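/- **Setting.** Let $T>0$, let $\Omega\subset\mathbb R^2$ be a bounded domain with $C^2$ boundary, let $\mathcal O\supset\Omega$ be another one, and write $\Omega_T=(0,T)\times\Omega$, $\mathcal O_T=(0,T)\times\mathcal O$. Let $\bar\sigma\in C^2([0,T]\times\overline\Omega)$, and let $\bar y\in C^2([0,T]\times\overline\Omega;\mathbb R^2)$ be divergence free in $\Omega_T$ and extended to a $C^2$ field on $[0,T]\times\mathbb R^2$ with bounded spatial gradient. Let $\bar X(t,\tau,x)$ be the flow of $\bar y$, i.e. $\partial_t\bar X(t,\tau,x)=\bar y(t,\bar X(t,\tau,x))$, $\bar X(\tau,\tau,x)=x$. Assume that for every $x\in\overline\Omega$ there is $t\in(0,T)$ with $\bar X(t,0,x)\notin\overline\Omega$. **Exit constants.** Numbers $T_0^*,T_1^*,\varsigma>0$ are called *exit constants* if for some $\varepsilon>0$ the following holds for all $T_0\in(0,T_0^*)$, $T_1\in(0,T_1^*)$, $x\in\overline\Omega$: there is $t\in[T_0,T-2T_1]$ with $d(\bar X(t,T_0,x),\Omega)\ge2\varepsilon$; and for every $w\in L^2(0,T;H^2(\mathbb R^2)^2)$ with $\|w\|_{L^2(0,T;L^\infty(\mathbb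 R^2))}\le2\varsigma$, the flow $X$ of $\bar y+w$ satisfies $d(X(t,T_0,x),\Omega)\ge\varepsilon$ for some $t\in[T_0,T-2T_1]$. **Weights.** Let $m\ge1$, let $T_0\in(0,T_0^*)$, $T_1\in(0,T_1^*)$ with $T_1\le\frac14$ and $T_0+2T_1<T$, where $T_0^*,T_1^*,\varsigma$ are exit constants. Let $\tilde\psi\in C^2([0,T]\times\overline{\mathcal O})$ take values in $[0,1]$, with $\partial_{\mathbf n}\tilde\psi\le0$ on $(0,T)\times\partial\mathcal O$, and such that for each $t\in[0,T]$, $\tilde\psi(t,\cdot)$ is constant on $\partial\mathcal O$, equal to $\inf_{\mathcal O}\tilde\psi(t,\cdot)$. Put $\psi=\tilde\psi+6m$ and assume $\partial_t\psi+\bar y\cdot\nabla\psi=0$ in $\Omega_T$. For $s,\lambda\ge1$ let $\mu=s\lambda^2e^{\lambda(6m-4)}$ and let $\theta\in C^2([0,T))$ satisfy $\theta(t)=1+(1-t/T_0)^\mu$ on $[0,T_0]$, $\theta=1$ on $[T_0,T-2T_1]$, $\theta(t)=(T-t)^{-m}$ on $[T-T_1,T)$, and $\theta$ nondecreasing on $[T-2T_1,T-T_1]$.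 Set $$\varphi=\theta\big(\lambda e^{6\lambda(m+1)}-e^{\lambda\psi}\big),\quad \xi=\theta e^{\lambda\psi},\quad \aleph=\xi^{-2}e^{s\varphi},\quad \varphi^*(t)=\max_{\overline{\mathcal O}}\varphi(t,\cdot).$$ **Perturbation.** Let $K\ge0$. Let $\hat u:\Omega_T\to\mathbb R^2$ satisfy $\operatorname{div}\hat u=0$ in $\Omega_T$, $\aleph\hat u\in L^2(\Omega_T)$ and $\|e^{3s\varphi^*/4}\hat u\|_{L^2(0,T;H^2(\Omega))}\le\varsigma$. It is extended to $(0,T)\times\mathbb R^2$, with the extension still denoted $\hat u$, so that $\|\hat u(t)\|_{H^2(\mathbb R^2)}\le K\|\hat u(t)\|_{H^2(\Omega)}$ for a.e. $t$. Let $\hat X$ be the flow of $\bar y+\hat u$ (integrated in time, with the representative of $\hat u(t)$ that is continuous in space). **Controlled density.** Let $\rho_0\in L^\infty(\Omega)$. The following transport problems are solved along the characteristics $\tau\mapsto\hat X(\tau,t,x)$: on each piece of characteristic inside $\Omega$ the solution is an integral of the right-hand side, and boundary values are the limits along characteristics at the points of $\partial\Omega$ through which they enter (resp. leave) $\Omega$.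 - $\rho_f$ solves $\partial_t\rho_f+(\bar y+\hat u)\cdot\nabla\rho_f=-\hat u\cdot\nabla\bar\sigma$ in $\Omega_T$, $\rho_f(0)=\rho_0$, $\rho_f=0$ on the inflow boundary. - $\rho_b$ solves the same equation with $\rho_b(T)=0$, $\rho_b=0$ on the outflow boundary. - $\chi$ solves $\partial_t\chi+(\bar y+\hat u)\cdot\nabla\chi=0$ in $\Omega_T$, $\chi(0)=1$, and on the inflow boundary $\chi=1$ at times $t<T_0$, $\chi=0$ at times $t\ge T_0$. Put $\rho=(1-\chi)\rho_b+\chi\rho_f$. **Theorem.** Exit constants exist. Moreover, for all exit constants $T_0^*,T_1^*,\varsigma$ and all $T_0,T_1,m,\tilde\psi,K$ as above, there are $C>0$ and $s_0\ge1$ such that for all $s\ge s_0$, $\lambda\ge1$, and all $\theta$, $\hat u$, $\rho_0$ as above (so $C$ and $s_0$ do not depend on $s,\lambda,\theta,\hat u,\rho_0$), the function $\rho$ is measurable on $\Omega_T$ and $$\|\aleph\rho\|_{L^2(\Omega_T)}\le C\Big(\|\aleph\hat u\|_{L^2(0,T;L^2(\Omega))}+e^{s\varphi^*(0)}\|\rho_0\|_{L^2(\Omega)}\Big),$$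 $$\big\|e^{s\lambda e^{6\lambda(m+1)}\theta(t)/2}\rho\big\|_{L^\infty(\Omega_T)}\le C\Big(\big\|e^{s\lambda e^{6\lambda(m+1)}\theta(t)/2}\hat u\big\|_{L^2(0,T;L^\infty(\Omega))}+e^{s\lambda e^{6\lambda(m+1)}}\|\rho_0\|_{L^\infty(\Omega)}\Big).$$ -/

import Mathlib

open MeasureTheory Set Filter Topology
open scoped ENNReal NNReal ContDiff

noncomputable section

namespace DensityControl

/-- The Euclidean plane. -/
abbrev Plane : Type := EuclideanSpace ℝ (Fin 2)

/-- The `i`-th vector of the canonical basis. -/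
def unitVec (i : Fin 2) : Plane := EuclideanSpace.single i 1

/-! ### Domains of class `C²` -/

/-- Near the boundary point `x`, the set `U` is the sublevel set `{g < 0}` of the `C²` function `g`,
whose differential does not vanish at `x`. -/
structure IsLocalDefining (U : Set Plane) (x : Plane) (g : Plane → ℝ) : Prop where
  contDiff : ContDiff ℝ 2 g
  grad_ne : fderiv ℝ g x ≠ 0
  mem_iff : ∀ᶠ y in 𝓝 x, (y ∈ U ↔ g y < 0)

/-- Bounded domain (nonempty connected open set) of the plane with boundary of class `C²`. -/
structure IsC2Domain (U : Set Plane) : Prop where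
  isOpen : IsOpen U
  isConnected : IsConnected U
  isBounded : Bornology.IsBounded U
  boundary : ∀ x ∈ frontier U, ∃ g : Plane → ℝ, IsLocalDefining U x g

/-- `n` is the outward unit normal of `U` at the boundary point `x`. -/
def IsOutwardNormal (U : Set Plane) (x n : Plane) : Prop :=
  ∃ g : Plane → ℝ, IsLocalDefining U x g ∧ n = ‖gradient g x‖⁻¹ • gradient g x

/-! ### Sobolev and Bochner norms -/

/-- `D` is the weak `i`-th partial derivative of `v` in the open set `U`. -/
def IsWeakPartial (U : Set Plane) (i : Fin 2) (v D : Plane → Plane) : Prop :=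
  ∀ η : Plane → ℝ, ContDiff ℝ ∞ η → HasCompactSupport η → tsupport η ⊆ U →
    ∫ x in U, fderiv ℝ η x (unitVec i) • v x = - ∫ x in U, η x • D x

/-- `v ∈ H²(U)`, with first weak derivatives `D₁` and second weak derivatives `D₂`. -/
structure IsH2Jet (U : Set Plane) (v : Plane → Plane) (D₁ : Fin 2 → Plane → Plane)
    (D₂ : Fin 2 → Fin 2 → Plane → Plane) : Prop where
  memLp : MemLp v 2 (volume.restrict U)
  memLp₁ : ∀ i, MemLp (D₁ i) 2 (volume.restrict U)
  memLp₂ : ∀ i j, MemLp (D₂ i j) 2 (volume.restrict U)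
  weak₁ : ∀ i, IsWeakPartial U i v (D₁ i)
  weak₂ : ∀ i j, IsWeakPartial U j (D₁ i) (D₂ i j)

/-- The `H²(U)` norm of a vector field. Weak derivatives are unique almost everywhere, so the
infimum is over a single value if `v ∈ H²(U)`, and it is `∞` if `v ∉ H²(U)`. -/
def h2norm (U : Set Plane) (v : Plane → Plane) : ℝ≥0∞ :=
  ⨅ (D₁ : Fin 2 → Plane → Plane) (D₂ : Fin 2 → Fin 2 → Plane → Plane) (_ : IsH2Jet U v D₁ D₂),
    (eLpNorm v 2 (volume.restrict U) ^ 2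
      + ∑ i, eLpNorm (D₁ i) 2 (volume.restrict U) ^ 2
      + ∑ i, ∑ j, eLpNorm (D₂ i j) 2 (volume.restrict U) ^ 2) ^ (1 / 2 : ℝ)

/-- The norm of `L²(0,T; H²(U))`. -/
def l2h2norm (T : ℝ) (U : Set Plane) (v : ℝ → Plane → Plane) : ℝ≥0∞ :=
  (∫⁻ t in Ioo 0 T, h2norm U (v t) ^ 2) ^ (1 / 2 : ℝ)

/-- The norm of `L²(0,T; L^∞(U))`. -/
def l2linfnorm (T : ℝ) (U : Set Plane) (v : ℝ → Plane → Plane) : ℝ≥0∞ :=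
  (∫⁻ t in Ioo 0 T, eLpNorm (v t) ∞ (volume.restrict U) ^ 2) ^ (1 / 2 : ℝ)

/-- Membership in `L²(0,T; H²(U))` (for a jointly measurable field). -/
def MemL2H2 (T : ℝ) (U : Set Plane) (v : ℝ → Plane → Plane) : Prop :=
  (∀ᵐ t ∂(volume.restrict (Ioo 0 T)), h2norm U (v t) < ⊤) ∧ l2h2norm T U v < ⊤

/-- A jointly measurable velocity field on the plane which is continuous in space for almost every
time. Every element of `L²(0,T; H²(ℝ²))` has such a representative since `H²(ℝ²) ⊂ C⁰(ℝ²)`, and it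
is the one that the flow is computed with. -/
structure IsContinuousRep (T : ℝ) (v : ℝ → Plane → Plane) : Prop where
  measurable : Measurable (Function.uncurry v)
  continuous : ∀ᵐ t ∂(volume.restrict (Ioo 0 T)), Continuous (v t)

/-- `div v(t) = 0` in `U`, in the sense of distributions, for almost every `t ∈ (0,T)`. -/
def IsWeaklyDivFree (T : ℝ) (U : Set Plane) (v : ℝ → Plane → Plane) : Prop :=
  ∀ᵐ t ∂(volume.restrict (Ioo 0 T)), ∀ η : Plane → ℝ,
    ContDiff ℝ ∞ η → HasCompactSupport η → tsupport η ⊆ U →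
      ∫ x in U, fderiv ℝ η x (v t x) = 0

/-! ### Flows -/

/-- `X = X(t, τ, x)` is the flow of `v` on `[0,T]`:
`∂ₜ X(t,τ,x) = v(t, X(t,τ,x))`, `X(τ,τ,x) = x`, in the integrated (Carathéodory) sense. -/
def IsFlow (T : ℝ) (v : ℝ → Plane → Plane) (X : ℝ → ℝ → Plane → Plane) : Prop :=
  ∀ τ ∈ Icc 0 T, ∀ x : Plane,
    IntervalIntegrable (fun r => v r (X r τ x)) volume 0 T ∧
    ∀ t ∈ Icc 0 T, X t τ x = x + ∫ r in τ..t, v r (X r τ x)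

/-- The target velocity, extended to `[0,T] × ℝ²`: of class `C²`, with bounded spatial gradient,
and divergence free in `(0,T) × Ω`. -/
structure IsTargetVelocity (T : ℝ) (Ω : Set Plane) (ybar : ℝ → Plane → Plane) : Prop where
  contDiffOn : ContDiffOn ℝ 2 (Function.uncurry ybar) (Icc 0 T ×ˢ univ)
  lipschitz : ∃ L : ℝ≥0, ∀ t ∈ Icc 0 T, LipschitzWith L (ybar t)
  divFree : ∀ t ∈ Ioo 0 T, ∀ x ∈ Ω, ∑ i, (fderiv ℝ (ybar t) x (unitVec i)) i = 0

/-- Every particle of `closure Ω` at time `0` leaves `closure Ω` before time `T`. -/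
def AllParticlesExit (T : ℝ) (Ω : Set Plane) (Xbar : ℝ → ℝ → Plane → Plane) : Prop :=
  ∀ x ∈ closure Ω, ∃ t ∈ Ioo 0 T, Xbar t 0 x ∉ closure Ω

/-- `T₀*`, `T₁*` and `ς` are exit constants: for some `ε > 0` and for all `T₀ ∈ (0,T₀*)` and
`T₁ ∈ (0,T₁*)`, each particle of `closure Ω` at time `T₀` is at distance at least `2ε` from `Ω` at
some time of `[T₀, T - 2T₁]` under the flow of `ybar`, and at distance at least `ε` from `Ω` at some
time of `[T₀, T - 2T₁]` under the flow of `ybar + w`, for all `w ∈ L²(0,T; H²(ℝ²))` with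
`L²(0,T; L^∞(ℝ²))` norm at most `2ς`. -/
def IsExitData (T : ℝ) (Ω : Set Plane) (ybar : ℝ → Plane → Plane) (Xbar : ℝ → ℝ → Plane → Plane)
    (T0s T1s sig : ℝ) : Prop :=
  0 < T0s ∧ 0 < T1s ∧ 0 < sig ∧ ∃ ε : ℝ, 0 < ε ∧
    (∀ T0 ∈ Ioo 0 T0s, ∀ T1 ∈ Ioo 0 T1s, ∀ x ∈ closure Ω,
      ∃ t ∈ Icc T0 (T - 2 * T1), 2 * ε ≤ Metric.infDist (Xbar t T0 x) Ω) ∧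
    (∀ w : ℝ → Plane → Plane, IsContinuousRep T w → MemL2H2 T univ w →
      l2linfnorm T univ w ≤ ENNReal.ofReal (2 * sig) →
      ∀ X : ℝ → ℝ → Plane → Plane, IsFlow T (fun t x => ybar t x + w t x) X →
        ∀ T0 ∈ Ioo 0 T0s, ∀ T1 ∈ Ioo 0 T1s, ∀ x ∈ closure Ω,
          ∃ t ∈ Icc T0 (T - 2 * T1), ε ≤ Metric.infDist (X t T0 x) Ω)

/-! ### Transport equations in a domain, solved along the characteristics -/

/-- `f` solves `∂ₜ f + v · ∇f = g` in `(0,T) × Ω` along the characteristics, where `X` is the flow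
of `v`: on every piece of characteristic that stays in `Ω`, the derivative of `f` is `g`. -/
def IsTransported (T : ℝ) (Ω : Set Plane) (X : ℝ → ℝ → Plane → Plane) (g f : ℝ → Plane → ℝ) :
    Prop :=
  ∀ t ∈ Icc 0 T, ∀ x ∈ Ω, ∀ τ ∈ Icc 0 T, (∀ r ∈ uIcc τ t, X r t x ∈ Ω) →
    f t x - f τ (X τ t x) = ∫ r in τ..t, g r (X r t x)

/-- `f = b` on the inflow boundary: along each characteristic that enters `Ω` at time `τ` through a
point of `∂Ω`, the limit of `f` at the entrance is `b τ`. -/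
def HasInflowData (T : ℝ) (Ω : Set Plane) (X : ℝ → ℝ → Plane → Plane) (b : ℝ → ℝ)
    (f : ℝ → Plane → ℝ) : Prop :=
  ∀ t ∈ Icc 0 T, ∀ x ∈ Ω, ∀ τ ∈ Ico 0 t, X τ t x ∈ frontier Ω → (∀ r ∈ Ioc τ t, X r t x ∈ Ω) →
    Tendsto (fun r => f r (X r t x)) (𝓝[>] τ) (𝓝 (b τ))

/-- `f = b` on the outflow boundary: along each characteristic that leaves `Ω` at time `τ` through a
point of `∂Ω`, the limit of `f` at the exit is `b τ`. -/
def HasOutflowData (T : ℝ) (Ω : Set Plane) (X : ℝ → ℝ → Plane → Plane) (b : ℝ → ℝ)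
    (f : ℝ → Plane → ℝ) : Prop :=
  ∀ t ∈ Icc 0 T, ∀ x ∈ Ω, ∀ τ ∈ Ioc t T, X τ t x ∈ frontier Ω → (∀ r ∈ Ico t τ, X r t x ∈ Ω) →
    Tendsto (fun r => f r (X r t x)) (𝓝[<] τ) (𝓝 (b τ))

/-- The source term `- u · ∇σ`. -/
def source (sigbar : ℝ → Plane → ℝ) (u : ℝ → Plane → Plane) (t : ℝ) (x : Plane) : ℝ :=
  - fderiv ℝ (sigbar t) x (u t x)

/-- Forward solution: initial value `ρ₀`, and `0` on the inflow boundary. -/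
structure IsForwardDensity (T : ℝ) (Ω : Set Plane) (X : ℝ → ℝ → Plane → Plane)
    (sigbar : ℝ → Plane → ℝ) (u : ℝ → Plane → Plane) (ρ₀ : Plane → ℝ) (ρf : ℝ → Plane → ℝ) :
    Prop where
  eqn : IsTransported T Ω X (source sigbar u) ρf
  inflow : HasInflowData T Ω X (fun _ => 0) ρf
  initial : ∀ x ∈ Ω, ρf 0 x = ρ₀ x

/-- Backward solution: final value `0`, and `0` on the outflow boundary. -/
structure IsBackwardDensity (T : ℝ) (Ω : Set Plane) (X : ℝ → ℝ → Plane → Plane)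
    (sigbar : ℝ → Plane → ℝ) (u : ℝ → Plane → Plane) (ρb : ℝ → Plane → ℝ) : Prop where
  eqn : IsTransported T Ω X (source sigbar u) ρb
  outflow : HasOutflowData T Ω X (fun _ => 0) ρb
  final : ∀ x ∈ Ω, ρb T x = 0

/-- Transported cut-off: initial value `1`, and, on the inflow boundary, `1` before `T₀` and `0`
from `T₀` on. -/
structure IsCutoff (T T0 : ℝ) (Ω : Set Plane) (X : ℝ → ℝ → Plane → Plane) (χ : ℝ → Plane → ℝ) :
    Prop where
  eqn : IsTransported T Ω X (fun _ _ => 0) χ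
  inflow : HasInflowData T Ω X (fun τ => if τ < T0 then 1 else 0) χ
  initial : ∀ x ∈ Ω, χ 0 x = 1

/-- The controlled density `(1 - χ) ρ_b + χ ρ_f`. -/
def glue (χ ρb ρf : ℝ → Plane → ℝ) (t : ℝ) (x : Plane) : ℝ :=
  (1 - χ t x) * ρb t x + χ t x * ρf t x

/-! ### Weights -/

/-- The basic spatial weight `ψ̃` on `[0,T] × closure O`. -/
structure IsSpaceWeight (T : ℝ) (O : Set Plane) (psit : ℝ → Plane → ℝ) : Prop where
  contDiffOn : ContDiffOn ℝ 2 (Function.uncurry psit) (Icc 0 T ×ˢ closure O)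
  range : ∀ t ∈ Icc 0 T, ∀ x ∈ closure O, psit t x ∈ Icc (0 : ℝ) 1
  normal : ∀ t ∈ Ioo 0 T, ∀ x ∈ frontier O, ∀ n : Plane, IsOutwardNormal O x n →
    fderivWithin ℝ (psit t) (closure O) x n ≤ 0
  boundary : ∀ t ∈ Icc 0 T, ∃ c : ℝ, (∀ x ∈ frontier O, psit t x = c) ∧ IsGLB (psit t '' O) c

/-- `ψ = ψ̃ + 6m`. -/
def psi (m : ℝ) (psit : ℝ → Plane → ℝ) (t : ℝ) (x : Plane) : ℝ := psit t x + 6 * m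

/-- `∂ₜ f + ybar · ∇f = 0` in `(0,T) × Ω`, classically. -/
def IsTransportedBy (T : ℝ) (Ω : Set Plane) (ybar : ℝ → Plane → Plane) (f : ℝ → Plane → ℝ) :
    Prop :=
  ∀ t ∈ Ioo 0 T, ∀ x ∈ Ω, deriv (fun r => f r x) t + fderiv ℝ (f t) x (ybar t x) = 0

/-- The weight in time `θ = θ_{m,μ}` on `[0,T)`. -/
structure IsTimeWeight (T T0 T1 m μ : ℝ) (θ : ℝ → ℝ) : Prop where
  initial : ∀ t ∈ Icc 0 T0, θ t = 1 + (1 - t / T0) ^ μ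
  middle : ∀ t ∈ Icc T0 (T - 2 * T1), θ t = 1
  final : ∀ t ∈ Ico (T - T1) T, θ t = 1 / (T - t) ^ m
  mono : MonotoneOn θ (Icc (T - 2 * T1) (T - T1))
  contDiffOn : ContDiffOn ℝ 2 θ (Ico 0 T)

/-- `μ = s λ² e^{λ(6m - 4)}`. -/
def muExp (m s lam : ℝ) : ℝ := s * lam ^ 2 * Real.exp (lam * (6 * m - 4))

/-- `Λ = λ e^{6λ(m+1)}`. -/
def bigLam (m lam : ℝ) : ℝ := lam * Real.exp (6 * lam * (m + 1))

/-- `φ = θ (λ e^{6λ(m+1)} - e^{λψ})`. -/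
def phi (m lam : ℝ) (θ : ℝ → ℝ) (ψ : ℝ → Plane → ℝ) (t : ℝ) (x : Plane) : ℝ :=
  θ t * (bigLam m lam - Real.exp (lam * ψ t x))

/-- `ξ = θ e^{λψ}`. -/
def xi (lam : ℝ) (θ : ℝ → ℝ) (ψ : ℝ → Plane → ℝ) (t : ℝ) (x : Plane) : ℝ :=
  θ t * Real.exp (lam * ψ t x)

/-- `φ*(t)`, the maximum of `φ(t,·)` over `closure O`. -/
def phiStar (O : Set Plane) (m lam : ℝ) (θ : ℝ → ℝ) (ψ : ℝ → Plane → ℝ) (t : ℝ) : ℝ :=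
  sSup (phi m lam θ ψ t '' closure O)

/-- `ℵ = ξ⁻² e^{sφ}`. -/
def aleph (m s lam : ℝ) (θ : ℝ → ℝ) (ψ : ℝ → Plane → ℝ) (t : ℝ) (x : Plane) : ℝ :=
  (xi lam θ ψ t x ^ 2)⁻¹ * Real.exp (s * phi m lam θ ψ t x)

/-- `e^{s λ e^{6λ(m+1)} θ(t) / 2}`. -/
def linfWeight (m s lam : ℝ) (θ : ℝ → ℝ) (t : ℝ) : ℝ :=
  Real.exp (s * bigLam m lam * θ t / 2)

/-- Lebesgue measure on `Ω_T = (0,T) × Ω`. -/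
def cylMeasure (T : ℝ) (Ω : Set Plane) : Measure (ℝ × Plane) :=
  volume.restrict (Ioo 0 T ×ˢ Ω)

/-- Admissible perturbations `û` of the velocity, given together with their extension to the plane:
`û` is divergence free in `Ω_T`, its extension has `H²(ℝ²)` norm at most `K` times its `H²(Ω)` norm,
`ℵ û ∈ L²(Ω_T)`, and `e^{3sφ*/4} û` has norm at most `ς` in `L²(0,T; H²(Ω))`. -/
structure IsAdmissible (T : ℝ) (Ω O : Set Plane) (K : ℝ≥0) (sig m s lam : ℝ) (θ : ℝ → ℝ)
    (ψ : ℝ → Plane → ℝ) (u : ℝ → Plane → Plane) : Prop where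
  rep : IsContinuousRep T u
  extension : ∀ᵐ t ∂(volume.restrict (Ioo 0 T)), h2norm univ (u t) ≤ K * h2norm Ω (u t)
  divFree : IsWeaklyDivFree T Ω u
  memL2 : MemLp (fun p : ℝ × Plane => aleph m s lam θ ψ p.1 p.2 • u p.1 p.2) 2 (cylMeasure T Ω)
  memL2H2 : MemL2H2 T Ω (fun t x => Real.exp (3 * s * phiStar O m lam θ ψ t / 4) • u t x)
  small : l2h2norm T Ω (fun t x => Real.exp (3 * s * phiStar O m lam θ ψ t / 4) • u t x)
    ≤ ENNReal.ofReal sig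

end DensityControl

end

/-!
The perturbed density has an explicit formula along the characteristics of `ybar + û`. Fix `(t, x)`
and call `r` reachable if the characteristic through `(t, x)` stays in `Ω` between `r` and `t`. Then
`ρ_f (t, x)` is the integral of the source `- û · ∇σ` over the reachable times before `t` (plus `ρ₀`
at the foot, if time `0` is reachable), `ρ_b (t, x)` is minus its integral over the reachable times
after `t`, and the cut-off `χ` is the indicator of `t < T₀` or `T₀` reachable. So `ρ` only looks
backward where `χ = 1` and only forward where `χ = 0` (`IsPerturbedFlow.glue_eq`).

The exit property makes this compatible with the weights. No characteristic stays in `Ω` from `T₀` to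
`T - 2 T₁` (`IsExitData.not_stays`), so backward integrals are used only for `t ≤ T - 2 T₁`, where
`θ` decreases, and forward integrals only for `t ≥ T₀`, where `θ` increases: `θ` is always smallest
at `t`. The function `ψ` is constant along `ybar`, so along a perturbed characteristic it varies by
at most `C ∫ ‖û‖_∞`, and the logarithm of `ℵ` by at most `C s λ θ(t) e^{λ(6m+1)} ∫ ‖û‖_∞`. The
assumption on `e^{3sφ*/4} û` and the embedding of `H²(ℝ²)` in `L^∞` bound this uniformly in `s` and
`λ` (`IsAdmissible.aleph_le_along`). Hence `ℵ(t, x) ≤ C ℵ(r, X(r,t,x))` for all the times that occur,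
which gives a pointwise bound of `ℵ ρ` by integrals of `ℵ û` along characteristics
(`IsTransportWeight.enorm_mul_densityFormula_le`). The same holds for the weight of the `L^∞` estimate,
which only depends on time. For `s` large, `û` is also small enough for the exit property to apply to
`ybar + û`.

For `L²` norms, the flow has to preserve areas, or at least not to compress them, although `û(t)` is
only in `H²(ℝ²)`, which does not embed in the Lipschitz functions. It embeds in the functions with
modulus of continuity `|x - y| √|log |x - y||`, proved here by duality and a Fourier splitting
(`enorm_sub_le_h2norm`), in the form `‖v x - v y‖ ≤ C (√(log N) ‖x - y‖ + 1 / N)` for all `N`. The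
corresponding Gronwall factor is `e^{C √(log N)} = o(N)`, which gives uniqueness and continuity of the
flow (`IsRegularField.continuousOn_flow`), and the convergence of the Euler scheme of a mollified
velocity (`IsRegularField.exists_euler_close`). An Euler step for a smooth velocity with zero
divergence has Jacobian determinant `1 + O(step²)`, so the scheme does not compress areas by more than
a factor `2`, and neither does the limit, for the particles that stay in `Ω`
(`IsRegularField.volume_flow_le`). This factor is all the estimates need; it also shows that `ρ` does
not depend on the representative of `ρ₀`.

Exit constants exist by compactness of `closure Ω` and Gronwall's inequality for the Lipschitz
velocity `ybar` (`exists_isExitData`).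
-/

noncomputable section

namespace DensityControl

/-! ### The embedding of `H²(ℝ²)` -/

open scoped SchwartzMap FourierTransform LineDeriv Laplacian

/-- Integration by parts against a weak derivative in the whole plane holds for Schwartz test
functions as well. -/
lemma IsWeakPartial.integral_lineDeriv_smul {i : Fin 2} {v D : Plane → Plane}
    (h : IsWeakPartial univ i v D) (hv : MemLp v 2 volume) (hD : MemLp D 2 volume)
    (g : 𝓢(Plane, ℝ)) :
    ∫ x, (∂_{unitVec i} g) x • v x = - ∫ x, g x • D x := by
  let φ : ContDiffBump (0 : Plane) := ⟨1, 2, one_pos, one_lt_two⟩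
  have hφ1 : ContDiff ℝ 1 φ := φ.contDiff
  obtain ⟨M, hM⟩ : ∃ M, ∀ x, ‖fderiv ℝ φ x‖ ≤ M :=
    (φ.hasCompactSupport.fderiv (𝕜 := ℝ)).exists_bound_of_continuous
      (hφ1.continuous_fderiv one_ne_zero)
  have hM0 : 0 ≤ M := (norm_nonneg _).trans (hM 0)
  have hφabs : ∀ x, |φ x| ≤ 1 := fun x => by
    rw [abs_of_nonneg φ.nonneg]; exact φ.le_one
  let c : ℕ → ℝ := fun n => ((n : ℝ) + 1)⁻¹
  have hc0 : ∀ n, 0 < c n := fun n => by positivity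
  have hc1 : ∀ n, c n ≤ 1 := fun n => inv_le_one_of_one_le₀ (by simp)
  have hc : Tendsto c atTop (𝓝 0) := tendsto_inv_atTop_zero.comp
    (tendsto_atTop_add_const_right _ _ tendsto_natCast_atTop_atTop)
  let η : ℕ → Plane → ℝ := fun n x => φ (c n • x) * g x
  have hφd : ∀ y, HasFDerivAt φ (fderiv ℝ φ y) y := fun y =>
    ((hφ1.differentiable one_ne_zero) y).hasFDerivAt
  have hηd : ∀ n x, fderiv ℝ (η n) x (unitVec i) =
      φ (c n • x) * (∂_{unitVec i} g) x + c n * (fderiv ℝ φ (c n • x) (unitVec i)) * g x := by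
    intro n x
    have h1 : HasFDerivAt (fun x : Plane => φ (c n • x))
        ((fderiv ℝ φ (c n • x)).comp (c n • ContinuousLinearMap.id ℝ Plane)) x :=
      (hφd (c n • x)).comp x ((hasFDerivAt_id x).const_smul (c n))
    have h2 : HasFDerivAt (η n) _ x := h1.mul (g.differentiableAt (x := x)).hasFDerivAt
    rw [h2.fderiv]
    simp [SchwartzMap.lineDerivOp_apply_eq_fderiv]
    ring
  have hηs : ∀ n, ContDiff ℝ ∞ (η n) := fun n =>
    (φ.contDiff.comp (contDiff_const_smul (c n))).mul g.smooth'
  have hηc : ∀ n, HasCompactSupport (η n) := fun n =>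
    (φ.hasCompactSupport.comp_homeomorph (Homeomorph.smulOfNeZero (c n) (hc0 n).ne')).mul_right
  have key : ∀ n, ∫ x, fderiv ℝ (η n) x (unitVec i) • v x = - ∫ x, η n x • D x := fun n => by
    simpa using h (η n) (hηs n) (hηc n) (subset_univ _)
  have hφlim : ∀ x, Tendsto (fun n => φ (c n • x)) atTop (𝓝 1) := fun x => by
    have h0 : Tendsto (fun n => c n • x) atTop (𝓝 0) := by simpa using hc.smul_const x
    have := (φ.continuous.tendsto 0).comp h0
    rwa [φ.one_of_mem_closedBall (by simp [φ.rIn_pos.le])] at this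
  have hmul : ∀ (f : 𝓢(Plane, ℝ)) (w : Plane → Plane), MemLp w 2 volume →
      Integrable (fun x => ‖f x‖ * ‖w x‖) volume := fun f w hw =>
    ((f.memLp 2 volume).norm).integrable_mul hw.norm
  have lim1 : Tendsto (fun n => ∫ x, fderiv ℝ (η n) x (unitVec i) • v x) atTop
      (𝓝 (∫ x, (∂_{unitVec i} g) x • v x)) := by
    refine tendsto_integral_of_dominated_convergence
      (fun x => ‖(∂_{unitVec i} g) x‖ * ‖v x‖ + M * ‖unitVec i‖ * (‖g x‖ * ‖v x‖)) ?_ ?_ ?_ ?_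
    · intro n
      exact (((hηs n).continuous_fderiv (by simp)).clm_apply
        continuous_const).aestronglyMeasurable.smul hv.1
    · exact (hmul _ v hv).add ((hmul _ v hv).const_mul _)
    · intro n
      refine Eventually.of_forall fun x => ?_
      rw [norm_smul, hηd, ← mul_assoc, ← add_mul]
      gcongr
      refine (norm_add_le _ _).trans (add_le_add ?_ ?_)
      · rw [norm_mul, Real.norm_eq_abs]
        exact mul_le_of_le_one_left (norm_nonneg _) (hφabs _)
      · rw [norm_mul, norm_mul]
        refine mul_le_mul_of_nonneg_right ?_ (norm_nonneg _)
        calc ‖c n‖ * ‖fderiv ℝ φ (c n • x) (unitVec i)‖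
            ≤ 1 * (M * ‖unitVec i‖) := by
              gcongr
              · rw [Real.norm_eq_abs, abs_of_pos (hc0 n)]; exact hc1 n
              · exact (ContinuousLinearMap.le_opNorm _ _).trans (by gcongr; exact hM _)
          _ = M * ‖unitVec i‖ := one_mul _
    · refine Eventually.of_forall fun x => ?_
      refine Tendsto.smul_const ?_ _
      simp_rw [hηd]
      have h2 : Tendsto (fun n => c n * (fderiv ℝ φ (c n • x) (unitVec i)) * g x) atTop (𝓝 0) := by
        have h0 : Tendsto (fun n => c n • x) atTop (𝓝 0) := by simpa using hc.smul_const x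
        have h3 : Tendsto (fun n => fderiv ℝ φ (c n • x) (unitVec i)) atTop
            (𝓝 (fderiv ℝ φ 0 (unitVec i))) :=
          (((hφ1.continuous_fderiv one_ne_zero).clm_apply continuous_const).tendsto 0).comp h0
        simpa using (hc.mul h3).mul_const (g x)
      simpa using ((hφlim x).mul_const ((∂_{unitVec i} g) x)).add h2
  have lim2 : Tendsto (fun n => ∫ x, η n x • D x) atTop (𝓝 (∫ x, g x • D x)) := by
    refine tendsto_integral_of_dominated_convergence (fun x => ‖g x‖ * ‖D x‖) ?_ (hmul g D hD) ?_ ?_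
    · exact fun n => (hηs n).continuous.aestronglyMeasurable.smul hD.1
    · intro n
      refine Eventually.of_forall fun x => ?_
      rw [norm_smul]
      gcongr
      rw [norm_mul, Real.norm_eq_abs]
      exact mul_le_of_le_one_left (norm_nonneg _) (hφabs _)
    · refine Eventually.of_forall fun x => Tendsto.smul_const ?_ _
      simpa using (hφlim x).mul_const (g x)
  refine tendsto_nhds_unique lim1 ?_
  simp_rw [key]
  exact lim2.neg

/-- The `H²` norm associated with given weak derivatives. -/
def jetNorm (U : Set Plane) (v : Plane → Plane) (D₁ : Fin 2 → Plane → Plane)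
    (D₂ : Fin 2 → Fin 2 → Plane → Plane) : ℝ≥0∞ :=
  (eLpNorm v 2 (volume.restrict U) ^ 2
      + ∑ i, eLpNorm (D₁ i) 2 (volume.restrict U) ^ 2
      + ∑ i, ∑ j, eLpNorm (D₂ i j) 2 (volume.restrict U) ^ 2) ^ (1 / 2 : ℝ)

lemma le_rpow_half {a b : ℝ≥0∞} (h : a ^ 2 ≤ b) : a ≤ b ^ (1 / 2 : ℝ) := by
  have := ENNReal.rpow_le_rpow h (by norm_num : (0 : ℝ) ≤ 1 / 2)
  rwa [← ENNReal.rpow_natCast_mul, show ((2 : ℕ) : ℝ) * (1 / 2) = 1 by norm_num,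
    ENNReal.rpow_one] at this

lemma eLpNorm_le_jetNorm (U : Set Plane) (v : Plane → Plane) (D₁ : Fin 2 → Plane → Plane)
    (D₂ : Fin 2 → Fin 2 → Plane → Plane) :
    eLpNorm v 2 (volume.restrict U) ≤ jetNorm U v D₁ D₂ :=
  le_rpow_half (by rw [add_assoc]; exact le_self_add)

lemma eLpNorm_second_le_jetNorm (U : Set Plane) (v : Plane → Plane) (D₁ : Fin 2 → Plane → Plane)
    (D₂ : Fin 2 → Fin 2 → Plane → Plane) (i j : Fin 2) :
    eLpNorm (D₂ i j) 2 (volume.restrict U) ≤ jetNorm U v D₁ D₂ := by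
  refine le_rpow_half (le_trans ?_ le_add_self)
  refine le_trans ?_ (Finset.single_le_sum
    (f := fun i => ∑ j, eLpNorm (D₂ i j) 2 (volume.restrict U) ^ 2)
    (fun _ _ => zero_le) (Finset.mem_univ i))
  exact Finset.single_le_sum (f := fun j => eLpNorm (D₂ i j) 2 (volume.restrict U) ^ 2)
    (fun _ _ => zero_le) (Finset.mem_univ j)

lemma unitVec_eq_basis (i : Fin 2) : unitVec i = EuclideanSpace.basisFun (Fin 2) ℝ i := by
  simp [unitVec]

lemma laplacian_eq_unitVec (g : 𝓢(Plane, ℝ)) :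
    Δ g = ∂_{unitVec 0} (∂_{unitVec 0} g) + ∂_{unitVec 1} (∂_{unitVec 1} g) := by
  rw [SchwartzMap.laplacian_eq_sum (EuclideanSpace.basisFun (Fin 2) ℝ), Fin.sum_univ_two,
    unitVec_eq_basis, unitVec_eq_basis]

lemma integral_sub_add {a b c : Plane → Plane} (ha : Integrable a) (hb : Integrable b)
    (hc : Integrable c) :
    ∫ x, (a x - (b x + c x)) = (∫ x, a x) - ((∫ x, b x) + ∫ x, c x) := by
  have hbc : Integrable (fun x => b x + c x) := hb.add hc
  rw [integral_sub ha hbc, integral_add hb hc]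

lemma IsH2Jet.integral_sub_laplacian_smul {v : Plane → Plane} {D₁ : Fin 2 → Plane → Plane}
    {D₂ : Fin 2 → Fin 2 → Plane → Plane} (h : IsH2Jet univ v D₁ D₂) (g : 𝓢(Plane, ℝ)) :
    ∫ x, (g - Δ g) x • v x = ∫ x, g x • (v x - (D₂ 0 0 x + D₂ 1 1 x)) := by
  have hv : MemLp v 2 volume := by simpa using h.memLp
  have h1 : ∀ i, MemLp (D₁ i) 2 volume := fun i => by simpa using h.memLp₁ i
  have h2 : ∀ i j, MemLp (D₂ i j) 2 volume := fun i j => by simpa using h.memLp₂ i j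
  have hint : ∀ (f : 𝓢(Plane, ℝ)) (w : Plane → Plane), MemLp w 2 volume →
      Integrable (fun x => f x • w x) volume := fun f w hw =>
    memLp_one_iff_integrable.1 (hw.smul (f.memLp 2 volume))
  have hii : ∀ i, ∫ x, (∂_{unitVec i} (∂_{unitVec i} g)) x • v x = ∫ x, g x • D₂ i i x := fun i => by
    rw [(h.weak₁ i).integral_lineDeriv_smul hv (h1 i) (∂_{unitVec i} g),
      (h.weak₂ i i).integral_lineDeriv_smul (h1 i) (h2 i i) g, neg_neg]
  have e1 : ∀ x, (g - Δ g) x • v x = g x • v x - ((∂_{unitVec 0} (∂_{unitVec 0} g)) x • v x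
      + (∂_{unitVec 1} (∂_{unitVec 1} g)) x • v x) := fun x => by
    rw [laplacian_eq_unitVec, sub_apply, add_apply, sub_smul, add_smul]
  have e2 : ∀ x, g x • (v x - (D₂ 0 0 x + D₂ 1 1 x)) =
      g x • v x - (g x • D₂ 0 0 x + g x • D₂ 1 1 x) := fun x => by rw [smul_sub, smul_add]
  rw [integral_congr_ae (Eventually.of_forall e1), integral_congr_ae (Eventually.of_forall e2),
    integral_sub_add (hint _ _ hv) (hint _ _ hv) (hint _ _ hv),
    integral_sub_add (hint _ _ hv) (hint _ _ (h2 0 0)) (hint _ _ (h2 1 1)), hii, hii]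

/-- Cauchy–Schwarz inequality for an integral of vectors. -/
lemma enorm_integral_smul_le_mul_eLpNorm {f : Plane → ℝ} {w : Plane → Plane}
    (hf : AEStronglyMeasurable f volume) (hw : AEStronglyMeasurable w volume) :
    ‖∫ x, f x • w x‖ₑ ≤ eLpNorm f 2 volume * eLpNorm w 2 volume := by
  have h := eLpNorm_smul_le_mul_eLpNorm (p := 2) (q := 2) (r := 1) hw hf
  rw [eLpNorm_one_eq_lintegral_enorm] at h
  exact (enorm_integral_le_lintegral_enorm _).trans h

/-- Pairing with `f = g - Δg` is controlled by the `L²` norm of `g`. -/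
lemma IsH2Jet.enorm_integral_sub_laplacian_smul_le {v : Plane → Plane} {D₁ : Fin 2 → Plane → Plane}
    {D₂ : Fin 2 → Fin 2 → Plane → Plane} (h : IsH2Jet univ v D₁ D₂) (g : 𝓢(Plane, ℝ)) :
    ‖∫ x, (g - Δ g) x • v x‖ₑ ≤ 3 * jetNorm univ v D₁ D₂ * eLpNorm g 2 volume := by
  have hv : MemLp v 2 volume := by simpa using h.memLp
  have h2 : ∀ i j, MemLp (D₂ i j) 2 volume := fun i j => by simpa using h.memLp₂ i j
  rw [h.integral_sub_laplacian_smul]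
  obtain ⟨w, hw⟩ : ∃ w : Plane → Plane, w = fun x => v x - (D₂ 0 0 x + D₂ 1 1 x) := ⟨_, rfl⟩
  have hwm : MemLp w 2 volume := hw ▸ hv.sub ((h2 0 0).add (h2 1 1))
  have hwS : eLpNorm w 2 volume ≤ 3 * jetNorm univ v D₁ D₂ := by
    have a0 := eLpNorm_le_jetNorm univ v D₁ D₂
    have aii := fun i => eLpNorm_second_le_jetNorm univ v D₁ D₂ i i
    simp only [Measure.restrict_univ] at a0 aii
    have a1 : eLpNorm w 2 volume ≤ eLpNorm v 2 volume +
        eLpNorm (fun x => D₂ 0 0 x + D₂ 1 1 x) 2 volume := by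
      rw [hw]
      exact eLpNorm_sub_le hv.1 ((h2 0 0).add (h2 1 1)).1 one_le_two
    have a2 : eLpNorm (fun x => D₂ 0 0 x + D₂ 1 1 x) 2 volume ≤
        eLpNorm (D₂ 0 0) 2 volume + eLpNorm (D₂ 1 1) 2 volume :=
      eLpNorm_add_le (h2 0 0).1 (h2 1 1).1 one_le_two
    refine (a1.trans (add_le_add a0 (a2.trans (add_le_add (aii 0) (aii 1))))).trans (le_of_eq ?_)
    ring
  have hw' : ∀ x, g x • (v x - (D₂ 0 0 x + D₂ 1 1 x)) = g x • w x := fun x => by rw [hw]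
  rw [integral_congr_ae (Eventually.of_forall hw')]
  refine (enorm_integral_smul_le_mul_eLpNorm g.continuous.aestronglyMeasurable hwm.1).trans ?_
  rw [mul_comm]
  gcongr

lemma eLpNorm_fourier_eq (g : 𝓢(Plane, ℂ)) :
    eLpNorm (𝓕 g : 𝓢(Plane, ℂ)) 2 volume = eLpNorm g 2 volume := by
  have h := SchwartzMap.norm_fourier_toL2_eq g
  rw [SchwartzMap.norm_toLp, SchwartzMap.norm_toLp,
    ENNReal.toReal_eq_toReal_iff' ((𝓕 g).memLp 2 volume).2.ne (g.memLp 2 volume).2.ne] at h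
  exact h

/-- The Fourier multiplier of `(1 - Δ)⁻¹`. -/
def resolventSymbol (ξ : Plane) : ℝ := (1 + ‖(2 * Real.pi) • ξ‖ ^ 2) ^ (-1 : ℝ)

lemma resolventSymbol_hasTemperateGrowth : Function.HasTemperateGrowth resolventSymbol :=
  (Function.hasTemperateGrowth_one_add_norm_sq_rpow Plane (-1)).comp
    ((2 * Real.pi) • ContinuousLinearMap.id ℝ Plane).hasTemperateGrowth

lemma resolventSymbol_eq (ξ : Plane) :
    resolventSymbol ξ = (1 + (2 * Real.pi) ^ 2 * ‖ξ‖ ^ 2)⁻¹ := by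
  rw [resolventSymbol, Real.rpow_neg_one, norm_smul, mul_pow, Real.norm_eq_abs, sq_abs]

/-- `(1 - Δ)⁻¹ f`. -/
def resolvent (f : 𝓢(Plane, ℂ)) : 𝓢(Plane, ℂ) :=
  SchwartzMap.fourierMultiplierCLM ℂ resolventSymbol f

lemma fourier_resolvent (f : 𝓢(Plane, ℂ)) (ξ : Plane) :
    (𝓕 (resolvent f) : 𝓢(Plane, ℂ)) ξ = resolventSymbol ξ • (𝓕 f : 𝓢(Plane, ℂ)) ξ := by
  rw [resolvent, SchwartzMap.fourierMultiplierCLM_apply, FourierTransform.fourier_fourierInv_eq,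
    SchwartzMap.smulLeftCLM_apply_apply resolventSymbol_hasTemperateGrowth]

lemma fourier_laplacian_apply (g : 𝓢(Plane, ℂ)) (ξ : Plane) :
    (𝓕 (Δ g) : 𝓢(Plane, ℂ)) ξ = - ((2 * Real.pi) ^ 2 * ‖ξ‖ ^ 2) • (𝓕 g : 𝓢(Plane, ℂ)) ξ := by
  have h : (𝓕 (Δ g) : 𝓢(Plane, ℂ)) =
      -(2 * Real.pi) ^ 2 • SchwartzMap.smulLeftCLM ℂ (fun x : Plane => ‖x‖ ^ 2) (𝓕 g) := by
    rw [SchwartzMap.laplacian_eq_fourierMultiplierCLM, FourierTransform.fourier_smul,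
      SchwartzMap.fourierMultiplierCLM_apply, FourierTransform.fourier_fourierInv_eq]
  rw [h, smul_apply,
    SchwartzMap.smulLeftCLM_apply_apply (Function.hasTemperateGrowth_norm_sq Plane), smul_smul]
  ring_nf

lemma resolvent_sub_laplacian (f : 𝓢(Plane, ℂ)) : resolvent f - Δ (resolvent f) = f := by
  apply (FourierTransform.fourierEquiv ℂ 𝓢(Plane, ℂ)).injective
  ext ξ
  have h : (𝓕 (resolvent f - Δ (resolvent f)) : 𝓢(Plane, ℂ)) ξ = (𝓕 f : 𝓢(Plane, ℂ)) ξ := by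
    rw [sub_eq_add_neg, FourierTransform.fourier_add, FourierTransform.fourier_neg,
      ← sub_eq_add_neg, sub_apply, fourier_laplacian_apply, fourier_resolvent,
      smul_smul, ← sub_smul, resolventSymbol_eq]
    have : (1 + (2 * Real.pi) ^ 2 * ‖ξ‖ ^ 2) ≠ 0 := by positivity
    convert one_smul ℝ ((𝓕 f : 𝓢(Plane, ℂ)) ξ) using 2
    field_simp
    ring
  exact h

/-- `H²` regularity in dual form: the pairing of an `H²` field with a test function `f` is
controlled by the `H⁻²` norm of `f`, expressed on the Fourier side. -/
lemma IsH2Jet.enorm_integral_smul_le {v : Plane → Plane} {D₁ : Fin 2 → Plane → Plane}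
    {D₂ : Fin 2 → Fin 2 → Plane → Plane} (h : IsH2Jet univ v D₁ D₂) (f : 𝓢(Plane, ℂ))
    (fR : Plane → ℝ) (hf : ∀ x, f x = fR x) :
    ‖∫ x, fR x • v x‖ₑ ≤ 3 * jetNorm univ v D₁ D₂ *
      eLpNorm (fun ξ => resolventSymbol ξ * ‖(𝓕 f : 𝓢(Plane, ℂ)) ξ‖) 2 volume := by
  let g := resolvent f
  let r : 𝓢(Plane, ℝ) := SchwartzMap.postcompCLM Complex.reCLM g
  have hr : ∀ x, r x = (g x).re := fun x => rfl
  have hΔ : ∀ x, (Δ r) x = ((Δ g) x).re := fun x => by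
    rw [SchwartzMap.laplacian_apply, SchwartzMap.laplacian_apply]
    exact ContDiffAt.laplacian_CLM_comp_left (l := Complex.reCLM) (g.contDiffAt 2)
  have hfR : ∀ x, fR x = (r - Δ r) x := fun x => by
    have h1 : (g - Δ g) x = f x := by rw [resolvent_sub_laplacian]
    rw [sub_apply, hr, hΔ, ← Complex.sub_re, ← sub_apply, h1, hf, Complex.ofReal_re]
  have e : ∫ x, fR x • v x = ∫ x, (r - Δ r) x • v x := by simp_rw [hfR]
  rw [e]
  refine (h.enorm_integral_sub_laplacian_smul_le r).trans ?_
  gcongr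
  calc eLpNorm r 2 volume ≤ eLpNorm g 2 volume :=
        eLpNorm_mono fun x => by rw [hr]; exact Complex.abs_re_le_norm _
    _ = eLpNorm (𝓕 g : 𝓢(Plane, ℂ)) 2 volume := (eLpNorm_fourier_eq g).symm
    _ ≤ _ := eLpNorm_mono fun ξ => by
        rw [fourier_resolvent, norm_smul, norm_mul, norm_norm]

lemma sq_eLpNorm_two {α E : Type*} [MeasurableSpace α] [NormedAddCommGroup E] (f : α → E)
    (μ : Measure α) : eLpNorm f 2 μ ^ 2 = ∫⁻ x, ‖f x‖ₑ ^ 2 ∂μ := by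
  have h := eLpNorm_nnreal_pow_eq_lintegral (f := f) (μ := μ) (p := 2) two_ne_zero
  simpa using h

/-- The area of the unit disc. -/
def discArea : ℝ := volume.real (Metric.ball (0 : Plane) 1)

lemma discArea_nonneg : 0 ≤ discArea := measureReal_nonneg

/-- Integration of a nonnegative radial function in polar coordinates. -/
lemma lintegral_norm_plane (f : ℝ → ℝ) (hf : ∀ r, 0 ≤ f r)
    (hi : IntegrableOn (fun r => r * f r) (Ioi 0)) :
    ∫⁻ x : Plane, ENNReal.ofReal (f ‖x‖) =
      ENNReal.ofReal (2 * discArea * ∫ r in Ioi (0 : ℝ), r * f r) := by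
  have hi' : Integrable (fun x : Plane => f ‖x‖) := by
    rw [integrable_fun_norm_addHaar volume (f := f)]
    simpa [finrank_euclideanSpace] using hi
  rw [← ofReal_integral_eq_lintegral_ofReal hi' (Eventually.of_forall fun x => hf _),
    integral_fun_norm_addHaar volume f]
  simp [finrank_euclideanSpace, mul_assoc, discArea]

lemma hasDerivAt_half_log (r : ℝ) :
    HasDerivAt (fun r : ℝ => Real.log (1 + r ^ 2) / 2) (r * (1 + r ^ 2)⁻¹) r := by
  have h1 : HasDerivAt (fun r : ℝ => 1 + r ^ 2) (2 * r) r := by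
    simpa using (hasDerivAt_pow 2 r).const_add 1
  refine ((h1.log (by positivity)).div_const 2).congr_deriv ?_
  have : (1 + r ^ 2) ≠ 0 := by positivity
  field_simp

lemma lintegral_ball_inv (N : ℝ) (hN : 0 ≤ N) :
    ∫⁻ x in Metric.ball (0 : Plane) N, ENNReal.ofReal ((1 + ‖x‖ ^ 2)⁻¹) =
      ENNReal.ofReal (discArea * Real.log (1 + N ^ 2)) := by
  have hcont : Continuous fun r : ℝ => r * (1 + r ^ 2)⁻¹ := by
    refine continuous_id.mul (Continuous.inv₀ (by fun_prop) fun r => ?_)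
    positivity
  have e0 : (fun r => r * (Iio N).indicator (fun r : ℝ => (1 + r ^ 2)⁻¹) r) =
      (Iio N).indicator (fun r => r * (1 + r ^ 2)⁻¹) := by
    ext r; by_cases h : r < N <;> simp [h]
  have hi : IntegrableOn (fun r => r * (Iio N).indicator (fun r : ℝ => (1 + r ^ 2)⁻¹) r)
      (Ioi 0) := by
    rw [e0, integrableOn_indicator_iff measurableSet_Iio]
    exact (hcont.integrableOn_Icc (a := 0) (b := N)).mono_set fun r hr =>
      ⟨le_of_lt hr.2, le_of_lt hr.1⟩
  have h := lintegral_norm_plane ((Iio N).indicator fun r : ℝ => (1 + r ^ 2)⁻¹)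
    (fun r => indicator_nonneg (fun r _ => by positivity) r) hi
  have e1 : ∫ r in Ioi (0 : ℝ), r * (Iio N).indicator (fun r : ℝ => (1 + r ^ 2)⁻¹) r =
      Real.log (1 + N ^ 2) / 2 := by
    rw [e0, setIntegral_indicator measurableSet_Iio, Ioi_inter_Iio,
      ← integral_Ioc_eq_integral_Ioo, ← intervalIntegral.integral_of_le hN,
      intervalIntegral.integral_eq_sub_of_hasDerivAt (fun r _ => hasDerivAt_half_log r)
        (hcont.intervalIntegrable _ _)]
    simp
  rw [e1] at h
  rw [← lintegral_indicator measurableSet_ball]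
  convert h using 1
  · refine lintegral_congr fun x => ?_
    by_cases hx : ‖x‖ < N <;> simp [indicator, hx]
  · ring_nf

lemma hasDerivAt_neg_half_inv (r : ℝ) :
    HasDerivAt (fun r : ℝ => -(1 + r ^ 2)⁻¹ / 2) (r * ((1 + r ^ 2) ^ 2)⁻¹) r := by
  have h1 : HasDerivAt (fun r : ℝ => 1 + r ^ 2) (2 * r) r := by
    simpa using (hasDerivAt_pow 2 r).const_add 1
  refine (((h1.fun_inv (by positivity)).fun_neg).div_const 2).congr_deriv ?_
  have : (1 + r ^ 2) ≠ 0 := by positivity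
  field_simp

lemma lintegral_compl_ball_inv_sq (N : ℝ) (hN : 0 ≤ N) :
    ∫⁻ x in (Metric.ball (0 : Plane) N)ᶜ, ENNReal.ofReal (((1 + ‖x‖ ^ 2) ^ 2)⁻¹) =
      ENNReal.ofReal (discArea * (1 + N ^ 2)⁻¹) := by
  have hcont : Continuous fun r : ℝ => r * ((1 + r ^ 2) ^ 2)⁻¹ := by
    refine continuous_id.mul (Continuous.inv₀ (by fun_prop) fun r => ?_)
    positivity
  have e0 : (fun r => r * (Ici N).indicator (fun r : ℝ => ((1 + r ^ 2) ^ 2)⁻¹) r) =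
      (Ici N).indicator (fun r => r * ((1 + r ^ 2) ^ 2)⁻¹) := by
    ext r; by_cases h : N ≤ r <;> simp [h]
  have hlim : Tendsto (fun r : ℝ => -(1 + r ^ 2)⁻¹ / 2) atTop (𝓝 0) := by
    have h1 : Tendsto (fun r : ℝ => 1 + r ^ 2) atTop atTop :=
      tendsto_atTop_add_const_left _ _ (tendsto_pow_atTop two_ne_zero)
    simpa using (h1.inv_tendsto_atTop.neg).div_const 2
  have hpos : ∀ r ∈ Ioi N, 0 ≤ r * ((1 + r ^ 2) ^ 2)⁻¹ := fun r hr => by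
    have : 0 ≤ r := hN.trans (le_of_lt hr)
    positivity
  have hiN : IntegrableOn (fun r : ℝ => r * ((1 + r ^ 2) ^ 2)⁻¹) (Ioi N) :=
    integrableOn_Ioi_deriv_of_nonneg' (fun r _ => hasDerivAt_neg_half_inv r) hpos hlim
  have hi : IntegrableOn (fun r => r * (Ici N).indicator (fun r : ℝ => ((1 + r ^ 2) ^ 2)⁻¹) r)
      (Ioi 0) := by
    rw [e0, integrableOn_indicator_iff measurableSet_Ici]
    exact ((integrableOn_Ici_iff_integrableOn_Ioi enorm_ne_top).2 hiN).mono_set inter_subset_left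
  have h := lintegral_norm_plane ((Ici N).indicator fun r : ℝ => ((1 + r ^ 2) ^ 2)⁻¹)
    (fun r => indicator_nonneg (fun r _ => by positivity) r) hi
  have e1 : ∫ r in Ioi (0 : ℝ), r * (Ici N).indicator (fun r : ℝ => ((1 + r ^ 2) ^ 2)⁻¹) r =
      (1 + N ^ 2)⁻¹ / 2 := by
    rw [e0]
    have e2 : ∫ r in Ioi (0 : ℝ), (Ici N).indicator (fun r => r * ((1 + r ^ 2) ^ 2)⁻¹) r =
        ∫ r in Ici (0 : ℝ), (Ici N).indicator (fun r => r * ((1 + r ^ 2) ^ 2)⁻¹) r :=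
      integral_Ici_eq_integral_Ioi.symm
    rw [e2, setIntegral_indicator measurableSet_Ici, Ici_inter_Ici, max_eq_right hN,
      integral_Ici_eq_integral_Ioi,
      integral_Ioi_of_hasDerivAt_of_nonneg' (fun r _ => hasDerivAt_neg_half_inv r) hpos hlim]
    ring
  rw [e1] at h
  rw [← lintegral_indicator measurableSet_ball.compl]
  convert h using 1
  · refine lintegral_congr fun x => ?_
    by_cases hx : N ≤ ‖x‖ <;> simp [indicator, hx]
  · ring_nf

/-- A smooth, compactly supported probability density on the plane. -/
structure IsMollifier (κ : Plane → ℝ) : Prop where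
  contDiff : ContDiff ℝ ∞ κ
  hasCompactSupport : HasCompactSupport κ
  nonneg : ∀ x, 0 ≤ κ x
  integral_eq : ∫ x, κ x = 1

lemma isMollifier_normed (φ : ContDiffBump (0 : Plane)) : IsMollifier (φ.normed volume) where
  contDiff := φ.contDiff_normed
  hasCompactSupport := φ.hasCompactSupport_normed
  nonneg := φ.nonneg_normed
  integral_eq := φ.integral_normed

/-- The test function `z ↦ κ (x - z)`. -/
def IsMollifier.test {κ : Plane → ℝ} (hκ : IsMollifier κ) (x : Plane) : 𝓢(Plane, ℂ) :=
  HasCompactSupport.toSchwartzMap (f := fun z => ((κ (x - z) : ℝ) : ℂ))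
    ((hκ.hasCompactSupport.comp_homeomorph (Homeomorph.subLeft x)).comp_left
      (g := fun r : ℝ => (r : ℂ)) Complex.ofReal_zero)
    (Complex.ofRealCLM.contDiff.comp (hκ.contDiff.comp (contDiff_const.sub contDiff_id)))

lemma IsMollifier.test_apply {κ : Plane → ℝ} (hκ : IsMollifier κ) (x z : Plane) :
    hκ.test x z = ((κ (x - z) : ℝ) : ℂ) := rfl

lemma IsMollifier.fourier_test {κ : Plane → ℝ} (hκ : IsMollifier κ) (x ξ : Plane) :
    (𝓕 (hκ.test x) : 𝓢(Plane, ℂ)) ξ =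
      ∫ w, Real.fourierChar (-inner ℝ (x - w) ξ) • ((κ w : ℝ) : ℂ) := by
  rw [SchwartzMap.fourier_coe, Real.fourier_eq,
    ← integral_sub_left_eq_self
      (fun w => Real.fourierChar (-inner ℝ (x - w) ξ) • ((κ w : ℝ) : ℂ)) volume x]
  simp [hκ.test_apply]

lemma norm_fourierChar_sub_le (a b : ℝ) :
    ‖(Real.fourierChar a : ℂ) - Real.fourierChar b‖ ≤ 2 * Real.pi * |a - b| := by
  have h1 : (Real.fourierChar a : ℂ) = Real.fourierChar b * Real.fourierChar (a - b) := by
    rw [← Circle.coe_mul, ← AddChar.map_add_eq_mul]; simp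
  have h2 : (Real.fourierChar a : ℂ) - Real.fourierChar b =
      Real.fourierChar b * ((Real.fourierChar (a - b) : ℂ) - 1) := by rw [h1]; ring
  rw [h2, norm_mul, Circle.norm_coe, one_mul, Real.fourierChar_apply, mul_comm]
  refine Real.norm_exp_I_mul_ofReal_sub_one_le.trans ?_
  rw [Real.norm_eq_abs, abs_mul, abs_of_pos Real.two_pi_pos]

lemma IsMollifier.integrable_fourierChar {κ : Plane → ℝ} (hκ : IsMollifier κ) (x ξ : Plane) :
    Integrable (fun w => Real.fourierChar (-inner ℝ (x - w) ξ) • ((κ w : ℝ) : ℂ)) := by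
  have hc := hκ.contDiff.continuous
  refine Continuous.integrable_of_hasCompactSupport ?_ ?_
  · have : Continuous fun w : Plane => Real.fourierChar (-inner ℝ (x - w) ξ) :=
      Real.continuous_fourierChar.comp (by fun_prop)
    exact this.smul (by fun_prop)
  · refine HasCompactSupport.smul_left ?_
    exact hκ.hasCompactSupport.comp_left (g := fun r : ℝ => (r : ℂ)) Complex.ofReal_zero

lemma IsMollifier.integrable {κ : Plane → ℝ} (hκ : IsMollifier κ) : Integrable κ :=
  hκ.contDiff.continuous.integrable_of_hasCompactSupport hκ.hasCompactSupport

lemma IsMollifier.norm_fourier_test_le {κ : Plane → ℝ} (hκ : IsMollifier κ) (x ξ : Plane) :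
    ‖(𝓕 (hκ.test x) : 𝓢(Plane, ℂ)) ξ‖ ≤ 1 := by
  rw [hκ.fourier_test, ← hκ.integral_eq]
  refine norm_integral_le_of_norm_le hκ.integrable (Eventually.of_forall fun w => ?_)
  rw [Circle.norm_smul, Complex.norm_real, Real.norm_eq_abs, abs_of_nonneg (hκ.nonneg w)]

lemma IsMollifier.norm_fourier_test_sub_le {κ : Plane → ℝ} (hκ : IsMollifier κ) (x y ξ : Plane) :
    ‖(𝓕 (hκ.test x - hκ.test y) : 𝓢(Plane, ℂ)) ξ‖ ≤ min 2 (2 * Real.pi * ‖ξ‖ * ‖x - y‖) := by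
  have e : (𝓕 (hκ.test x - hκ.test y) : 𝓢(Plane, ℂ)) ξ =
      (𝓕 (hκ.test x) : 𝓢(Plane, ℂ)) ξ - (𝓕 (hκ.test y) : 𝓢(Plane, ℂ)) ξ := by
    rw [sub_eq_add_neg, FourierTransform.fourier_add, FourierTransform.fourier_neg,
      ← sub_eq_add_neg, sub_apply]
  rw [e]
  refine le_min ?_ ?_
  · refine (norm_sub_le _ _).trans ?_
    linarith [hκ.norm_fourier_test_le x ξ, hκ.norm_fourier_test_le y ξ]
  · rw [hκ.fourier_test, hκ.fourier_test,
      ← integral_sub (hκ.integrable_fourierChar x ξ) (hκ.integrable_fourierChar y ξ)]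
    have : ∀ w, ‖Real.fourierChar (-inner ℝ (x - w) ξ) • ((κ w : ℝ) : ℂ)
        - Real.fourierChar (-inner ℝ (y - w) ξ) • ((κ w : ℝ) : ℂ)‖ ≤
        (2 * Real.pi * ‖ξ‖ * ‖x - y‖) * κ w := fun w => by
      rw [Circle.smul_def, Circle.smul_def, ← sub_smul, norm_smul, Complex.norm_real,
        Real.norm_eq_abs (κ w), abs_of_nonneg (hκ.nonneg w)]
      refine mul_le_mul_of_nonneg_right ((norm_fourierChar_sub_le _ _).trans ?_) (hκ.nonneg w)
      rw [mul_assoc (2 * Real.pi) ‖ξ‖]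
      refine mul_le_mul_of_nonneg_left ?_ Real.two_pi_pos.le
      have h3 : -inner ℝ (x - w) ξ - -inner ℝ (y - w) ξ = - inner ℝ (x - y) ξ := by
        simp only [inner_sub_left]; ring
      rw [h3, abs_neg, mul_comm]
      exact abs_real_inner_le_norm _ _
    refine (norm_integral_le_of_norm_le (hκ.integrable.const_mul _)
      (Eventually.of_forall this)).trans (le_of_eq ?_)
    rw [integral_const_mul, hκ.integral_eq, mul_one]

lemma resolventSymbol_sq_mul_le {ξ : Plane} {c δ : ℝ} (hc : 0 ≤ c)
    (h : c ≤ 2 * Real.pi * ‖ξ‖ * δ) :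
    (resolventSymbol ξ * c) ^ 2 ≤ δ ^ 2 * (1 + ‖ξ‖ ^ 2)⁻¹ := by
  rw [resolventSymbol_eq]
  set P := (2 * Real.pi) ^ 2 * ‖ξ‖ ^ 2 with hP
  have hP1 : ‖ξ‖ ^ 2 ≤ P := by
    refine le_mul_of_one_le_left (by positivity) ?_
    nlinarith [Real.pi_gt_three]
  have hP0 : 0 ≤ P := by positivity
  have hc2 : c ^ 2 ≤ P * δ ^ 2 := by
    calc c ^ 2 ≤ (2 * Real.pi * ‖ξ‖ * δ) ^ 2 := by gcongr
      _ = _ := by rw [hP]; ring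
  rw [mul_pow, inv_pow, ← div_eq_inv_mul, ← div_eq_mul_inv, div_le_div_iff₀ (by positivity)
    (by positivity)]
  calc c ^ 2 * (1 + ‖ξ‖ ^ 2) ≤ (P * δ ^ 2) * (1 + P) := by gcongr
    _ ≤ δ ^ 2 * (1 + P) ^ 2 := by nlinarith [sq_nonneg δ, mul_nonneg (sq_nonneg δ) hP0]

lemma resolventSymbol_sq_mul_le' {ξ : Plane} {c b : ℝ} (hc : 0 ≤ c) (h : c ≤ b) :
    (resolventSymbol ξ * c) ^ 2 ≤ b ^ 2 * ((1 + ‖ξ‖ ^ 2) ^ 2)⁻¹ := by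
  rw [resolventSymbol_eq, mul_pow, inv_pow, mul_comm]
  have : ‖ξ‖ ^ 2 ≤ (2 * Real.pi) ^ 2 * ‖ξ‖ ^ 2 := by
    refine le_mul_of_one_le_left (by positivity) ?_
    nlinarith [Real.pi_gt_three]
  gcongr

lemma enorm_sq_eq_ofReal (a : ℝ) : ‖a‖ₑ ^ 2 = ENNReal.ofReal (a ^ 2) := by
  rw [← ofReal_norm, ← ENNReal.ofReal_pow (norm_nonneg _), Real.norm_eq_abs, sq_abs]

lemma le_of_sq_le_ofReal {a : ℝ≥0∞} {b : ℝ} (hb : 0 ≤ b) (h : a ^ 2 ≤ ENNReal.ofReal (b ^ 2)) :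
    a ≤ ENNReal.ofReal b := by
  rw [ENNReal.ofReal_pow hb] at h
  exact (ENNReal.pow_le_pow_left_iff two_ne_zero).1 h

/-- The `H⁻²` norm of the difference of two approximate Dirac masses: frequencies below `N`
contribute at most `√log (1 + N²)` times their distance, higher frequencies at most `1 / N`. -/
lemma IsMollifier.eLpNorm_fourier_test_sub_le {κ : Plane → ℝ} (hκ : IsMollifier κ) (x y : Plane)
    {N : ℝ} (hN : 1 ≤ N) :
    eLpNorm (fun ξ => resolventSymbol ξ * ‖(𝓕 (hκ.test x - hκ.test y) : 𝓢(Plane, ℂ)) ξ‖) 2 volume ≤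
      ENNReal.ofReal (2 * √discArea * (√(Real.log (1 + N ^ 2)) * ‖x - y‖ + 1 / N)) := by
  have hN0 : 0 < N := one_pos.trans_le hN
  refine le_of_sq_le_ofReal (by positivity) ?_
  have hb := discArea_nonneg
  have hlog : 0 ≤ Real.log (1 + N ^ 2) := Real.log_nonneg (by nlinarith)
  rw [sq_eLpNorm_two, ← lintegral_add_compl _ (measurableSet_ball (x := (0 : Plane)) (ε := N))]
  have h1 : ∫⁻ ξ in Metric.ball (0 : Plane) N,
      ‖resolventSymbol ξ * ‖(𝓕 (hκ.test x - hκ.test y) : 𝓢(Plane, ℂ)) ξ‖‖ₑ ^ 2 ≤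
      ENNReal.ofReal (‖x - y‖ ^ 2 * (discArea * Real.log (1 + N ^ 2))) := by
    rw [ENNReal.ofReal_mul (by positivity), ← lintegral_ball_inv N hN0.le,
      ← lintegral_const_mul' _ _ ENNReal.ofReal_ne_top]
    refine lintegral_mono fun ξ => ?_
    rw [enorm_sq_eq_ofReal, ← ENNReal.ofReal_mul (by positivity)]
    exact ENNReal.ofReal_le_ofReal (resolventSymbol_sq_mul_le (norm_nonneg _)
      ((hκ.norm_fourier_test_sub_le x y ξ).trans (min_le_right _ _)))
  have h2 : ∫⁻ ξ in (Metric.ball (0 : Plane) N)ᶜ,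
      ‖resolventSymbol ξ * ‖(𝓕 (hκ.test x - hκ.test y) : 𝓢(Plane, ℂ)) ξ‖‖ₑ ^ 2 ≤
      ENNReal.ofReal (2 ^ 2 * (discArea * (1 + N ^ 2)⁻¹)) := by
    rw [ENNReal.ofReal_mul (by positivity), ← lintegral_compl_ball_inv_sq N hN0.le,
      ← lintegral_const_mul' _ _ ENNReal.ofReal_ne_top]
    refine lintegral_mono fun ξ => ?_
    rw [enorm_sq_eq_ofReal, ← ENNReal.ofReal_mul (by positivity)]
    exact ENNReal.ofReal_le_ofReal (resolventSymbol_sq_mul_le' (norm_nonneg _)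
      ((hκ.norm_fourier_test_sub_le x y ξ).trans (min_le_left _ _)))
  refine (add_le_add h1 h2).trans ?_
  rw [← ENNReal.ofReal_add (by positivity) (by positivity)]
  refine ENNReal.ofReal_le_ofReal ?_
  have h3 : (1 + N ^ 2)⁻¹ ≤ (1 / N) ^ 2 := by
    rw [one_div, inv_pow]; gcongr; linarith
  set L := √(Real.log (1 + N ^ 2)) with hL
  have hL2 : Real.log (1 + N ^ 2) = L ^ 2 := (Real.sq_sqrt hlog).symm
  have hL0 : 0 ≤ L := Real.sqrt_nonneg _
  rw [hL2, mul_pow, mul_pow, Real.sq_sqrt hb]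
  have h4 : 0 ≤ discArea * (L * ‖x - y‖) ^ 2 := by positivity
  have h5 : 0 ≤ discArea * ((L * ‖x - y‖) * (1 / N)) := by positivity
  have h6 := mul_le_mul_of_nonneg_left h3 hb
  nlinarith

lemma IsMollifier.eLpNorm_fourier_test_le {κ : Plane → ℝ} (hκ : IsMollifier κ) (x : Plane) :
    eLpNorm (fun ξ => resolventSymbol ξ * ‖(𝓕 (hκ.test x) : 𝓢(Plane, ℂ)) ξ‖) 2 volume ≤
      ENNReal.ofReal (√discArea) := by
  refine le_of_sq_le_ofReal (by positivity) ?_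
  rw [Real.sq_sqrt discArea_nonneg, sq_eLpNorm_two]
  have h0 := lintegral_compl_ball_inv_sq 0 le_rfl
  simp only [Metric.ball_zero, compl_empty, Measure.restrict_univ, ne_eq, OfNat.ofNat_ne_zero,
    not_false_eq_true, zero_pow, add_zero, inv_one, mul_one] at h0
  rw [← h0]
  refine lintegral_mono fun ξ => ?_
  rw [enorm_sq_eq_ofReal]
  refine ENNReal.ofReal_le_ofReal ?_
  simpa using resolventSymbol_sq_mul_le' (ξ := ξ) (norm_nonneg _) (hκ.norm_fourier_test_le x ξ)

/-- The convolution `κ * v`. -/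
def mollify (κ : Plane → ℝ) (v : Plane → Plane) (x : Plane) : Plane := ∫ z, κ (x - z) • v z

lemma exists_mollifier_seq : ∃ κ : ℕ → Plane → ℝ, (∀ n, IsMollifier (κ n)) ∧
    (∀ n, Function.support (κ n) ⊆ Metric.ball 0 (1 / ((n : ℝ) + 1))) ∧
    ∀ v : Plane → Plane, Continuous v → ∀ x,
      Tendsto (fun n => mollify (κ n) v x) atTop (𝓝 (v x)) := by
  let φ : ℕ → ContDiffBump (0 : Plane) := fun n =>
    ⟨1 / ((n : ℝ) + 1) / 2, 1 / ((n : ℝ) + 1), by positivity, half_lt_self (by positivity)⟩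
  refine ⟨fun n => (φ n).normed volume, fun n => isMollifier_normed _, fun n => ?_, ?_⟩
  · rw [ContDiffBump.support_normed_eq]
  · intro v hv x
    have := ContDiffBump.convolution_tendsto_right_of_continuous (μ := volume) (φ := φ)
      (l := atTop) tendsto_one_div_add_atTop_nhds_zero_nat hv x
    simp only [convolution_eq_swap, ContinuousLinearMap.lsmul_apply] at this
    exact this

lemma h2norm_eq (U : Set Plane) (v : Plane → Plane) : h2norm U v =
    ⨅ (D₁ : Fin 2 → Plane → Plane) (D₂ : Fin 2 → Fin 2 → Plane → Plane) (_ : IsH2Jet U v D₁ D₂),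
      jetNorm U v D₁ D₂ := rfl

lemma le_mul_h2norm {U : Set Plane} {v : Plane → Plane} {a : ℝ≥0∞} {c : ℝ} (hc : 0 < c)
    (h : ∀ D₁ D₂, IsH2Jet U v D₁ D₂ → a ≤ ENNReal.ofReal c * jetNorm U v D₁ D₂) :
    a ≤ ENNReal.ofReal c * h2norm U v := by
  have hc0 : ENNReal.ofReal c ≠ 0 := by simpa using hc
  rw [mul_comm, ← ENNReal.div_le_iff hc0 ENNReal.ofReal_ne_top, h2norm_eq]
  refine le_iInf fun D₁ => le_iInf fun D₂ => le_iInf fun hj => ?_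
  rw [ENNReal.div_le_iff hc0 ENNReal.ofReal_ne_top, mul_comm]
  exact h D₁ D₂ hj

/-- The embedding of `H²(ℝ²)` into bounded functions. -/
theorem enorm_le_h2norm {v : Plane → Plane} (hv : Continuous v) (x : Plane) :
    ‖v x‖ₑ ≤ ENNReal.ofReal (3 * (√discArea + 1)) * h2norm univ v := by
  refine le_mul_h2norm (by positivity) fun D₁ D₂ hj => ?_
  obtain ⟨κ, hκ, -, hlim⟩ := exists_mollifier_seq
  refine le_of_tendsto (hlim v hv x).enorm (Eventually.of_forall fun n => ?_)
  have h := hj.enorm_integral_smul_le ((hκ n).test x) (fun z => κ n (x - z)) (fun z => rfl)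
  refine h.trans ?_
  rw [ENNReal.ofReal_mul (by norm_num), ENNReal.ofReal_ofNat, mul_assoc, mul_assoc,
    mul_comm (ENNReal.ofReal _)]
  gcongr
  exact ((hκ n).eLpNorm_fourier_test_le x).trans (ENNReal.ofReal_le_ofReal (by linarith))

/-- The logarithmic modulus of continuity of `H²(ℝ²)`, in the form of a family of affine bounds: up
to an error `1 / N`, the field is Lipschitz with a constant of order `√log N`. -/
theorem enorm_sub_le_h2norm {v : Plane → Plane} (hv : Continuous v) (x y : Plane) {N : ℝ}
    (hN : 1 ≤ N) :
    ‖v x - v y‖ₑ ≤ ENNReal.ofReal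
      (6 * (√discArea + 1) * (√(Real.log (1 + N ^ 2)) * ‖x - y‖ + 1 / N)) * h2norm univ v := by
  have hN0 : 0 < N := one_pos.trans_le hN
  refine le_mul_h2norm (by positivity) fun D₁ D₂ hj => ?_
  obtain ⟨κ, hκ, -, hlim⟩ := exists_mollifier_seq
  refine le_of_tendsto ((hlim v hv x).sub (hlim v hv y)).enorm (Eventually.of_forall fun n => ?_)
  have hint : ∀ x, Integrable fun z => κ n (x - z) • v z := fun x => by
    refine Continuous.integrable_of_hasCompactSupport ?_ ?_
    · exact ((hκ n).contDiff.continuous.comp (continuous_const.sub continuous_id)).smul hv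
    · exact ((hκ n).hasCompactSupport.comp_homeomorph (Homeomorph.subLeft x)).smul_right
  have h := hj.enorm_integral_smul_le ((hκ n).test x - (hκ n).test y)
    (fun z => κ n (x - z) - κ n (y - z)) (fun z => by
      rw [sub_apply, IsMollifier.test_apply, IsMollifier.test_apply, Complex.ofReal_sub])
  simp_rw [sub_smul] at h
  rw [integral_sub (hint x) (hint y)] at h
  refine h.trans ?_
  have e : 6 * (√discArea + 1) * (√(Real.log (1 + N ^ 2)) * ‖x - y‖ + 1 / N) =
      3 * (2 * (√discArea + 1) * (√(Real.log (1 + N ^ 2)) * ‖x - y‖ + 1 / N)) := by ring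
  rw [e, ENNReal.ofReal_mul (by norm_num), ENNReal.ofReal_ofNat, mul_assoc, mul_assoc,
    mul_comm (ENNReal.ofReal _)]
  gcongr
  refine ((hκ n).eLpNorm_fourier_test_sub_le x y hN).trans (ENNReal.ofReal_le_ofReal ?_)
  gcongr
  linarith

/-! ### Absolutely continuous functions and Gronwall's inequality -/

/-- A function whose increments are dominated by those of an absolutely continuous function is
absolutely continuous. -/
lemma absolutelyContinuousOnInterval_of_dist_le {Y Z : Type*} [PseudoMetricSpace Y]
    [PseudoMetricSpace Z] {f : ℝ → Y} {g : ℝ → Z} {a b : ℝ} (C : ℝ)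
    (hf : AbsolutelyContinuousOnInterval f a b)
    (h : ∀ x ∈ uIcc a b, ∀ y ∈ uIcc a b, dist (g x) (g y) ≤ C * dist (f x) (f y)) :
    AbsolutelyContinuousOnInterval g a b := by
  rw [absolutelyContinuousOnInterval_iff] at hf ⊢
  intro ε hε
  obtain ⟨δ, hδ, H⟩ := hf (ε / (|C| + 1)) (by positivity)
  refine ⟨δ, hδ, fun E hE hEδ => ?_⟩
  have h1 := H E hE hEδ
  rw [lt_div_iff₀ (by positivity)] at h1
  refine lt_of_le_of_lt ?_ h1
  rw [Finset.sum_mul]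
  refine Finset.sum_le_sum fun i hi => ?_
  obtain ⟨hx, hy⟩ := hE.1 i hi
  refine (h _ hx _ hy).trans ?_
  rw [mul_comm]
  refine mul_le_mul_of_nonneg_left ?_ dist_nonneg
  linarith [le_abs_self C]

/-- The indefinite integral of a vector-valued integrable function is absolutely continuous. -/
lemma absolutelyContinuousOnInterval_integral {E : Type*} [NormedAddCommGroup E] [NormedSpace ℝ E]
    {f : ℝ → E} {a b c : ℝ} (hf : IntervalIntegrable f volume a b) (hc : c ∈ uIcc a b) :
    AbsolutelyContinuousOnInterval (fun t => ∫ r in c..t, f r) a b := by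
  refine absolutelyContinuousOnInterval_of_dist_le 1
    (hf.norm.absolutelyContinuousOnInterval_intervalIntegral hc) fun x hx y hy => ?_
  have hi : ∀ z ∈ uIcc a b, IntervalIntegrable f volume c z := fun z hz =>
    hf.mono_set (uIcc_subset_uIcc hc hz)
  rw [dist_eq_norm, dist_eq_norm, intervalIntegral.integral_interval_sub_left (hi x hx) (hi y hy),
    intervalIntegral.integral_interval_sub_left (hi x hx).norm (hi y hy).norm, one_mul,
    Real.norm_eq_abs]
  exact intervalIntegral.norm_integral_le_abs_integral_norm

lemma abs_exp_neg_sub_exp_neg_le {x y : ℝ} (hx : 0 ≤ x) (hy : 0 ≤ y) :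
    |Real.exp (-x) - Real.exp (-y)| ≤ |x - y| := by
  wlog h : x ≤ y generalizing x y
  · rw [abs_sub_comm, abs_sub_comm x]
    exact this hy hx (le_of_not_ge h)
  have h1 : Real.exp (-y) ≤ Real.exp (-x) := Real.exp_le_exp.2 (by linarith)
  rw [abs_of_nonneg (by linarith), abs_sub_comm, abs_of_nonneg (by linarith)]
  have h2 : Real.exp (-y) = Real.exp (-x) * Real.exp (-(y - x)) := by
    rw [← Real.exp_add]; ring_nf
  have h3 := Real.add_one_le_exp (-(y - x))
  have h4 : Real.exp (-x) ≤ 1 := Real.exp_le_one_iff.2 (by linarith)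
  have h5 := Real.exp_pos (-x)
  rw [h2]
  nlinarith

/-- Gronwall's inequality in integral form with an integrable coefficient. -/
lemma gronwall_integral {f k : ℝ → ℝ} {a b δ : ℝ} (hab : a ≤ b) (hf : ContinuousOn f (Icc a b))
    (hk : IntervalIntegrable k volume a b) (hk0 : ∀ r, 0 ≤ k r)
    (h : ∀ t ∈ Icc a b, f t ≤ δ + ∫ r in a..t, k r * f r) :
    ∀ t ∈ Icc a b, f t ≤ δ * Real.exp (∫ r in a..t, k r) := by
  intro t ht
  have hkf : IntervalIntegrable (fun r => k r * f r) volume a b :=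
    hk.mul_continuousOn (by rwa [uIcc_of_le hab])
  have ha : a ∈ uIcc a b := left_mem_uIcc
  set K : ℝ → ℝ := fun t => ∫ r in a..t, k r with hK
  set W : ℝ → ℝ := fun t => δ + ∫ r in a..t, k r * f r with hW
  have hK0 : ∀ t ∈ Icc a b, 0 ≤ K t := fun t ht =>
    intervalIntegral.integral_nonneg ht.1 fun r _ => hk0 r
  have hKac : AbsolutelyContinuousOnInterval K a b :=
    absolutelyContinuousOnInterval_integral hk ha
  have hEac : AbsolutelyContinuousOnInterval (fun t => Real.exp (-K t)) a b := by
    refine absolutelyContinuousOnInterval_of_dist_le 1 hKac fun x hx y hy => ?_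
    rw [uIcc_of_le hab] at hx hy
    rw [one_mul]
    exact abs_exp_neg_sub_exp_neg_le (hK0 x hx) (hK0 y hy)
  have hWac : AbsolutelyContinuousOnInterval W a b := by
    refine absolutelyContinuousOnInterval_of_dist_le 1
      (absolutelyContinuousOnInterval_integral hkf ha) fun x _ y _ => ?_
    simp [hW]
  have hG := (hWac.mul hEac).mono (c := a) (d := t) (by
    rw [uIcc_of_le hab, uIcc_of_le ht.1]; exact Icc_subset_Icc_right ht.2)
  have hint := hG.integral_deriv_eq_sub
  -- the function `W e^{-K}` is absolutely continuous, with nonpositive derivative almost everywhere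
  have hle : ∫ r in a..t, deriv (W * fun t => Real.exp (-K t)) r ≤ 0 := by
    rw [← neg_nonneg, ← intervalIntegral.integral_neg]
    refine intervalIntegral.integral_nonneg_of_ae_restrict ht.1 ?_
    rw [Filter.EventuallyLE, ae_restrict_iff' measurableSet_Icc]
    filter_upwards [hk.ae_hasDerivAt_integral, hkf.ae_hasDerivAt_integral] with r h1 h2 hr
    have hr' : r ∈ Icc a b := ⟨hr.1, hr.2.trans ht.2⟩
    have hru : r ∈ uIcc a b := by rwa [uIcc_of_le hab]
    have d1 : HasDerivAt K (k r) r := h1 hru a ha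
    have d2 : HasDerivAt W (k r * f r) r := (h2 hru a ha).const_add δ
    have d3 := d2.mul d1.fun_neg.exp
    rw [d3.deriv, Pi.zero_apply]
    have h3 := h r hr'
    have h4 := mul_le_mul_of_nonneg_left h3 (hk0 r)
    have h5 := Real.exp_pos (-K r)
    change k r * f r ≤ k r * W r at h4
    nlinarith
  rw [hint] at hle
  have hKa : K a = 0 := intervalIntegral.integral_same
  have hWa : W a = δ := by simp [hW]
  simp only [Pi.mul_apply, hKa, hWa, neg_zero, Real.exp_zero, mul_one, sub_nonpos] at hle
  have h6 : W t * Real.exp (-K t) * Real.exp (K t) ≤ δ * Real.exp (K t) := by gcongr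
  rw [mul_assoc, ← Real.exp_add, neg_add_cancel, Real.exp_zero, mul_one] at h6
  exact (h t ht).trans h6

/-- Two-sided version of `gronwall_integral`. -/
lemma gronwall_integral_two_sided {f k : ℝ → ℝ} {T t₀ δ : ℝ} (ht₀ : t₀ ∈ Icc 0 T)
    (hf : ContinuousOn f (Icc 0 T)) (hk : IntervalIntegrable k volume 0 T) (hk0 : ∀ r, 0 ≤ k r)
    (hδ : 0 ≤ δ) (h : ∀ t ∈ Icc 0 T, f t ≤ δ + |∫ r in t₀..t, k r * f r|) (hf0 : ∀ t, 0 ≤ f t) :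
    ∀ t ∈ Icc 0 T, f t ≤ δ * Real.exp (∫ r in (0)..T, k r) := by
  intro t ht
  have hT : 0 ≤ T := ht.1.trans ht.2
  have hmono : ∀ x y, x ∈ Icc 0 T → y ∈ Icc 0 T → x ≤ y → ∫ r in x..y, k r ≤ ∫ r in (0)..T, k r :=
    fun x y hx hy hxy => intervalIntegral.integral_mono_interval hx.1 hxy hy.2
      (Eventually.of_forall hk0) hk
  rcases le_total t₀ t with htt | htt
  · have h1 := gronwall_integral (f := f) (k := k) (δ := δ) htt
      (hf.mono (Icc_subset_Icc ht₀.1 ht.2))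
      (hk.mono_set (by rw [uIcc_of_le htt, uIcc_of_le hT]; exact Icc_subset_Icc ht₀.1 ht.2)) hk0
      (fun s hs => by
        have := h s ⟨ht₀.1.trans hs.1, hs.2.trans ht.2⟩
        rwa [abs_of_nonneg (intervalIntegral.integral_nonneg hs.1
          fun r _ => mul_nonneg (hk0 r) (hf0 r))] at this) t ⟨htt, le_rfl⟩
    refine h1.trans (mul_le_mul_of_nonneg_left (Real.exp_le_exp.2 ?_) hδ)
    exact hmono _ _ ht₀ ht htt
  · have hsub : Icc t t₀ ⊆ Icc 0 T := Icc_subset_Icc ht.1 ht₀.2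
    have hkm : IntervalIntegrable (fun r => k (-r)) volume (-t₀) (-t) :=
      ((IntervalIntegrable.iff_comp_neg enorm_ne_top).1
        (hk.mono_set (by rw [uIcc_of_le htt, uIcc_of_le hT]; exact hsub))).symm
    have h1 := gronwall_integral (f := fun r => f (-r)) (k := fun r => k (-r)) (δ := δ)
      (neg_le_neg htt)
      (hf.comp continuous_neg.continuousOn fun r hr => hsub ⟨by linarith [hr.2], by linarith [hr.1]⟩)
      hkm (fun r => hk0 _)
      (fun s hs => by
        have hs' : -s ∈ Icc 0 T := hsub ⟨by linarith [hs.2], by linarith [hs.1]⟩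
        have := h (-s) hs'
        rw [intervalIntegral.integral_symm, abs_neg, abs_of_nonneg
          (intervalIntegral.integral_nonneg (by linarith [hs.1])
          fun r _ => mul_nonneg (hk0 r) (hf0 r))] at this
        rwa [intervalIntegral.integral_comp_neg (fun r => k r * f r), neg_neg]) (-t)
        ⟨neg_le_neg htt, le_rfl⟩
    rw [intervalIntegral.integral_comp_neg (fun r => k r), neg_neg, neg_neg] at h1
    exact h1.trans (mul_le_mul_of_nonneg_left (Real.exp_le_exp.2 (hmono _ _ ht ht₀ htt)) hδ)

/-! ### Flows of fields with a logarithmic modulus of continuity -/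

/-- The Lipschitz constant allowed at precision `1 / N`. -/
def logMod (N : ℕ) : ℝ := √(Real.log (1 + (N : ℝ) ^ 2)) + 1

lemma logMod_nonneg (N : ℕ) : 0 ≤ logMod N := add_nonneg (Real.sqrt_nonneg _) zero_le_one

/-- The growth of `logMod` is slow enough for uniqueness: the Gronwall factor is `o(N)`. -/
lemma tendsto_exp_logMod_div (B : ℝ) :
    Tendsto (fun N : ℕ => Real.exp (logMod N * B) / N) atTop (𝓝 0) := by
  let y : ℕ → ℝ := fun N => √(Real.log (1 + (N : ℝ) ^ 2))
  have hy : Tendsto y atTop atTop := by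
    refine Real.tendsto_sqrt_atTop.comp (Real.tendsto_log_atTop.comp ?_)
    exact tendsto_atTop_add_const_left _ _
      ((tendsto_pow_atTop two_ne_zero).comp tendsto_natCast_atTop_atTop)
  have hz : Tendsto (fun z : ℝ => z * (z / 2 - B) - (B + Real.log 2 / 2)) atTop atTop :=
    tendsto_atTop_add_const_right _ _ (tendsto_id.atTop_mul_atTop₀
      (tendsto_atTop_add_const_right _ _ (tendsto_id.atTop_div_const two_pos)))
  have h1 : Tendsto (fun N => Real.exp (-(y N * (y N / 2 - B) - (B + Real.log 2 / 2)))) atTop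
      (𝓝 0) :=
    (Real.tendsto_exp_neg_atTop_nhds_zero.comp hz).comp hy
  refine squeeze_zero' (Eventually.of_forall fun N => by positivity) ?_ h1
  filter_upwards [eventually_ge_atTop 1] with N hN
  have hN1 : (1 : ℝ) ≤ N := by exact_mod_cast hN
  have hN0 : (0 : ℝ) < N := by linarith
  have hsq : y N ^ 2 = Real.log (1 + (N : ℝ) ^ 2) :=
    Real.sq_sqrt (Real.log_nonneg (by nlinarith))
  have h2 : y N ^ 2 ≤ Real.log 2 + 2 * Real.log N := by
    rw [hsq, ← Real.log_rpow hN0, ← Real.log_mul two_ne_zero (by positivity)]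
    refine Real.log_le_log (by positivity) ?_
    norm_num
    nlinarith
  rw [div_eq_mul_inv, ← Real.exp_log hN0, ← Real.exp_neg, ← Real.exp_add]
  refine Real.exp_le_exp.2 ?_
  have : logMod N = y N + 1 := rfl
  rw [this]
  nlinarith

/-- A velocity field with an integrable logarithmic modulus of continuity in space: for almost every
time and for all `N`, it is Lipschitz with constant `b t * logMod N`, up to an error `b t / N`. -/
structure IsRegularField (T : ℝ) (v : ℝ → Plane → Plane) (b : ℝ → ℝ) : Prop where
  nonneg : ∀ t, 0 ≤ b t
  integrable : IntervalIntegrable b volume 0 T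
  modulus : ∀ᵐ t ∂(volume.restrict (Ioo 0 T)), ∀ N : ℕ, 1 ≤ N → ∀ x y,
    ‖v t x - v t y‖ ≤ b t * (logMod N * ‖x - y‖ + 1 / N)

/-- `γ` is a trajectory of `v` on `[0,T]`, in the integrated sense. -/
structure IsTrajectory (T : ℝ) (v : ℝ → Plane → Plane) (γ : ℝ → Plane) : Prop where
  integrable : IntervalIntegrable (fun r => v r (γ r)) volume 0 T
  eqn : ∀ s ∈ Icc 0 T, ∀ t ∈ Icc 0 T, γ t = γ s + ∫ r in s..t, v r (γ r)

lemma uIcc_subset_time {T s t : ℝ} (hs : s ∈ Icc 0 T) (ht : t ∈ Icc 0 T) :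
    uIcc s t ⊆ uIcc 0 T := by
  rw [uIcc_of_le (hs.1.trans hs.2)]
  exact uIcc_subset_Icc hs ht

lemma ae_uIoc_of_ae_restrict {T : ℝ} {p : ℝ → Prop}
    (h : ∀ᵐ t ∂(volume.restrict (Ioo 0 T)), p t) {s t : ℝ} (hs : s ∈ Icc 0 T) (ht : t ∈ Icc 0 T) :
    ∀ᵐ r, r ∈ uIoc s t → p r := by
  rw [ae_restrict_iff' measurableSet_Ioo] at h
  filter_upwards [h, Measure.ae_ne volume T] with r h1 h2 hr
  have h3 : r ∈ Ioc (min s t) (max s t) := hr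
  exact h1 ⟨(le_min hs.1 ht.1).trans_lt h3.1,
    lt_of_le_of_ne (h3.2.trans (max_le hs.2 ht.2)) h2⟩

lemma IsFlow.isTrajectory {T : ℝ} {v : ℝ → Plane → Plane} {X : ℝ → ℝ → Plane → Plane}
    (h : IsFlow T v X) {τ : ℝ} (hτ : τ ∈ Icc 0 T) (x : Plane) :
    IsTrajectory T v (fun t => X t τ x) := by
  obtain ⟨h1, h2⟩ := h τ hτ x
  refine ⟨h1, fun s hs t ht => ?_⟩
  rw [h2 t ht, h2 s hs, add_assoc, intervalIntegral.integral_add_adjacent_intervals]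
  · exact h1.mono_set (uIcc_subset_time hτ hs)
  · exact h1.mono_set (uIcc_subset_time hs ht)

lemma IsFlow.self {T : ℝ} {v : ℝ → Plane → Plane} {X : ℝ → ℝ → Plane → Plane}
    (h : IsFlow T v X) {τ : ℝ} (hτ : τ ∈ Icc 0 T) (x : Plane) : X τ τ x = x := by
  rw [(h τ hτ x).2 τ hτ]; simp

/-- Only the values of the field for almost all times matter. -/
lemma IsFlow.congr {T : ℝ} {v w : ℝ → Plane → Plane} {X : ℝ → ℝ → Plane → Plane}
    (h : IsFlow T v X) (hvw : ∀ t ∈ Ioo 0 T, v t = w t) : IsFlow T w X := by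
  intro τ hτ x
  obtain ⟨h1, h2⟩ := h τ hτ x
  have hae : ∀ᵐ t ∂(volume.restrict (Ioo 0 T)), v t = w t :=
    (ae_restrict_iff' measurableSet_Ioo).2 (Eventually.of_forall hvw)
  have h0T := hτ.1.trans hτ.2
  constructor
  · refine h1.congr_ae ?_
    rw [EventuallyEq, ae_restrict_iff' measurableSet_uIoc]
    filter_upwards [ae_uIoc_of_ae_restrict hae (left_mem_Icc.2 h0T) (right_mem_Icc.2 h0T)]
      with r hr hr'
    rw [hr hr']
  · intro t ht
    rw [h2 t ht]
    congr 1
    refine intervalIntegral.integral_congr_ae ?_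
    filter_upwards [ae_uIoc_of_ae_restrict hae hτ ht] with r hr hr'
    rw [hr hr']

lemma IsTrajectory.continuousOn {T : ℝ} {v : ℝ → Plane → Plane} {γ : ℝ → Plane}
    (h : IsTrajectory T v γ) (hT : 0 ≤ T) : ContinuousOn γ (Icc 0 T) := by
  have h1 : ContinuousOn (fun t => γ 0 + ∫ r in (0)..t, v r (γ r)) (Icc 0 T) := by
    refine continuousOn_const.add ?_
    have := intervalIntegral.continuousOn_primitive_interval' h.integrable left_mem_uIcc
    rwa [uIcc_of_le hT] at this
  exact h1.congr fun t ht => h.eqn 0 (left_mem_Icc.2 hT) t ht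

/-- Stability of trajectories, at precision `1 / N`. -/
lemma IsRegularField.dist_trajectory_le {T : ℝ} {v : ℝ → Plane → Plane} {b : ℝ → ℝ}
    (hv : IsRegularField T v b) {γ₁ γ₂ : ℝ → Plane} (h₁ : IsTrajectory T v γ₁)
    (h₂ : IsTrajectory T v γ₂) {t₀ : ℝ} (ht₀ : t₀ ∈ Icc 0 T) {N : ℕ} (hN : 1 ≤ N) {t : ℝ}
    (ht : t ∈ Icc 0 T) :
    ‖γ₁ t - γ₂ t‖ ≤ (‖γ₁ t₀ - γ₂ t₀‖ + (∫ r in (0)..T, b r) / N) *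
      Real.exp (logMod N * ∫ r in (0)..T, b r) := by
  have hT : 0 ≤ T := ht.1.trans ht.2
  have hN0 : (0 : ℝ) < N := by exact_mod_cast hN
  have hB : 0 ≤ ∫ r in (0)..T, b r := intervalIntegral.integral_nonneg hT fun r _ => hv.nonneg r
  have hcont : ContinuousOn (fun t => ‖γ₁ t - γ₂ t‖) (Icc 0 T) :=
    ((h₁.continuousOn hT).sub (h₂.continuousOn hT)).norm
  rw [← intervalIntegral.integral_const_mul]
  refine gronwall_integral_two_sided (f := fun t => ‖γ₁ t - γ₂ t‖) (k := fun r => logMod N * b r)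
    ht₀ hcont (hv.integrable.const_mul _) (fun r => mul_nonneg (logMod_nonneg N) (hv.nonneg r))
    (by positivity) ?_ (fun t => norm_nonneg _) t ht
  intro s hs
  have hsub := uIcc_subset_time ht₀ hs
  have i1 := h₁.integrable.mono_set hsub
  have i2 := h₂.integrable.mono_set hsub
  have e : γ₁ s - γ₂ s = (γ₁ t₀ - γ₂ t₀) + ∫ r in t₀..s, (v r (γ₁ r) - v r (γ₂ r)) := by
    rw [intervalIntegral.integral_sub i1 i2, h₁.eqn t₀ ht₀ s hs, h₂.eqn t₀ ht₀ s hs]; abel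
  have ib : IntervalIntegrable b volume t₀ s := hv.integrable.mono_set hsub
  have ik : IntervalIntegrable (fun r => logMod N * b r * ‖γ₁ r - γ₂ r‖) volume t₀ s :=
    (ib.const_mul _).mul_continuousOn (hcont.mono (by rwa [uIcc_of_le hT] at hsub))
  have h3 : ‖∫ r in t₀..s, (v r (γ₁ r) - v r (γ₂ r))‖ ≤
      |∫ r in t₀..s, (b r / N + logMod N * b r * ‖γ₁ r - γ₂ r‖)| := by
    refine intervalIntegral.norm_integral_le_abs_of_norm_le ?_ ((ib.div_const _).add ik)
    rw [ae_restrict_iff' measurableSet_uIoc]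
    filter_upwards [ae_uIoc_of_ae_restrict hv.modulus ht₀ hs] with r hr hr'
    refine (hr hr' N hN _ _).trans (le_of_eq ?_)
    ring
  have h4 : |∫ r in t₀..s, b r / N| ≤ (∫ r in (0)..T, b r) / N := by
    rw [intervalIntegral.integral_div, abs_div, abs_of_pos hN0]
    gcongr
    refine (intervalIntegral.abs_integral_mono_interval (c := 0) (d := T) ?_ ?_
      hv.integrable).trans (le_of_eq (abs_of_nonneg hB))
    · rw [uIoc_of_le hT]
      exact fun r hr => ⟨(le_min ht₀.1 hs.1).trans_lt hr.1, hr.2.trans (max_le ht₀.2 hs.2)⟩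
    · exact Eventually.of_forall hv.nonneg
  rw [intervalIntegral.integral_add (ib.div_const _) ik] at h3
  rw [e]
  refine (norm_add_le _ _).trans ?_
  rw [add_assoc]
  refine add_le_add_right (h3.trans ((abs_add_le _ _).trans ?_)) _
  exact add_le_add_left h4 _

/-- Trajectories depend continuously on their value at any time, uniformly in all times. -/
lemma IsRegularField.exists_dist_trajectory_lt {T : ℝ} {v : ℝ → Plane → Plane} {b : ℝ → ℝ}
    (hv : IsRegularField T v b) {ε : ℝ} (hε : 0 < ε) :
    ∃ δ > 0, ∀ γ₁ γ₂ : ℝ → Plane, IsTrajectory T v γ₁ → IsTrajectory T v γ₂ →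
      ∀ t₀ ∈ Icc 0 T, ∀ t ∈ Icc 0 T, ‖γ₁ t₀ - γ₂ t₀‖ < δ → ‖γ₁ t - γ₂ t‖ < ε := by
  set B := ∫ r in (0)..T, b r with hB
  have h1 : Tendsto (fun N : ℕ => B * (Real.exp (logMod N * B) / N)) atTop (𝓝 0) := by
    simpa using (tendsto_exp_logMod_div B).const_mul B
  obtain ⟨N, hN1, hN2⟩ := ((h1.eventually (gt_mem_nhds (half_pos hε))).and
    (eventually_ge_atTop 1)).exists
  refine ⟨ε / 2 / Real.exp (logMod N * B), by positivity,
    fun γ₁ γ₂ h₁ h₂ t₀ ht₀ t ht hd => ?_⟩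
  have h := hv.dist_trajectory_le h₁ h₂ ht₀ hN2 ht
  rw [← hB, add_mul] at h
  rw [lt_div_iff₀ (Real.exp_pos _)] at hd
  calc ‖γ₁ t - γ₂ t‖ ≤ _ := h
    _ < ε / 2 + ε / 2 := by
        refine add_lt_add hd ?_
        convert hN1 using 1
        ring
    _ = ε := add_halves ε

/-- The flow of a regular field is jointly continuous. -/
lemma IsRegularField.continuousOn_flow {T : ℝ} {v : ℝ → Plane → Plane} {b : ℝ → ℝ}
    (hv : IsRegularField T v b) {X : ℝ → ℝ → Plane → Plane} (hX : IsFlow T v X) :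
    ContinuousOn (fun p : ℝ × ℝ × Plane => X p.1 p.2.1 p.2.2) (Icc 0 T ×ˢ Icc 0 T ×ˢ univ) := by
  rintro ⟨t, τ, x⟩ ⟨ht, hτ, -⟩
  simp only at ht hτ
  have hT : 0 ≤ T := ht.1.trans ht.2
  have hγ := hX.isTrajectory hτ x
  have hc := hγ.continuousOn hT
  rw [ContinuousWithinAt, Metric.tendsto_nhds]
  intro ε hε
  obtain ⟨δ, hδ, H⟩ := hv.exists_dist_trajectory_lt (half_pos hε)
  have hS : Icc 0 T ×ˢ Icc 0 T ×ˢ univ ∈ 𝓝[Icc 0 T ×ˢ Icc 0 T ×ˢ (univ : Set Plane)]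
    ((t, τ, x) : ℝ × ℝ × Plane) := self_mem_nhdsWithin
  have c1 : Tendsto (fun p : ℝ × ℝ × Plane => X p.1 τ x)
      (𝓝[Icc 0 T ×ˢ Icc 0 T ×ˢ univ] (t, τ, x)) (𝓝 (X t τ x)) :=
    (hc t ht).tendsto.comp (tendsto_nhdsWithin_iff.2
      ⟨(continuous_fst.tendsto _).mono_left nhdsWithin_le_nhds,
        eventually_of_mem hS fun p hp => hp.1⟩)
  have c2 : Tendsto (fun p : ℝ × ℝ × Plane => ‖p.2.2 - X p.2.1 τ x‖)
      (𝓝[Icc 0 T ×ˢ Icc 0 T ×ˢ univ] (t, τ, x)) (𝓝 0) := by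
    have c3 : Tendsto (fun p : ℝ × ℝ × Plane => X p.2.1 τ x)
        (𝓝[Icc 0 T ×ˢ Icc 0 T ×ˢ univ] (t, τ, x)) (𝓝 (X τ τ x)) :=
      (hc τ hτ).tendsto.comp (tendsto_nhdsWithin_iff.2
        ⟨((continuous_fst.comp continuous_snd).tendsto _).mono_left nhdsWithin_le_nhds,
          eventually_of_mem hS fun p hp => hp.2.1⟩)
    have c4 : Tendsto (fun p : ℝ × ℝ × Plane => p.2.2)
        (𝓝[Icc 0 T ×ˢ Icc 0 T ×ˢ univ] (t, τ, x)) (𝓝 x) :=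
      ((continuous_snd.comp continuous_snd).tendsto _).mono_left nhdsWithin_le_nhds
    have := (c4.sub c3).norm
    rwa [hX.self hτ, sub_self, norm_zero] at this
  filter_upwards [hS, Metric.tendsto_nhds.1 c1 _ (half_pos hε), c2.eventually (gt_mem_nhds hδ)]
    with p hp h1 h2
  have h3 := H _ _ (hX.isTrajectory hp.2.1 p.2.2) hγ p.2.1 hp.2.1 p.1 hp.1 (by
    simp only [hX.self hp.2.1]; exact h2)
  calc dist (X p.1 p.2.1 p.2.2) (X t τ x)
      ≤ dist (X p.1 p.2.1 p.2.2) (X p.1 τ x) + dist (X p.1 τ x) (X t τ x) := dist_triangle _ _ _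
    _ < ε / 2 + ε / 2 := add_lt_add (by rw [dist_eq_norm]; exact h3) h1
    _ = ε := add_halves ε

/-! ### Volume distortion of the Euler scheme -/

/-- The divergence of a linear field. -/
def linTrace (A : Plane →L[ℝ] Plane) : ℝ := ∑ i, (A (unitVec i)) i

lemma abs_apply_unitVec_le (A : Plane →L[ℝ] Plane) (i j : Fin 2) : |(A (unitVec j)) i| ≤ ‖A‖ := by
  have h1 : |(A (unitVec j)) i| ≤ ‖A (unitVec j)‖ := by
    rw [← Real.norm_eq_abs]; exact PiLp.norm_apply_le (A (unitVec j)) i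
  refine h1.trans ((A.le_opNorm _).trans (le_of_eq ?_))
  simp [unitVec]

/-- In the plane `det (1 + A) = 1 + tr A + det A`, and `|det A| ≤ 2 ‖A‖²`. -/
lemma le_det_one_add (A : Plane →L[ℝ] Plane) (h : linTrace A = 0) :
    1 - 2 * ‖A‖ ^ 2 ≤ (ContinuousLinearMap.id ℝ Plane + A).det := by
  have hdet : (ContinuousLinearMap.id ℝ Plane + A).det =
      (1 + (A (unitVec 0)) 0) * (1 + (A (unitVec 1)) 1) - (A (unitVec 1)) 0 * (A (unitVec 0)) 1 := by
    rw [ContinuousLinearMap.det,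
      ← LinearMap.det_toMatrix (EuclideanSpace.basisFun (Fin 2) ℝ).toBasis, Matrix.det_fin_two]
    simp [LinearMap.toMatrix_apply, unitVec]
  have h00 := abs_le.1 (abs_apply_unitVec_le A 0 0)
  have h11 := abs_le.1 (abs_apply_unitVec_le A 1 1)
  have h01 := abs_le.1 (abs_apply_unitVec_le A 0 1)
  have h10 := abs_le.1 (abs_apply_unitVec_le A 1 0)
  rw [linTrace, Fin.sum_univ_two] at h
  rw [hdet]
  have e1 : |(A (unitVec 0)) 0 * (A (unitVec 1)) 1| ≤ ‖A‖ * ‖A‖ := by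
    rw [abs_mul]; gcongr <;> exact abs_apply_unitVec_le A _ _
  have e2 : |(A (unitVec 1)) 0 * (A (unitVec 0)) 1| ≤ ‖A‖ * ‖A‖ := by
    rw [abs_mul]; gcongr <;> exact abs_apply_unitVec_le A _ _
  have e1' := abs_le.1 e1
  have e2' := abs_le.1 e2
  nlinarith

/-- A measurable field `w`, differentiable in space at almost every time, which is divergence free at
the points at distance at least `ε` from the complement of `Ω`. Its differential is `D`, and the
integrable function `l` bounds its Lipschitz constant. -/
structure IsSmoothField (T : ℝ) (Ω : Set Plane) (ε : ℝ) (w : ℝ → Plane → Plane)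
    (D : ℝ → Plane → Plane →L[ℝ] Plane) (l : ℝ → ℝ) : Prop where
  measurable : Measurable (Function.uncurry w)
  integrable : ∀ x, IntervalIntegrable (fun t => w t x) volume 0 T
  measurable_deriv : ∀ x, AEStronglyMeasurable (fun t => D t x) (volume.restrict (Ioo 0 T))
  nonneg : ∀ t, 0 ≤ l t
  integrable_bound : IntervalIntegrable l volume 0 T
  hasFDerivAt : ∀ᵐ t ∂(volume.restrict (Ioo 0 T)), ∀ x, HasFDerivAt (w t) (D t x) x
  norm_le : ∀ᵐ t ∂(volume.restrict (Ioo 0 T)), ∀ x, ‖D t x‖ ≤ l t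
  trace_eq : ∀ᵐ t ∂(volume.restrict (Ioo 0 T)), ∀ x, Metric.ball x ε ⊆ Ω → linTrace (D t x) = 0

/-- One step of the Euler scheme, from time `s` to time `s'`. -/
def eulerStep (w : ℝ → Plane → Plane) (s s' : ℝ) (x : Plane) : Plane := x + ∫ r in s..s', w r x

lemma measurableSet_ball_subset (Ω : Set Plane) (ε : ℝ) :
    MeasurableSet {x : Plane | Metric.ball x ε ⊆ Ω} := by
  have h : {x : Plane | Metric.ball x ε ⊆ Ω} = {x | ENNReal.ofReal ε ≤ Metric.infEDist x Ωᶜ} := by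
    ext x
    simp only [mem_ofPred_eq, Metric.le_infEDist]
    constructor
    · intro h y hy
      by_contra hlt
      rw [not_le, edist_dist, ENNReal.ofReal_lt_ofReal_iff_of_nonneg dist_nonneg] at hlt
      exact hy (h (by rwa [Metric.mem_ball, dist_comm]))
    · intro h y hy
      by_contra hy'
      have h1 := h y hy'
      rw [edist_dist, ENNReal.ofReal_le_ofReal_iff dist_nonneg, dist_comm] at h1
      exact absurd hy (by rw [Metric.mem_ball]; exact not_lt.2 h1)
  rw [h]
  exact (isClosed_le continuous_const Metric.continuous_infEDist).measurableSet

section Step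

variable {T : ℝ} {Ω : Set Plane} {ε : ℝ} {w : ℝ → Plane → Plane}
  {D : ℝ → Plane → Plane →L[ℝ] Plane} {l : ℝ → ℝ}

lemma uIoc_subset_Ioc_time {T s t : ℝ} (hs : s ∈ Icc 0 T) (ht : t ∈ Icc 0 T) :
    uIoc s t ⊆ Ioc 0 T := fun _ hr =>
  ⟨(le_min hs.1 ht.1).trans_lt hr.1, hr.2.trans (max_le hs.2 ht.2)⟩

lemma IsSmoothField.hasFDerivAt_eulerStep (h : IsSmoothField T Ω ε w D l) {s s' : ℝ}
    (hs : s ∈ Icc 0 T) (hs' : s' ∈ Icc 0 T) (x : Plane) :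
    HasFDerivAt (eulerStep w s s') (ContinuousLinearMap.id ℝ Plane + ∫ r in s..s', D r x) x := by
  refine (hasFDerivAt_id x).add ?_
  refine intervalIntegral.hasFDerivAt_integral_of_dominated_of_fderiv_le (s := univ)
    (F := fun x r => w r x) (F' := fun x r => D r x) (bound := l) univ_mem ?_ ?_ ?_ ?_ ?_ ?_
  · refine Eventually.of_forall fun y => ?_
    exact (h.measurable.comp (measurable_id.prodMk measurable_const)).aestronglyMeasurable
  · exact (h.integrable x).mono_set (uIcc_subset_time hs hs')
  · refine AEStronglyMeasurable.mono_set (uIoc_subset_Ioc_time hs hs') ?_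
    rw [← restrict_Ioo_eq_restrict_Ioc]
    exact h.measurable_deriv x
  · filter_upwards [ae_uIoc_of_ae_restrict h.norm_le hs hs'] with r hr hr' y _ using hr hr' y
  · exact h.integrable_bound.mono_set (uIcc_subset_time hs hs')
  · filter_upwards [ae_uIoc_of_ae_restrict h.hasFDerivAt hs hs'] with r hr hr' y _ using hr hr' y

lemma IsSmoothField.norm_integral_deriv_le (h : IsSmoothField T Ω ε w D l) {s s' : ℝ}
    (hs : s ∈ Icc 0 T) (hs' : s' ∈ Icc 0 T) (x : Plane) :
    ‖∫ r in s..s', D r x‖ ≤ |∫ r in s..s', l r| := by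
  refine intervalIntegral.norm_integral_le_abs_of_norm_le ?_
    (h.integrable_bound.mono_set (uIcc_subset_time hs hs'))
  rw [ae_restrict_iff' measurableSet_uIoc]
  filter_upwards [ae_uIoc_of_ae_restrict h.norm_le hs hs'] with r hr hr' using hr hr' x

lemma IsSmoothField.continuous_eulerStep (h : IsSmoothField T Ω ε w D l) {s s' : ℝ}
    (hs : s ∈ Icc 0 T) (hs' : s' ∈ Icc 0 T) : Continuous (eulerStep w s s') :=
  continuous_iff_continuousAt.2 fun x => (h.hasFDerivAt_eulerStep hs hs' x).continuousAt

lemma IsSmoothField.injective_eulerStep (h : IsSmoothField T Ω ε w D l) {s s' : ℝ}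
    (hs : s ∈ Icc 0 T) (hs' : s' ∈ Icc 0 T) (hl : |∫ r in s..s', l r| < 1) :
    Function.Injective (eulerStep w s s') := by
  intro x y hxy
  have h1 : ‖(eulerStep w s s' y - y) - (eulerStep w s s' x - x)‖ ≤
      |∫ r in s..s', l r| * ‖y - x‖ := by
    refine Convex.norm_image_sub_le_of_norm_hasFDerivWithin_le (𝕜 := ℝ)
      (f := fun x => eulerStep w s s' x - x) (f' := fun x => ∫ r in s..s', D r x) (s := univ)
      (fun z _ => ?_) (fun z _ => h.norm_integral_deriv_le hs hs' z) convex_univ (mem_univ x)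
      (mem_univ y)
    refine HasFDerivAt.hasFDerivWithinAt ?_
    refine ((h.hasFDerivAt_eulerStep hs hs' z).fun_sub (hasFDerivAt_id z)).congr_fderiv ?_
    exact add_sub_cancel_left _ _
  rw [hxy] at h1
  have h2 : ‖y - x‖ ≤ |∫ r in s..s', l r| * ‖y - x‖ := by
    convert h1 using 1
    rw [← norm_neg]; congr 1; abel
  by_contra hne
  have h3 : 0 < ‖y - x‖ := norm_pos_iff.2 (sub_ne_zero.2 (Ne.symm hne))
  nlinarith

lemma IsSmoothField.linTrace_integral (h : IsSmoothField T Ω ε w D l) {s s' : ℝ}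
    (hs : s ∈ Icc 0 T) (hs' : s' ∈ Icc 0 T) {x : Plane} (hx : Metric.ball x ε ⊆ Ω) :
    linTrace (∫ r in s..s', D r x) = 0 := by
  have hint : IntervalIntegrable (fun r => D r x) volume s s' := by
    refine IntervalIntegrable.mono_set (a := 0) (b := T) ?_ (uIcc_subset_time hs hs')
    have h0T : 0 ≤ T := hs.1.trans hs.2
    refine h.integrable_bound.mono_fun ?_ ?_
    · rw [uIoc_of_le h0T, ← restrict_Ioo_eq_restrict_Ioc]; exact h.measurable_deriv x
    · rw [uIoc_of_le h0T, ← restrict_Ioo_eq_restrict_Ioc]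
      filter_upwards [h.norm_le] with r hr
      exact (hr x).trans (le_abs_self _)
  let L : (Plane →L[ℝ] Plane) →L[ℝ] ℝ := ∑ i,
    (EuclideanSpace.proj i).comp (ContinuousLinearMap.apply ℝ Plane (unitVec i))
  have hL : ∀ A, linTrace A = L A := fun A => by simp [L, linTrace]
  rw [hL, ← ContinuousLinearMap.intervalIntegral_comp_comm L hint,
    intervalIntegral.integral_congr_ae (g := fun _ => (0 : ℝ)), intervalIntegral.integral_zero]
  filter_upwards [ae_uIoc_of_ae_restrict h.trace_eq hs hs'] with r hr hr'
  rw [← hL, hr hr' x hx]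

/-- A short Euler step along a divergence free field almost preserves areas. -/
lemma IsSmoothField.volume_eulerStep_le (h : IsSmoothField T Ω ε w D l) {s s' : ℝ}
    (hs : s ∈ Icc 0 T) (hs' : s' ∈ Icc 0 T) (hl : |∫ r in s..s', l r| < 1) {B : Set Plane}
    (hB : MeasurableSet B) :
    volume ({x | Metric.ball x ε ⊆ Ω} ∩ eulerStep w s s' ⁻¹' B) *
      ENNReal.ofReal (1 - 2 * |∫ r in s..s', l r| ^ 2) ≤ volume B := by
  set Φ := eulerStep w s s'
  set S := {x | Metric.ball x ε ⊆ Ω} ∩ Φ ⁻¹' B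
  have hS : MeasurableSet S := (measurableSet_ball_subset Ω ε).inter
    ((h.continuous_eulerStep hs hs').measurable hB)
  have h1 := lintegral_image_eq_lintegral_abs_det_fderiv_mul volume hS
    (fun x _ => (h.hasFDerivAt_eulerStep hs hs' x).hasFDerivWithinAt)
    (h.injective_eulerStep hs hs' hl).injOn (fun _ => 1)
  simp only [lintegral_const, Measure.restrict_apply MeasurableSet.univ, univ_inter, one_mul,
    mul_one] at h1
  calc volume S * ENNReal.ofReal (1 - 2 * |∫ r in s..s', l r| ^ 2)
      = ∫⁻ x in S, ENNReal.ofReal (1 - 2 * |∫ r in s..s', l r| ^ 2) := by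
        rw [setLIntegral_const, mul_comm]
    _ ≤ ∫⁻ x in S, ENNReal.ofReal |(ContinuousLinearMap.id ℝ Plane + ∫ r in s..s', D r x).det| := by
        refine setLIntegral_mono' hS fun x hx => ENNReal.ofReal_le_ofReal ?_
        refine le_trans ?_ ((le_det_one_add _ (h.linTrace_integral hs hs' hx.1)).trans (le_abs_self _))
        have := h.norm_integral_deriv_le hs hs' x
        gcongr
    _ = volume (Φ '' S) := h1.symm
    _ ≤ volume B := measure_mono (by rintro _ ⟨x, hx, rfl⟩; exact hx.2)

end Step

/-- Composition of maps which do not compress areas too much. -/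
lemma volume_iterate_le {Φ : ℕ → Plane → Plane} (hΦ : ∀ k, Measurable (Φ k)) {S : Set Plane}
    (hS : MeasurableSet S) {c : ℕ → ℝ≥0∞}
    (h : ∀ k, ∀ B, MeasurableSet B → volume (S ∩ Φ k ⁻¹' B) * c k ≤ volume B)
    {Ψ : ℕ → Plane → Plane} (h0 : ∀ x, Ψ 0 x = x) (hΨ : ∀ k x, Ψ (k + 1) x = Φ k (Ψ k x)) (k : ℕ) :
    ∀ B, MeasurableSet B →
      volume {x | (∀ j < k, Ψ j x ∈ S) ∧ Ψ k x ∈ B} * ∏ j ∈ Finset.range k, c j ≤ volume B := by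
  induction k with
  | zero => intro B _; simp [h0]
  | succ k ih =>
    intro B hB
    have h1 := ih (S ∩ Φ k ⁻¹' B) (hS.inter (hΦ k hB))
    rw [Finset.prod_range_succ, ← mul_assoc]
    refine le_trans ?_ (h k B hB)
    refine mul_le_mul_left ((mul_le_mul_left (measure_mono fun x hx => ?_) _).trans h1) _
    exact ⟨fun j hj => hx.1 j (hj.trans k.lt_succ_self), hx.1 k k.lt_succ_self, by
      have := hx.2; rwa [hΨ] at this⟩

lemma one_sub_sum_le_prod (x : ℕ → ℝ) (h0 : ∀ k, 0 ≤ x k) (h1 : ∀ k, x k ≤ 1) (n : ℕ) :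
    1 - ∑ k ∈ Finset.range n, x k ≤ ∏ k ∈ Finset.range n, (1 - x k) := by
  induction n with
  | zero => simp
  | succ n ih =>
    rw [Finset.prod_range_succ, Finset.sum_range_succ]
    have hS : 0 ≤ ∑ k ∈ Finset.range n, x k := Finset.sum_nonneg fun k _ => h0 k
    nlinarith [mul_le_mul_of_nonneg_right ih (sub_nonneg.2 (h1 n)), h0 n, mul_nonneg hS (h0 n)]

/-- The times of the Euler scheme with `M` steps from `t₀` to `τ`, constant after step `M`. -/
def eulerTime (t₀ τ : ℝ) (M k : ℕ) : ℝ := t₀ + min ((k : ℝ) / M) 1 * (τ - t₀)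

/-- The Euler scheme with `M` steps from `t₀` to `τ`. -/
def euler (w : ℝ → Plane → Plane) (t₀ τ : ℝ) (M : ℕ) : ℕ → Plane → Plane
  | 0, x => x
  | k + 1, x => eulerStep w (eulerTime t₀ τ M k) (eulerTime t₀ τ M (k + 1)) (euler w t₀ τ M k x)

section Times

variable {T t₀ τ : ℝ} {M : ℕ}

lemma eulerTime_zero : eulerTime t₀ τ M 0 = t₀ := by simp [eulerTime]

lemma eulerTime_last (hM : 1 ≤ M) : eulerTime t₀ τ M M = τ := by
  have : (M : ℝ) ≠ 0 := by positivity
  simp [eulerTime, this]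

lemma eulerTime_mem_uIcc (k : ℕ) : eulerTime t₀ τ M k ∈ uIcc t₀ τ := by
  have h0 : 0 ≤ min ((k : ℝ) / M) 1 := le_min (by positivity) zero_le_one
  have h1 : min ((k : ℝ) / M) 1 ≤ 1 := min_le_right _ _
  rw [eulerTime]
  rcases le_total t₀ τ with h | h
  · rw [uIcc_of_le h]; constructor <;> nlinarith
  · rw [uIcc_of_ge h]; constructor <;> nlinarith

lemma eulerTime_mem (ht₀ : t₀ ∈ Icc 0 T) (hτ : τ ∈ Icc 0 T) (k : ℕ) :
    eulerTime t₀ τ M k ∈ Icc 0 T :=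
  uIcc_subset_Icc ht₀ hτ (eulerTime_mem_uIcc k)

lemma eulerFrac_mono (M : ℕ) : Monotone fun k : ℕ => min ((k : ℝ) / M) 1 := fun i j hij => by
  dsimp only; gcongr

lemma eulerTime_mono (h : t₀ ≤ τ) : Monotone (eulerTime t₀ τ M) := fun i j hij => by
  have := eulerFrac_mono M hij
  simp only [eulerTime]; nlinarith

lemma eulerTime_anti (h : τ ≤ t₀) : Antitone (eulerTime t₀ τ M) := fun i j hij => by
  have := eulerFrac_mono M hij
  simp only [eulerTime]; nlinarith

lemma abs_eulerTime_succ_sub_le (k : ℕ) :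
    |eulerTime t₀ τ M (k + 1) - eulerTime t₀ τ M k| ≤ |τ - t₀| / M := by
  have h1 := eulerFrac_mono M k.le_succ
  have h2 : min (((k + 1 : ℕ) : ℝ) / M) 1 ≤ min ((k : ℝ) / M) 1 + 1 / M := by
    rw [min_add]
    refine min_le_min (le_of_eq (by push_cast; ring)) ?_
    have : (0 : ℝ) ≤ 1 / M := by positivity
    linarith
  have e : eulerTime t₀ τ M (k + 1) - eulerTime t₀ τ M k =
      (min (((k + 1 : ℕ) : ℝ) / M) 1 - min ((k : ℝ) / M) 1) * (τ - t₀) := by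
    simp only [eulerTime]; ring
  simp only [Nat.succ_eq_add_one] at h1
  rw [e, abs_mul, abs_of_nonneg (by linarith), show |τ - t₀| / M = 1 / M * |τ - t₀| by ring]
  exact mul_le_mul_of_nonneg_right (by linarith) (abs_nonneg _)

lemma sum_abs_integral_eulerTime_le (ht₀ : t₀ ∈ Icc 0 T) (hτ : τ ∈ Icc 0 T) {l : ℝ → ℝ}
    (hl : IntervalIntegrable l volume 0 T) (h0 : ∀ t, 0 ≤ l t) (n : ℕ) :
    ∑ k ∈ Finset.range n, |∫ r in eulerTime t₀ τ M k..eulerTime t₀ τ M (k + 1), l r| ≤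
      ∫ r in (0)..T, l r := by
  have hint : ∀ k, IntervalIntegrable l volume (eulerTime t₀ τ M k) (eulerTime t₀ τ M (k + 1)) :=
    fun k => hl.mono_set (uIcc_subset_time (eulerTime_mem ht₀ hτ _) (eulerTime_mem ht₀ hτ _))
  have hsum := intervalIntegral.sum_integral_adjacent_intervals (n := n) (fun k _ => hint k)
  have key : ∑ k ∈ Finset.range n, |∫ r in eulerTime t₀ τ M k..eulerTime t₀ τ M (k + 1), l r| ≤
      |∫ r in eulerTime t₀ τ M 0..eulerTime t₀ τ M n, l r| := by
    rw [← hsum]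
    rcases le_total t₀ τ with h | h
    · refine le_trans (le_of_eq (Finset.sum_congr rfl fun k _ => abs_of_nonneg ?_)) (le_abs_self _)
      exact intervalIntegral.integral_nonneg (eulerTime_mono h k.le_succ) fun r _ => h0 r
    · refine le_trans (le_of_eq ?_) (neg_le_abs _)
      rw [← Finset.sum_neg_distrib]
      refine Finset.sum_congr rfl fun k _ => abs_of_nonpos ?_
      rw [intervalIntegral.integral_symm, neg_nonpos]
      exact intervalIntegral.integral_nonneg (eulerTime_anti h k.le_succ) fun r _ => h0 r
  have hT : 0 ≤ T := ht₀.1.trans ht₀.2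
  refine key.trans ((intervalIntegral.abs_integral_mono_interval (c := 0) (d := T) ?_
    (Eventually.of_forall h0) hl).trans (le_of_eq (abs_of_nonneg ?_)))
  · rw [uIoc_of_le hT]
    exact uIoc_subset_Ioc_time (eulerTime_mem ht₀ hτ _) (eulerTime_mem ht₀ hτ _)
  · exact intervalIntegral.integral_nonneg hT fun r _ => h0 r

/-- A continuous function oscillates little over the steps of a fine Euler scheme. -/
lemma exists_eulerTime_osc_le {E : Type*} [PseudoMetricSpace E] {f : ℝ → E}
    (hf : ContinuousOn f (Icc 0 T)) (ht₀ : t₀ ∈ Icc 0 T) (hτ : τ ∈ Icc 0 T) {η : ℝ} (hη : 0 < η) :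
    ∃ M₀ : ℕ, ∀ M ≥ M₀, ∀ k, ∀ r ∈ uIcc (eulerTime t₀ τ M k) (eulerTime t₀ τ M (k + 1)),
      dist (f r) (f (eulerTime t₀ τ M k)) ≤ η := by
  have huc := isCompact_Icc.uniformContinuousOn_of_continuous hf
  rw [Metric.uniformContinuousOn_iff_le] at huc
  obtain ⟨δ, hδ, H⟩ := huc η hη
  obtain ⟨M₀, hM₀⟩ := exists_nat_gt (|τ - t₀| / δ)
  refine ⟨M₀, fun M hM k r hr => ?_⟩
  have hM1 : |τ - t₀| / δ < M := hM₀.trans_le (by exact_mod_cast hM)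
  have hM0 : (0 : ℝ) < M := lt_of_le_of_lt (by positivity) hM1
  refine H r ?_ _ (eulerTime_mem ht₀ hτ k) ?_
  · exact uIcc_subset_Icc (eulerTime_mem ht₀ hτ _) (eulerTime_mem ht₀ hτ _) hr
  · rw [Real.dist_eq]
    refine (abs_sub_left_of_mem_uIcc hr).trans ((abs_eulerTime_succ_sub_le k).trans ?_)
    rw [div_le_iff₀ hM0]
    rw [div_lt_iff₀ hδ] at hM1
    linarith

end Times

/-- The Euler scheme of a uniform approximation of a regular field stays close to its
trajectories. -/
lemma IsRegularField.exists_euler_close {T : ℝ} {v : ℝ → Plane → Plane} {b : ℝ → ℝ}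
    (hv : IsRegularField T v b) {γ : ℝ → Plane} (hγ : IsTrajectory T v γ) {t₀ τ : ℝ}
    (ht₀ : t₀ ∈ Icc 0 T) (hτ : τ ∈ Icc 0 T) {ε : ℝ} (hε : 0 < ε) :
    ∃ η > 0, ∃ M₀ : ℕ, ∀ M ≥ M₀, ∀ (w : ℝ → Plane → Plane) (e : ℝ),
      (∀ x, IntervalIntegrable (fun t => w t x) volume 0 T) → 0 ≤ e → e ≤ η →
      (∀ᵐ t ∂(volume.restrict (Ioo 0 T)), ∀ x, ‖w t x - v t x‖ ≤ b t * e) →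
      ∀ k, ‖euler w t₀ τ M k (γ t₀) - γ (eulerTime t₀ τ M k)‖ ≤ ε := by
  have hT : 0 ≤ T := ht₀.1.trans ht₀.2
  set B := ∫ r in (0)..T, b r with hB
  have hB0 : 0 ≤ B := intervalIntegral.integral_nonneg hT fun r _ => hv.nonneg r
  have h1 : Tendsto (fun N : ℕ => B * (Real.exp (logMod N * B) / N)) atTop (𝓝 0) := by
    simpa using (tendsto_exp_logMod_div B).const_mul B
  obtain ⟨N, hN1, hN2⟩ := ((h1.eventually (gt_mem_nhds (half_pos hε))).and
    (eventually_ge_atTop 1)).exists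
  have hN0 : (0 : ℝ) < N := by exact_mod_cast hN2
  set E := Real.exp (logMod N * B) with hE
  have hE0 : 0 < E := Real.exp_pos _
  have hc := logMod_nonneg N
  set q := ε / 2 / ((B + 1) * E) with hq
  have hq0 : 0 < q := by positivity
  obtain ⟨M₀, hM₀⟩ := exists_eulerTime_osc_le (hγ.continuousOn hT) ht₀ hτ
    (η := q / 2 / (logMod N + 1)) (by positivity)
  refine ⟨q / 2, by positivity, M₀, fun M hM w e hw he0 he hwv k => ?_⟩
  set η' := q / 2 / (logMod N + 1) with hη'
  have hη'0 : 0 < η' := by positivity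
  set s := eulerTime t₀ τ M with hs
  have hsm : ∀ k, s k ∈ Icc 0 T := fun k => eulerTime_mem ht₀ hτ k
  let u : ℕ → ℝ := fun k => ‖euler w t₀ τ M k (γ t₀) - γ (s k)‖
  let β : ℕ → ℝ := fun k => |∫ r in s k..s (k + 1), b r|
  have hβ : ∀ k, 0 ≤ β k := fun k => abs_nonneg _
  -- one step: the error of approximation `e`, the oscillation `η'` of `γ` and the precision `1 / N`
  have hstep : ∀ k, u (k + 1) ≤ (1 + logMod N * β k) * u k + (e + logMod N * η' + 1 / N) * β k := by
    intro k
    set y := euler w t₀ τ M k (γ t₀) with hy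
    have hsub := uIcc_subset_time (hsm k) (hsm (k + 1))
    have iw := (hw y).mono_set hsub
    have iv := hγ.integrable.mono_set hsub
    have ib : IntervalIntegrable b volume (s k) (s (k + 1)) := hv.integrable.mono_set hsub
    have e1 : euler w t₀ τ M (k + 1) (γ t₀) - γ (s (k + 1)) =
        (y - γ (s k)) + ∫ r in s k..s (k + 1), (w r y - v r (γ r)) := by
      rw [intervalIntegral.integral_sub iw iv, hγ.eqn (s k) (hsm k) (s (k + 1)) (hsm (k + 1))]
      change y + (∫ r in s k..s (k + 1), w r y) - _ = _
      abel
    have e2 : ‖∫ r in s k..s (k + 1), (w r y - v r (γ r))‖ ≤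
        |∫ r in s k..s (k + 1), b r * (e + logMod N * (u k + η') + 1 / N)| := by
      refine intervalIntegral.norm_integral_le_abs_of_norm_le ?_ (ib.mul_const _)
      rw [ae_restrict_iff' measurableSet_uIoc]
      filter_upwards [ae_uIoc_of_ae_restrict hwv (hsm k) (hsm (k + 1)),
        ae_uIoc_of_ae_restrict hv.modulus (hsm k) (hsm (k + 1))] with r h1 h2 hr
      have hb := hv.nonneg r
      have h3 := hM₀ M hM k r (uIoc_subset_uIcc hr)
      have h4 : ‖y - γ r‖ ≤ u k + η' := by
        have : y - γ r = (y - γ (s k)) + (γ (s k) - γ r) := by abel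
        rw [this]
        refine (norm_add_le _ _).trans (add_le_add le_rfl ?_)
        rw [← dist_eq_norm, dist_comm]; exact h3
      calc ‖w r y - v r (γ r)‖ ≤ ‖w r y - v r y‖ + ‖v r y - v r (γ r)‖ := norm_sub_le_norm_sub_add_norm_sub _ _ _
        _ ≤ b r * e + b r * (logMod N * (u k + η') + 1 / N) := by
            refine add_le_add (h1 hr y) ((h2 hr N hN2 _ _).trans ?_)
            gcongr
        _ = _ := by ring
    rw [intervalIntegral.integral_mul_const, abs_mul,
      abs_of_nonneg (a := e + logMod N * (u k + η') + 1 / N) (by positivity)] at e2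
    calc u (k + 1) = ‖(y - γ (s k)) + ∫ r in s k..s (k + 1), (w r y - v r (γ r))‖ := by rw [← e1]
      _ ≤ u k + β k * (e + logMod N * (u k + η') + 1 / N) := (norm_add_le _ _).trans
          (add_le_add le_rfl e2)
      _ = _ := by ring
  have hu0 : u 0 = 0 := by
    simp only [u, hs, eulerTime_zero]
    change ‖γ t₀ - γ t₀‖ = 0
    simp
  have hg := discrete_gronwall (n₀ := 0) (u := u) (c := fun k => logMod N * β k)
    (b := fun k => (e + logMod N * η' + 1 / N) * β k) (norm_nonneg _) (fun k _ => hstep k)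
    (fun k _ => mul_nonneg hc (hβ k)) (fun k _ => mul_nonneg (by positivity) (hβ k)) (Nat.zero_le k)
  rw [hu0, zero_add, ← Finset.mul_sum, ← Finset.mul_sum, ← Finset.range_eq_Ico] at hg
  have hsumβ : ∑ j ∈ Finset.range k, β j ≤ B :=
    sum_abs_integral_eulerTime_le ht₀ hτ hv.integrable hv.nonneg k
  have hsum0 : 0 ≤ ∑ j ∈ Finset.range k, β j := Finset.sum_nonneg fun j _ => hβ j
  have hη1 : logMod N * η' ≤ q / 2 := by
    rw [hη', mul_div_assoc', div_le_iff₀ (by positivity)]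
    nlinarith
  calc u k ≤ _ := hg
    _ ≤ (q + 1 / N) * B * E := by
        have : Real.exp (logMod N * ∑ j ∈ Finset.range k, β j) ≤ E :=
          Real.exp_le_exp.2 (by gcongr)
        gcongr
        linarith
    _ = q * B * E + B * (E / N) := by ring
    _ ≤ ε / 2 + ε / 2 := by
        refine add_le_add ?_ hN1.le
        calc q * B * E ≤ q * (B + 1) * E := by gcongr; linarith
          _ = ε / 2 := by rw [hq]; field_simp
    _ = ε := add_halves ε

/-- `v` is a uniform limit of smooth fields which are divergence free at a positive distance from
the complement of `Ω`. -/
def IsApproximable (T : ℝ) (Ω : Set Plane) (v : ℝ → Plane → Plane) (b : ℝ → ℝ) : Prop :=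
  ∃ (w : ℕ → ℝ → Plane → Plane) (D : ℕ → ℝ → Plane → Plane →L[ℝ] Plane) (l : ℕ → ℝ → ℝ) (e : ℕ → ℝ),
    (∀ n : ℕ, IsSmoothField T Ω (1 / ((n : ℝ) + 1)) (w n) (D n) (l n)) ∧ (∀ n, 0 ≤ e n) ∧
    Tendsto e atTop (𝓝 0) ∧
    ∀ n, ∀ᵐ t ∂(volume.restrict (Ioo 0 T)), ∀ x, ‖w n t x - v t x‖ ≤ b t * e n

/-- A fine Euler scheme of a smooth field does not compress areas by more than a factor `2`, since the
squares of the integrals of `l` over the steps have a small sum. -/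
lemma IsSmoothField.volume_euler_le {T : ℝ} {Ω : Set Plane} {ε : ℝ} {w : ℝ → Plane → Plane}
    {D : ℝ → Plane → Plane →L[ℝ] Plane} {l : ℝ → ℝ} (h : IsSmoothField T Ω ε w D l) {t₀ τ : ℝ}
    (ht₀ : t₀ ∈ Icc 0 T) (hτ : τ ∈ Icc 0 T) :
    ∃ M₀ : ℕ, ∀ M ≥ M₀, ∀ B, MeasurableSet B → volume {x | (∀ j < M,
      Metric.ball (euler w t₀ τ M j x) ε ⊆ Ω) ∧ euler w t₀ τ M M x ∈ B} ≤ 2 * volume B := by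
  have hT : 0 ≤ T := ht₀.1.trans ht₀.2
  set Λ := ∫ r in (0)..T, l r with hΛ
  have hΛ0 : 0 ≤ Λ := intervalIntegral.integral_nonneg hT fun r _ => h.nonneg r
  -- if the integral of `l` over each step is at most `η`, the squares sum up to at most `η Λ`
  set η := min (1 / 2) (1 / (4 * (Λ + 1))) with hη
  have hη0 : 0 < η := lt_min (by norm_num) (by positivity)
  have hcont : ContinuousOn (fun t => ∫ r in (0)..t, l r) (Icc 0 T) := by
    have := intervalIntegral.continuousOn_primitive_interval' h.integrable_bound left_mem_uIcc
    rwa [uIcc_of_le hT] at this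
  obtain ⟨M₀, hM₀⟩ := exists_eulerTime_osc_le hcont ht₀ hτ hη0
  refine ⟨M₀, fun M hM B hBm => ?_⟩
  set s := eulerTime t₀ τ M with hs
  have hsm : ∀ k, s k ∈ Icc 0 T := fun k => eulerTime_mem ht₀ hτ k
  let κ : ℕ → ℝ := fun k => |∫ r in s k..s (k + 1), l r|
  have hκ0 : ∀ k, 0 ≤ κ k := fun k => abs_nonneg _
  have h0T : (0 : ℝ) ∈ Icc 0 T := left_mem_Icc.2 hT
  have hκη : ∀ k, κ k ≤ η := fun k => by
    have := hM₀ M hM k (s (k + 1)) right_mem_uIcc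
    rw [Real.dist_eq, intervalIntegral.integral_interval_sub_left
      (h.integrable_bound.mono_set (uIcc_subset_time h0T (hsm _)))
      (h.integrable_bound.mono_set (uIcc_subset_time h0T (hsm _)))] at this
    exact this
  have hκ2 : ∀ k, κ k ≤ 1 / 2 := fun k => (hκη k).trans (min_le_left _ _)
  have hsum : ∑ k ∈ Finset.range M, κ k ≤ Λ :=
    sum_abs_integral_eulerTime_le ht₀ hτ h.integrable_bound h.nonneg M
  have hsq : ∑ k ∈ Finset.range M, 2 * κ k ^ 2 ≤ 1 / 2 := by
    calc ∑ k ∈ Finset.range M, 2 * κ k ^ 2 ≤ ∑ k ∈ Finset.range M, 2 * η * κ k := by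
          refine Finset.sum_le_sum fun k _ => ?_
          nlinarith [hκ0 k, hκη k]
      _ = 2 * η * ∑ k ∈ Finset.range M, κ k := by rw [Finset.mul_sum]
      _ ≤ 2 * (1 / (4 * (Λ + 1))) * Λ := by
          gcongr
          exact min_le_right _ _
      _ ≤ 1 / 2 := by
          rw [mul_one_div, div_mul_eq_mul_div, div_le_div_iff₀ (by positivity) (by norm_num)]
          linarith
  have hprod : 1 / 2 ≤ ∏ k ∈ Finset.range M, (1 - 2 * κ k ^ 2) :=
    le_trans (by linarith) (one_sub_sum_le_prod (fun k => 2 * κ k ^ 2) (fun k => by positivity)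
      (fun k => by nlinarith [hκ0 k, hκ2 k]) M)
  have key := volume_iterate_le (Φ := fun k => eulerStep w (s k) (s (k + 1)))
    (fun k => (h.continuous_eulerStep (hsm k) (hsm (k + 1))).measurable)
    (measurableSet_ball_subset Ω ε) (c := fun k => ENNReal.ofReal (1 - 2 * κ k ^ 2))
    (fun k B hB => h.volume_eulerStep_le (hsm k) (hsm (k + 1))
      ((hκ2 k).trans_lt (by norm_num)) hB)
    (Ψ := euler w t₀ τ M) (fun x => rfl) (fun k x => rfl) M B hBm
  rw [← ENNReal.ofReal_prod_of_nonneg (fun k _ => by nlinarith [hκ0 k, hκ2 k])] at key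
  have hhalf : ENNReal.ofReal (1 / 2) = 2⁻¹ := by
    rw [one_div, ENNReal.ofReal_inv_of_pos two_pos, ENNReal.ofReal_ofNat]
  have key2 := (mul_le_mul_right (ENNReal.ofReal_le_ofReal hprod) _).trans key
  rw [hhalf, ← div_eq_mul_inv, ENNReal.div_le_iff two_ne_zero ENNReal.ofNat_ne_top,
    mul_comm (volume B)] at key2
  exact key2

/-- The flow of a divergence free regular field does not compress areas by more than a factor `2`,
as long as the particles stay in `Ω`. -/
theorem IsRegularField.volume_flow_le {T : ℝ} {Ω : Set Plane} (hΩ : IsOpen Ω)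
    {v : ℝ → Plane → Plane} {b : ℝ → ℝ} (hv : IsRegularField T v b) (ha : IsApproximable T Ω v b)
    {X : ℝ → ℝ → Plane → Plane} (hX : IsFlow T v X) {t₀ τ : ℝ} (ht₀ : t₀ ∈ Icc 0 T)
    (hτ : τ ∈ Icc 0 T) (B : Set Plane) :
    volume {x | (∀ r ∈ uIcc t₀ τ, X r t₀ x ∈ Ω) ∧ X τ t₀ x ∈ B} ≤ 2 * volume B := by
  obtain ⟨w, D, l, e, hw, he0, he, hwv⟩ := ha
  -- By outer regularity it is enough to treat an open set.
  suffices H : ∀ U : Set Plane, IsOpen U →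
      volume {x | (∀ r ∈ uIcc t₀ τ, X r t₀ x ∈ Ω) ∧ X τ t₀ x ∈ U} ≤ 2 * volume U by
    refine ENNReal.le_of_forall_pos_le_add fun ε hε hfin => ?_
    have hB : volume B ≠ ⊤ := fun hB => by simp [hB] at hfin
    obtain ⟨U, hBU, hU, hlt⟩ := B.exists_isOpen_le_add volume
      (ε := (ε : ℝ≥0∞) / 2) (by simpa using hε.ne')
    calc volume {x | (∀ r ∈ uIcc t₀ τ, X r t₀ x ∈ Ω) ∧ X τ t₀ x ∈ B}
        ≤ volume {x | (∀ r ∈ uIcc t₀ τ, X r t₀ x ∈ Ω) ∧ X τ t₀ x ∈ U} :=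
          measure_mono fun x hx => ⟨hx.1, hBU hx.2⟩
      _ ≤ 2 * volume U := H U hU
      _ ≤ 2 * (volume B + ε / 2) := by gcongr
      _ = 2 * volume B + ε := by
          rw [mul_add, ENNReal.mul_div_cancel two_ne_zero ENNReal.ofNat_ne_top]
  intro U hU
  choose M₀ hM₀ using fun n => (hw n).volume_euler_le ht₀ hτ
  let M : ℕ → ℕ := fun n => max (max n 1) (M₀ n)
  let A : ℕ → Set Plane := fun n => {x | (∀ j < M n,
    Metric.ball (euler (w n) t₀ τ (M n) j x) (1 / ((n : ℝ) + 1)) ⊆ Ω) ∧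
    euler (w n) t₀ τ (M n) (M n) x ∈ U}
  have hA : ∀ n, volume (A n) ≤ 2 * volume U := fun n =>
    hM₀ n (M n) (le_max_right _ _) U hU.measurableSet
  -- Every point of the set belongs to all but finitely many of the sets `A n`.
  have hsub : {x | (∀ r ∈ uIcc t₀ τ, X r t₀ x ∈ Ω) ∧ X τ t₀ x ∈ U} ⊆ ⋃ m, ⋂ n ≥ m, A n := by
    rintro x ⟨hx1, hx2⟩
    have hT : 0 ≤ T := ht₀.1.trans ht₀.2
    have hγ := hX.isTrajectory ht₀ x
    have hcomp : IsCompact ((fun r => X r t₀ x) '' uIcc t₀ τ) :=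
      isCompact_uIcc.image_of_continuousOn
        ((hγ.continuousOn hT).mono (uIcc_subset_Icc ht₀ hτ))
    obtain ⟨δ₁, hδ₁, hsub₁⟩ := hcomp.exists_thickening_subset_open hΩ
      (by rintro _ ⟨r, hr, rfl⟩; exact hx1 r hr)
    obtain ⟨δ₂, hδ₂, hsub₂⟩ := Metric.isOpen_iff.1 hU _ hx2
    set ε := min (δ₁ / 2) (δ₂ / 2) with hε
    have hε0 : 0 < ε := lt_min (half_pos hδ₁) (half_pos hδ₂)
    obtain ⟨η, hη, M₁, H⟩ := hv.exists_euler_close hγ ht₀ hτ hε0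
    have ev1 : ∀ᶠ n in atTop, e n ≤ η := (he.eventually (gt_mem_nhds hη)).mono fun n hn => hn.le
    have ev2 : ∀ᶠ n : ℕ in atTop, 1 / ((n : ℝ) + 1) < δ₁ / 2 :=
      tendsto_one_div_add_atTop_nhds_zero_nat.eventually (gt_mem_nhds (half_pos hδ₁))
    obtain ⟨m, hm⟩ := eventually_atTop.1 ((ev1.and ev2).and (eventually_ge_atTop M₁))
    refine mem_iUnion.2 ⟨m, mem_iInter₂.2 fun n hn => ?_⟩
    obtain ⟨⟨hn1, hn2⟩, hn3⟩ := hm n hn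
    have hM1 : M₁ ≤ M n := hn3.trans ((le_max_left _ _).trans (le_max_left _ _))
    have hM2 : 1 ≤ M n := (le_max_right n 1).trans (le_max_left _ _)
    have hc := H (M n) hM1 (w n) (e n) (hw n).integrable (he0 n) hn1 (hwv n)
    rw [hX.self ht₀] at hc
    refine ⟨fun j _ z hz => hsub₁ ?_, hsub₂ ?_⟩
    · refine Metric.mem_thickening_iff.2 ⟨_, ⟨eulerTime t₀ τ (M n) j, eulerTime_mem_uIcc j, rfl⟩, ?_⟩
      calc dist z (X (eulerTime t₀ τ (M n) j) t₀ x)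
          ≤ dist z (euler (w n) t₀ τ (M n) j x) +
            dist (euler (w n) t₀ τ (M n) j x) (X (eulerTime t₀ τ (M n) j) t₀ x) :=
              dist_triangle _ _ _
        _ < δ₁ / 2 + δ₁ / 2 := by
            refine add_lt_add_of_lt_of_le ((Metric.mem_ball.1 hz).trans hn2) ?_
            rw [dist_eq_norm]
            exact (hc j).trans (min_le_left _ _)
        _ = δ₁ := add_halves _
    · have h1 := hc (M n)
      rw [eulerTime_last hM2] at h1
      rw [Metric.mem_ball, dist_eq_norm]
      exact (h1.trans (min_le_right _ _)).trans_lt (half_lt_self hδ₂)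
  have hmono : Monotone fun m => ⋂ n ≥ m, A n := fun m m' hm x hx =>
    mem_iInter₂.2 fun n hn => mem_iInter₂.1 hx n (hm.trans hn)
  refine (measure_mono hsub).trans ?_
  rw [hmono.measure_iUnion]
  exact iSup_le fun m => (measure_mono (iInter₂_subset m le_rfl)).trans (hA m)

/-! ### The perturbed velocity is a regular, approximable field -/

/-- The best constant in the uniform bound and in the logarithmic modulus of continuity of a
continuous field. The supremum runs over a countable dense set, so that it is measurable with
respect to parameters. -/
def supMod (f : Plane → Plane) : ℝ≥0∞ :=
  (⨆ n : ℕ, ‖f (TopologicalSpace.denseSeq Plane n)‖ₑ) ⊔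
    ⨆ (N : ℕ) (m : ℕ) (n : ℕ),
      ‖f (TopologicalSpace.denseSeq Plane m) - f (TopologicalSpace.denseSeq Plane n)‖ₑ /
        ENNReal.ofReal (logMod (N + 1) *
          ‖TopologicalSpace.denseSeq Plane m - TopologicalSpace.denseSeq Plane n‖ +
            1 / ((N + 1 : ℕ) : ℝ))

lemma logMod_bound_pos (N : ℕ) (r : ℝ) (hr : 0 ≤ r) : 0 < logMod (N + 1) * r + 1 / ((N + 1 : ℕ) : ℝ) :=
  add_pos_of_nonneg_of_pos (mul_nonneg (logMod_nonneg _) hr) (by positivity)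

lemma measurable_supMod {u : ℝ → Plane → Plane} (hu : Measurable (Function.uncurry u)) :
    Measurable fun t => supMod (u t) := by
  have h : ∀ x, Measurable fun t => u t x := fun x => hu.comp (measurable_id.prodMk measurable_const)
  refine Measurable.sup (Measurable.iSup fun n => (h _).enorm) ?_
  exact Measurable.iSup fun N => Measurable.iSup fun m => Measurable.iSup fun n =>
    ((h _).sub (h _)).enorm.div_const _

lemma enorm_le_supMod {f : Plane → Plane} (hf : Continuous f) (x : Plane) : ‖f x‖ₑ ≤ supMod f := by
  have hc : IsClosed {x | ‖f x‖ₑ ≤ supMod f} := isClosed_le hf.enorm continuous_const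
  have : range (TopologicalSpace.denseSeq Plane) ⊆ {x | ‖f x‖ₑ ≤ supMod f} := by
    rintro _ ⟨n, rfl⟩
    exact le_sup_of_le_left (le_iSup (fun n => ‖f (TopologicalSpace.denseSeq Plane n)‖ₑ) n)
  exact hc.closure_subset_iff.2 this ((TopologicalSpace.denseRange_denseSeq Plane) x)

lemma enorm_sub_le_supMod {f : Plane → Plane} (hf : Continuous f) {N : ℕ} (hN : 1 ≤ N)
    (x y : Plane) :
    ‖f x - f y‖ₑ ≤ supMod f * ENNReal.ofReal (logMod N * ‖x - y‖ + 1 / N) := by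
  obtain ⟨N, rfl⟩ := Nat.exists_eq_add_of_le' hN
  have hc : IsClosed {p : Plane × Plane | ‖f p.1 - f p.2‖ₑ /
      ENNReal.ofReal (logMod (N + 1) * ‖p.1 - p.2‖ + 1 / ((N + 1 : ℕ) : ℝ)) ≤ supMod f} := by
    refine isClosed_le ?_ continuous_const
    refine continuous_iff_continuousAt.2 fun p => ENNReal.Tendsto.div
      (Continuous.tendsto (by fun_prop) p) (Or.inr ?_)
      (Continuous.tendsto (ENNReal.continuous_ofReal.comp (by fun_prop)) p)
      (Or.inl ENNReal.ofReal_ne_top)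
    simpa using logMod_bound_pos N _ (norm_nonneg (p.1 - p.2))
  have hd := (TopologicalSpace.denseRange_denseSeq Plane).prodMap
    (TopologicalSpace.denseRange_denseSeq Plane)
  have : range (Prod.map (TopologicalSpace.denseSeq Plane) (TopologicalSpace.denseSeq Plane)) ⊆
      {p : Plane × Plane | ‖f p.1 - f p.2‖ₑ /
      ENNReal.ofReal (logMod (N + 1) * ‖p.1 - p.2‖ + 1 / ((N + 1 : ℕ) : ℝ)) ≤ supMod f} := by
    rintro _ ⟨⟨m, n⟩, rfl⟩
    change _ ≤ supMod f
    refine le_sup_of_le_right ?_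
    exact le_iSup_of_le N (le_iSup_of_le m (le_iSup_of_le n le_rfl))
  have h := hc.closure_subset_iff.2 this (hd (x, y))
  have hp : ENNReal.ofReal (logMod (N + 1) * ‖x - y‖ + 1 / ((N + 1 : ℕ) : ℝ)) ≠ 0 := by
    simpa using logMod_bound_pos N _ (norm_nonneg (x - y))
  exact (ENNReal.div_le_iff hp ENNReal.ofReal_ne_top).1 h

/-- The constant of the embedding of `H²(ℝ²)`. -/
def sobolevConst : ℝ := 6 * (√discArea + 1)

lemma sobolevConst_pos : 0 < sobolevConst := by unfold sobolevConst; positivity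

lemma supMod_le_h2norm {f : Plane → Plane} (hf : Continuous f) :
    supMod f ≤ ENNReal.ofReal sobolevConst * h2norm univ f := by
  refine sup_le (iSup_le fun n => ?_) (iSup_le fun N => iSup_le fun m => iSup_le fun n => ?_)
  · refine (enorm_le_h2norm hf _).trans ?_
    gcongr
    rw [sobolevConst]
    have := Real.sqrt_nonneg discArea
    linarith
  · set x := TopologicalSpace.denseSeq Plane m
    set y := TopologicalSpace.denseSeq Plane n
    have hp : ENNReal.ofReal (logMod (N + 1) * ‖x - y‖ + 1 / ((N + 1 : ℕ) : ℝ)) ≠ 0 := by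
      simpa using logMod_bound_pos N _ (norm_nonneg (x - y))
    rw [ENNReal.div_le_iff hp ENNReal.ofReal_ne_top]
    refine (enorm_sub_le_h2norm hf x y (N := ((N + 1 : ℕ) : ℝ)) (by simp)).trans ?_
    rw [mul_right_comm (ENNReal.ofReal sobolevConst), ← ENNReal.ofReal_mul sobolevConst_pos.le]
    have := sobolevConst_pos
    refine mul_le_mul_left (ENNReal.ofReal_le_ofReal ?_) _
    refine mul_le_mul_of_nonneg_left ?_ this.le
    gcongr
    exact le_add_of_nonneg_right zero_le_one

section Total

variable {T : ℝ} {Ω : Set Plane} {ybar u : ℝ → Plane → Plane}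

/-- The velocity `ybar + u`, set to zero outside of the time interval. -/
def totalField (T : ℝ) (ybar u : ℝ → Plane → Plane) (t : ℝ) (x : Plane) : Plane :=
  if t ∈ Ioo 0 T then ybar t x + u t x else 0

lemma totalField_of_mem {t : ℝ} (ht : t ∈ Ioo 0 T) (x : Plane) :
    totalField T ybar u t x = ybar t x + u t x := if_pos ht

lemma measurable_totalField
    (hy : ContDiffOn ℝ 2 (Function.uncurry ybar) (Icc 0 T ×ˢ univ))
    (hu : Measurable (Function.uncurry u)) :
    Measurable (Function.uncurry (totalField T ybar u)) := by
  classical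
  have hs : MeasurableSet (Ioo 0 T ×ˢ (univ : Set Plane)) :=
    measurableSet_Ioo.prod MeasurableSet.univ
  have h1 : Measurable ((Ioo 0 T ×ˢ (univ : Set Plane)).piecewise (Function.uncurry ybar) 0) :=
    (hy.continuousOn.mono (prod_mono Ioo_subset_Icc_self le_rfl)).measurable_piecewise
      continuousOn_const hs
  have h2 : Measurable ((Ioo 0 T ×ˢ (univ : Set Plane)).piecewise (Function.uncurry u) 0) :=
    hu.piecewise hs measurable_const
  convert h1.add h2 using 1
  ext1 ⟨t, x⟩
  by_cases ht : t ∈ Ioo 0 T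
  · simp only [Function.uncurry, totalField_of_mem ht, Pi.add_apply]
    rw [piecewise_eq_of_mem _ _ _ (show (t, x) ∈ Ioo 0 T ×ˢ univ from ⟨ht, trivial⟩),
      piecewise_eq_of_mem _ _ _ (show (t, x) ∈ Ioo 0 T ×ˢ univ from ⟨ht, trivial⟩)]
    rfl
  · have hn : (t, x) ∉ Ioo 0 T ×ˢ (univ : Set Plane) := fun h => ht h.1
    simp only [Function.uncurry, totalField, if_neg ht, Pi.add_apply]
    rw [piecewise_eq_of_notMem _ _ _ hn, piecewise_eq_of_notMem _ _ _ hn]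
    simp

/-- The integrable function of time which controls the velocity `ybar + u`. -/
def totalBound (L : ℝ) (u : ℝ → Plane → Plane) (t : ℝ) : ℝ := (supMod (u t)).toReal + L

lemma lintegral_supMod_sq_lt_top (hu : IsContinuousRep T u) (hH : MemL2H2 T univ u) :
    ∫⁻ t in Ioo 0 T, supMod (u t) ^ 2 < ⊤ := by
  have h1 : ∫⁻ t in Ioo 0 T, h2norm univ (u t) ^ 2 < ⊤ := by
    by_contra hne
    have := hH.2
    rw [l2h2norm, not_lt_top_iff.1 hne, ENNReal.top_rpow_of_pos (by norm_num)] at this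
    exact lt_irrefl _ this
  calc ∫⁻ t in Ioo 0 T, supMod (u t) ^ 2
      ≤ ∫⁻ t in Ioo 0 T, ENNReal.ofReal sobolevConst ^ 2 * h2norm univ (u t) ^ 2 := by
        refine lintegral_mono_ae ?_
        filter_upwards [hu.continuous] with t ht
        rw [← mul_pow]
        gcongr
        exact supMod_le_h2norm ht
    _ = ENNReal.ofReal sobolevConst ^ 2 * ∫⁻ t in Ioo 0 T, h2norm univ (u t) ^ 2 :=
        lintegral_const_mul' _ _ (ENNReal.pow_ne_top ENNReal.ofReal_ne_top)
    _ < ⊤ := ENNReal.mul_lt_top (ENNReal.pow_lt_top ENNReal.ofReal_lt_top) h1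

lemma lintegral_supMod_lt_top (hu : IsContinuousRep T u) (hH : MemL2H2 T univ u) :
    ∫⁻ t in Ioo 0 T, supMod (u t) < ⊤ := by
  calc ∫⁻ t in Ioo 0 T, supMod (u t) ≤ ∫⁻ t in Ioo 0 T, (1 + supMod (u t) ^ 2) := by
        refine lintegral_mono fun t => ?_
        rcases le_total (supMod (u t)) 1 with h | h
        · exact h.trans le_self_add
        · refine le_trans ?_ le_add_self
          rw [sq]; exact le_mul_of_one_le_left zero_le h
    _ = (∫⁻ _ in Ioo 0 T, 1) + ∫⁻ t in Ioo 0 T, supMod (u t) ^ 2 :=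
        lintegral_add_left measurable_const _
    _ < ⊤ := ENNReal.add_lt_top.2 ⟨(setLIntegral_one _).trans_lt measure_Ioo_lt_top, lintegral_supMod_sq_lt_top hu hH⟩

lemma ae_supMod_lt_top (hu : IsContinuousRep T u) (hH : MemL2H2 T univ u) :
    ∀ᵐ t ∂(volume.restrict (Ioo 0 T)), supMod (u t) < ⊤ :=
  ae_lt_top (measurable_supMod hu.measurable) (lintegral_supMod_lt_top hu hH).ne

lemma intervalIntegrable_totalBound (hT : 0 ≤ T) (hu : IsContinuousRep T u)
    (hH : MemL2H2 T univ u) (L : ℝ) : IntervalIntegrable (totalBound L u) volume 0 T := by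
  refine IntervalIntegrable.add ?_ intervalIntegrable_const
  rw [intervalIntegrable_iff_integrableOn_Ioo_of_le hT]
  exact integrable_toReal_of_lintegral_ne_top (measurable_supMod hu.measurable).aemeasurable
    (lintegral_supMod_lt_top hu hH).ne

lemma toReal_le_of_enorm_le {x : Plane} {a : ℝ≥0∞} (ha : a < ⊤) (h : ‖x‖ₑ ≤ a) : ‖x‖ ≤ a.toReal := by
  rw [← toReal_enorm]; exact ENNReal.toReal_mono ha.ne h

lemma norm_sub_le_supMod {f : Plane → Plane} (hf : Continuous f) (ha : supMod f < ⊤) {N : ℕ}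
    (hN : 1 ≤ N) (x y : Plane) :
    ‖f x - f y‖ ≤ (supMod f).toReal * (logMod N * ‖x - y‖ + 1 / N) := by
  have h := toReal_le_of_enorm_le (ENNReal.mul_lt_top ha ENNReal.ofReal_lt_top)
    (enorm_sub_le_supMod hf hN x y)
  have hpos := logMod_nonneg N
  rwa [ENNReal.toReal_mul, ENNReal.toReal_ofReal (by positivity)] at h

lemma isRegularField_totalField (hT : 0 ≤ T) {L : ℝ≥0}
    (hL : ∀ t ∈ Icc 0 T, LipschitzWith L (ybar t)) (hu : IsContinuousRep T u)
    (hH : MemL2H2 T univ u) : IsRegularField T (totalField T ybar u) (totalBound L u) where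
  nonneg t := by unfold totalBound; positivity
  integrable := intervalIntegrable_totalBound hT hu hH L
  modulus := by
    filter_upwards [hu.continuous, ae_supMod_lt_top hu hH, ae_restrict_mem measurableSet_Ioo]
      with t hc hfin ht N hN x y
    have ht' := Ioo_subset_Icc_self ht
    rw [totalField_of_mem ht, totalField_of_mem ht]
    have h1 := norm_sub_le_supMod hc hfin hN x y
    have h2 := (hL t ht').norm_sub_le x y
    have h7 := norm_nonneg (x - y)
    have h8 : (0 : ℝ) ≤ L := L.2
    have hc1 : 1 ≤ logMod N := le_add_of_nonneg_left (Real.sqrt_nonneg _)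
    have h9 : (0 : ℝ) ≤ 1 / N := by positivity
    have e : ybar t x + u t x - (ybar t y + u t y) = (ybar t x - ybar t y) + (u t x - u t y) := by
      abel
    rw [e]
    refine (norm_add_le _ _).trans ?_
    have h10 : ‖x - y‖ ≤ logMod N * ‖x - y‖ + 1 / N := by nlinarith
    unfold totalBound
    have h11 := mul_le_mul_of_nonneg_left h10 h8
    nlinarith

end Total

/-! ### Mollification of a field -/

section Mollify

variable {κ : Plane → ℝ} {f : Plane → Plane}

/-- The differential of the convolution `κ * f`. -/
def mollifyDeriv (κ : Plane → ℝ) (f : Plane → Plane) (x : Plane) : Plane →L[ℝ] Plane :=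
  ∫ z, (fderiv ℝ κ (x - z)).smulRight (f z)

lemma IsMollifier.hasFDerivAt_mollify (hκ : IsMollifier κ) (hf : Continuous f) (x : Plane) :
    HasFDerivAt (mollify κ f) (mollifyDeriv κ f x) x := by
  have h := hκ.hasCompactSupport.hasFDerivAt_convolution_left
    (ContinuousLinearMap.lsmul ℝ ℝ : ℝ →L[ℝ] Plane →L[ℝ] Plane) (μ := volume)
    (hκ.contDiff.of_le (by exact_mod_cast le_top)) hf.locallyIntegrable x
  have e1 : convolution κ f (ContinuousLinearMap.lsmul ℝ ℝ) volume = mollify κ f := by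
    ext1 y; rw [convolution_eq_swap]; rfl
  rw [e1, convolution_eq_swap] at h
  refine h.congr_fderiv (integral_congr_ae (Eventually.of_forall fun z => ?_))
  ext1 e
  simp

lemma IsMollifier.integral_sub_left (hκ : IsMollifier κ) (x : Plane) : ∫ z, κ (x - z) = 1 := by
  rw [integral_sub_left_eq_self (fun z => κ z)]; exact hκ.integral_eq

lemma IsMollifier.integrable_sub_left (hκ : IsMollifier κ) (x : Plane) :
    Integrable fun z => κ (x - z) := hκ.integrable.comp_sub_left x

lemma IsMollifier.norm_mollify_le (hκ : IsMollifier κ) {a : ℝ} (ha : ∀ x, ‖f x‖ ≤ a) (x : Plane) :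
    ‖mollify κ f x‖ ≤ a := by
  refine (norm_integral_le_of_norm_le ((hκ.integrable_sub_left x).mul_const a)
    (Eventually.of_forall fun z => ?_)).trans (le_of_eq ?_)
  · rw [norm_smul, Real.norm_eq_abs, abs_of_nonneg (hκ.nonneg _)]
    exact mul_le_mul_of_nonneg_left (ha z) (hκ.nonneg _)
  · rw [integral_mul_const, hκ.integral_sub_left, one_mul]

lemma IsMollifier.norm_mollify_sub_le (hκ : IsMollifier κ) (hf : Continuous f) {r a : ℝ}
    (hr : Function.support κ ⊆ Metric.ball 0 r) {x : Plane}
    (ha : ∀ z, ‖x - z‖ < r → ‖f z - f x‖ ≤ a) :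
    ‖mollify κ f x - f x‖ ≤ a := by
  have hint : Integrable fun z => κ (x - z) • f z := by
    refine Continuous.integrable_of_hasCompactSupport ?_ ?_
    · exact (hκ.contDiff.continuous.comp (continuous_const.sub continuous_id)).smul hf
    · exact (hκ.hasCompactSupport.comp_homeomorph (Homeomorph.subLeft x)).smul_right
  have e : mollify κ f x - f x = ∫ z, κ (x - z) • (f z - f x) := by
    simp_rw [smul_sub]
    rw [integral_sub hint ((hκ.integrable_sub_left x).smul_const _), integral_smul_const,
      hκ.integral_sub_left, one_smul]
    rfl
  rw [e]
  refine (norm_integral_le_of_norm_le ((hκ.integrable_sub_left x).mul_const a)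
    (Eventually.of_forall fun z => ?_)).trans (le_of_eq ?_)
  · rw [norm_smul, Real.norm_eq_abs, abs_of_nonneg (hκ.nonneg _)]
    by_cases hz : κ (x - z) = 0
    · simp [hz]
    · exact mul_le_mul_of_nonneg_left (ha z (by simpa using hr hz)) (hκ.nonneg _)
  · rw [integral_mul_const, hκ.integral_sub_left, one_mul]

lemma IsMollifier.continuous_fderiv (hκ : IsMollifier κ) : Continuous (fderiv ℝ κ) :=
  hκ.contDiff.continuous_fderiv (by simp)

lemma IsMollifier.integrable_fderiv (hκ : IsMollifier κ) : Integrable fun z => ‖fderiv ℝ κ z‖ :=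
  (hκ.continuous_fderiv.integrable_of_hasCompactSupport (hκ.hasCompactSupport.fderiv ℝ)).norm

lemma IsMollifier.norm_mollifyDeriv_le (hκ : IsMollifier κ) {a : ℝ} (ha : ∀ x, ‖f x‖ ≤ a)
    (x : Plane) : ‖mollifyDeriv κ f x‖ ≤ (∫ z, ‖fderiv ℝ κ z‖) * a := by
  refine (norm_integral_le_of_norm_le ((hκ.integrable_fderiv.comp_sub_left x).mul_const a)
    (Eventually.of_forall fun z => ?_)).trans (le_of_eq ?_)
  · rw [ContinuousLinearMap.norm_smulRight_apply]
    exact mul_le_mul_of_nonneg_left (ha z) (norm_nonneg _)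
  · rw [integral_mul_const, integral_sub_left_eq_self (fun z => ‖fderiv ℝ κ z‖)]

lemma linTrace_smulRight (A : Plane →L[ℝ] ℝ) (v : Plane) : linTrace (A.smulRight v) = A v := by
  have hv : v = ∑ i, v i • unitVec i := by
    have := (EuclideanSpace.basisFun (Fin 2) ℝ).sum_repr v
    simpa [unitVec] using this.symm
  conv_rhs => rw [hv]
  simp [linTrace, mul_comm]

/-- The linear form `A ↦ tr A`. -/
def traceCLM : (Plane →L[ℝ] Plane) →L[ℝ] ℝ := ∑ i,
    (EuclideanSpace.proj i).comp (ContinuousLinearMap.apply ℝ Plane (unitVec i))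

lemma linTrace_eq_traceCLM (A : Plane →L[ℝ] Plane) : linTrace A = traceCLM A := by
  simp [traceCLM, linTrace]

/-- Mollification preserves the divergence free condition, away from the boundary. -/
lemma IsMollifier.linTrace_mollifyDeriv (hκ : IsMollifier κ) (hf : Continuous f) {Ω : Set Plane}
    (hdiv : ∀ η : Plane → ℝ, ContDiff ℝ ∞ η → HasCompactSupport η → tsupport η ⊆ Ω →
      ∫ x in Ω, fderiv ℝ η x (f x) = 0) {r r' : ℝ} (hr : Function.support κ ⊆ Metric.ball 0 r)
    (hrr : r < r') {x : Plane} (hx : Metric.ball x r' ⊆ Ω) :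
    linTrace (mollifyDeriv κ f x) = 0 := by
  have hint : Integrable fun z => (fderiv ℝ κ (x - z)).smulRight (f z) := by
    have h1 : Integrable fun z => fderiv ℝ κ (x - z) :=
      (hκ.continuous_fderiv.integrable_of_hasCompactSupport
        (hκ.hasCompactSupport.fderiv ℝ)).comp_sub_left x
    refine Continuous.integrable_of_hasCompactSupport ?_ ?_
    · have hc : Continuous fun z => fderiv ℝ κ (x - z) :=
        hκ.continuous_fderiv.comp (continuous_const.sub continuous_id)
      exact (((ContinuousLinearMap.smulRightL ℝ Plane Plane).continuous.comp hc).clm_apply hf)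
    · refine HasCompactSupport.mono ((hκ.hasCompactSupport.fderiv ℝ).comp_homeomorph
        (Homeomorph.subLeft x)) ?_
      intro z hz hz'
      refine hz ?_
      have : fderiv ℝ κ (x - z) = 0 := hz'
      simp [this]
  set η : Plane → ℝ := fun z => κ (x - z) with hη
  have hηd : ∀ z, fderiv ℝ η z = -fderiv ℝ κ (x - z) := fun z => by
    have h1 : HasFDerivAt κ (fderiv ℝ κ (x - z)) (x - z) :=
      ((hκ.contDiff.differentiable (by simp)) _).hasFDerivAt
    have h2 := h1.comp z ((hasFDerivAt_id z).const_sub x)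
    have h3 : HasFDerivAt η _ z := h2
    rw [h3.fderiv]
    ext e
    simp
  have hts : tsupport η ⊆ Ω := by
    refine subset_trans ?_ hx
    have h1 : tsupport η ⊆ Metric.closedBall x r := by
      refine closure_minimal ?_ Metric.isClosed_closedBall
      intro z hz
      have h2 := hr (show x - z ∈ Function.support κ from hz)
      rw [mem_ball_zero_iff] at h2
      rw [Metric.mem_closedBall, dist_comm, dist_eq_norm]
      exact h2.le
    exact h1.trans (Metric.closedBall_subset_ball hrr)
  have h0 := hdiv η (hκ.contDiff.comp (contDiff_const.sub contDiff_id))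
    (hκ.hasCompactSupport.comp_homeomorph (Homeomorph.subLeft x)) hts
  rw [setIntegral_eq_integral_of_forall_compl_eq_zero] at h0
  · rw [linTrace_eq_traceCLM, mollifyDeriv, ← ContinuousLinearMap.integral_comp_comm _ hint]
    simp_rw [← linTrace_eq_traceCLM, linTrace_smulRight]
    simp_rw [hηd, neg_apply] at h0
    rwa [integral_neg, neg_eq_zero] at h0
  · intro z hz
    have : fderiv ℝ η z = 0 := by
      by_contra hne
      exact hz (hts (support_fderiv_subset ℝ hne))
    simp [this]

end Mollify

/-! ### Mollified velocities -/

section Approximation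

variable {T : ℝ} {Ω : Set Plane} {ybar u : ℝ → Plane → Plane} {κ : Plane → ℝ}

lemma contDiffAt_uncurry {F : Type*} [NormedAddCommGroup F] [NormedSpace ℝ F] {g : ℝ → Plane → F}
    {S : Set Plane} {n : WithTop ℕ∞} (hg : ContDiffOn ℝ n (Function.uncurry g) (Icc 0 T ×ˢ S))
    {t : ℝ} (ht : t ∈ Ioo 0 T) {x : Plane} (hx : x ∈ interior S) :
    ContDiffAt ℝ n (Function.uncurry g) (t, x) :=
  hg.contDiffAt (prod_mem_nhds (Icc_mem_nhds ht.1 ht.2) (mem_interior_iff_mem_nhds.1 hx))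

lemma hasFDerivAt_slice {F : Type*} [NormedAddCommGroup F] [NormedSpace ℝ F] {g : ℝ → Plane → F}
    {S : Set Plane} (hg : ContDiffOn ℝ 2 (Function.uncurry g) (Icc 0 T ×ˢ S))
    {t : ℝ} (ht : t ∈ Ioo 0 T) {x : Plane} (hx : x ∈ interior S) :
    HasFDerivAt (g t) ((fderiv ℝ (Function.uncurry g) (t, x)).comp
      (ContinuousLinearMap.inr ℝ ℝ Plane)) x :=
  ((contDiffAt_uncurry hg ht hx).differentiableAt (by simp)).hasFDerivAt.comp x
    (hasFDerivAt_prodMk_right t x)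

lemma measurable_mollify (hκ : IsMollifier κ) (hu : Measurable (Function.uncurry u)) :
    Measurable (Function.uncurry fun t => mollify κ (u t)) := by
  have h : StronglyMeasurable (Function.uncurry fun (p : ℝ × Plane) (z : Plane) =>
      κ (p.2 - z) • u p.1 z) := by
    refine Measurable.stronglyMeasurable ?_
    refine (hκ.contDiff.continuous.measurable.comp
      (measurable_fst.snd.sub measurable_snd)).smul
      (hu.comp (measurable_fst.fst.prodMk measurable_snd))
  exact h.integral_prod_right.measurable

lemma stronglyMeasurable_mollifyDeriv (hκ : IsMollifier κ) (hu : Measurable (Function.uncurry u))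
    (x : Plane) : StronglyMeasurable fun t => mollifyDeriv κ (u t) x := by
  have h : StronglyMeasurable (Function.uncurry fun (t : ℝ) (z : Plane) =>
      (fderiv ℝ κ (x - z)).smulRight (u t z)) := by
    have h1 : StronglyMeasurable fun p : ℝ × Plane => fderiv ℝ κ (x - p.2) :=
      (hκ.continuous_fderiv.comp (continuous_const.sub continuous_snd)).stronglyMeasurable
    exact (ContinuousLinearMap.smulRightL ℝ Plane Plane).continuous₂.comp_stronglyMeasurable
      (h1.prodMk hu.stronglyMeasurable)
  exact h.integral_prod_right

lemma totalField_eq {t : ℝ} (ht : t ∈ Ioo 0 T) :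
    totalField T ybar u t = fun x => ybar t x + u t x := funext (totalField_of_mem ht)

/-- The convolution of `u` with `κ` is divergence free where the support of `κ (x - ·)` is contained in
`Ω`, whence the two radii `r < r'`. -/
lemma isSmoothField_mollify (hT : 0 ≤ T) (hy : IsTargetVelocity T Ω ybar)
    {L : ℝ≥0} (hL : ∀ t ∈ Icc 0 T, LipschitzWith L (ybar t)) {B₀ : ℝ}
    (hB₀ : ∀ t ∈ Icc 0 T, ‖ybar t 0‖ ≤ B₀) (hu : IsContinuousRep T u) (hH : MemL2H2 T univ u)
    (hdiv : IsWeaklyDivFree T Ω u) (hκ : IsMollifier κ) {r r' : ℝ} (hr : 0 < r') (hrr : r < r')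
    (hsupp : Function.support κ ⊆ Metric.ball 0 r) :
    IsSmoothField T Ω r' (totalField T ybar fun t => mollify κ (u t))
      (fun t x => fderiv ℝ (ybar t) x + mollifyDeriv κ (u t) x)
      (fun t => L + (∫ z, ‖fderiv ℝ κ z‖) * (supMod (u t)).toReal) := by
  have hmeas := measurable_totalField hy.contDiffOn (measurable_mollify hκ hu.measurable)
  have hsup : IntervalIntegrable (fun t => (supMod (u t)).toReal) volume 0 T := by
    have h := intervalIntegrable_totalBound hT hu hH 0
    unfold totalBound at h
    simpa only [add_zero] using h
  have hbd : ∀ᵐ t ∂(volume.restrict (Ioo 0 T)), ∀ x, ‖u t x‖ ≤ (supMod (u t)).toReal := by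
    filter_upwards [hu.continuous, ae_supMod_lt_top hu hH] with t hc hfin x
    exact toReal_le_of_enorm_le hfin (enorm_le_supMod hc x)
  have hslice := fun {t} (ht : t ∈ Ioo 0 T) x => hasFDerivAt_slice hy.contDiffOn ht
    (x := x) (by simp)
  refine ⟨hmeas, fun x => ?_, fun x => ?_, fun t => ?_, ?_, ?_, ?_, ?_⟩
  · rw [intervalIntegrable_iff_integrableOn_Ioo_of_le hT]
    have h1 : IntegrableOn (fun t => (supMod (u t)).toReal + (B₀ + L * ‖x‖)) (Ioo 0 T) :=
      (intervalIntegrable_iff_integrableOn_Ioo_of_le hT).1 (hsup.add intervalIntegrable_const)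
    refine h1.mono' (hmeas.comp (measurable_id.prodMk measurable_const)).aestronglyMeasurable ?_
    filter_upwards [hbd, ae_restrict_mem measurableSet_Ioo] with t hb ht
    rw [totalField_of_mem ht]
    have h3 := (hL t (Ioo_subset_Icc_self ht)).norm_sub_le x 0
    rw [sub_zero] at h3
    have h4 := norm_add_le (ybar t x - ybar t 0) (ybar t 0)
    rw [sub_add_cancel] at h4
    linarith [hB₀ t (Ioo_subset_Icc_self ht), hκ.norm_mollify_le hb x,
      norm_add_le (ybar t x) (mollify κ (u t) x)]
  · refine AEStronglyMeasurable.add ?_ (stronglyMeasurable_mollifyDeriv hκ hu.measurable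
      x).aestronglyMeasurable
    refine ContinuousOn.aestronglyMeasurable ?_ measurableSet_Ioo
    have h1 : ContinuousOn (fun t => (fderiv ℝ (Function.uncurry ybar) (t, x)).comp
        (ContinuousLinearMap.inr ℝ ℝ Plane)) (Ioo 0 T) := by
      intro t ht
      have h2 : ContinuousAt (fderiv ℝ (Function.uncurry ybar)) (t, x) :=
        ((contDiffAt_uncurry hy.contDiffOn ht (by simp)).fderiv_right (m := 1)
          (by norm_num)).continuousAt
      have h3 : ContinuousAt (fun t => fderiv ℝ (Function.uncurry ybar) (t, x)) t :=
        ContinuousAt.comp (f := fun t : ℝ => (t, x)) h2 (by fun_prop)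
      exact (h3.clm_comp continuousAt_const).continuousWithinAt
    exact h1.congr fun t ht => (hslice ht x).fderiv
  · positivity
  · exact intervalIntegrable_const.add (hsup.const_mul _)
  · filter_upwards [hu.continuous, ae_restrict_mem measurableSet_Ioo] with t hc ht x
    rw [totalField_eq ht]
    exact (hslice ht x).differentiableAt.hasFDerivAt.add (hκ.hasFDerivAt_mollify hc x)
  · filter_upwards [hbd, ae_restrict_mem measurableSet_Ioo] with t hb ht x
    exact (norm_add_le _ _).trans (add_le_add
      (norm_fderiv_le_of_lipschitz ℝ (hL t (Ioo_subset_Icc_self ht)))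
      (hκ.norm_mollifyDeriv_le hb x))
  · filter_upwards [hu.continuous, hdiv, ae_restrict_mem measurableSet_Ioo] with t hc hd ht x hx
    have h1 : linTrace (mollifyDeriv κ (u t) x) = 0 := hκ.linTrace_mollifyDeriv hc hd hsupp hrr hx
    have h2 : linTrace (fderiv ℝ (ybar t) x) = 0 :=
      hy.divFree t ht x (hx (Metric.mem_ball_self hr))
    rw [linTrace_eq_traceCLM] at h1 h2 ⊢
    rw [map_add, h1, h2, add_zero]

/-- The velocity `ybar + u` is a limit of fields which are smooth in space and divergence free away
from the boundary. -/
theorem isApproximable_totalField (hT : 0 ≤ T) (hy : IsTargetVelocity T Ω ybar)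
    {L : ℝ≥0} (hL : ∀ t ∈ Icc 0 T, LipschitzWith L (ybar t)) {B₀ : ℝ}
    (hB₀ : ∀ t ∈ Icc 0 T, ‖ybar t 0‖ ≤ B₀) (hu : IsContinuousRep T u) (hH : MemL2H2 T univ u)
    (hdiv : IsWeaklyDivFree T Ω u) :
    IsApproximable T Ω (totalField T ybar u) (totalBound L u) := by
  obtain ⟨κ, hκ, hsupp, -⟩ := exists_mollifier_seq
  refine ⟨fun n => totalField T ybar fun t => mollify (κ (n + 1)) (u t),
    fun n t x => fderiv ℝ (ybar t) x + mollifyDeriv (κ (n + 1)) (u t) x,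
    fun n t => L + (∫ z, ‖fderiv ℝ (κ (n + 1)) z‖) * (supMod (u t)).toReal,
    -- a bound of `(logMod (n + 1) + 1) / (n + 1)`, in a form whose limit is known
    fun n => Real.exp (logMod (n + 1) * 1) / ((n + 1 : ℕ) : ℝ), fun n => ?_,
    fun n => by positivity, (tendsto_add_atTop_iff_nat 1).2 (tendsto_exp_logMod_div 1), fun n => ?_⟩
  · refine isSmoothField_mollify hT hy hL hB₀ hu hH hdiv (hκ (n + 1)) (by positivity) ?_
      (hsupp (n + 1))
    push_cast
    gcongr
    linarith
  · filter_upwards [hu.continuous, ae_supMod_lt_top hu hH, ae_restrict_mem measurableSet_Ioo]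
      with t hc hfin ht x
    rw [totalField_of_mem ht, totalField_of_mem ht, add_sub_add_left_eq_sub]
    have hl := logMod_nonneg (n + 1)
    have hb : (supMod (u t)).toReal ≤ totalBound L u t := by
      have : (0 : ℝ) ≤ L := L.2
      unfold totalBound; linarith
    refine (hκ (n + 1)).norm_mollify_sub_le hc (hsupp (n + 1)) fun z hz => ?_
    rw [norm_sub_rev] at hz
    have hz' : ‖z - x‖ ≤ 1 / ((n + 1 : ℕ) : ℝ) := by
      refine hz.le.trans ?_
      gcongr
      push_cast
      linarith
    refine (norm_sub_le_supMod hc hfin (Nat.le_add_left 1 n) z x).trans ?_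
    refine mul_le_mul hb ?_ (by positivity) (ENNReal.toReal_nonneg.trans hb)
    calc logMod (n + 1) * ‖z - x‖ + 1 / ((n + 1 : ℕ) : ℝ)
        ≤ logMod (n + 1) * (1 / ((n + 1 : ℕ) : ℝ)) + 1 / ((n + 1 : ℕ) : ℝ) := by gcongr
      _ = (logMod (n + 1) * 1 + 1) / ((n + 1 : ℕ) : ℝ) := by ring
      _ ≤ _ := by gcongr; exact Real.add_one_le_exp _

end Approximation

/-! ### Existence of exit constants -/

/-- A continuous field is bounded everywhere in an open set by its essential supremum. -/
lemma enorm_le_eLpNorm_top {f : Plane → Plane} (hf : Continuous f) {U : Set Plane} (hU : IsOpen U)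
    {x : Plane} (hx : x ∈ U) : ‖f x‖ₑ ≤ eLpNorm f ⊤ (volume.restrict U) := by
  by_contra! hlt
  rw [eLpNorm_exponent_top] at hlt
  have h1 : ∀ᵐ y, y ∈ U → ‖f y‖ₑ ≤ eLpNormEssSup f (volume.restrict U) :=
    (ae_restrict_iff' hU.measurableSet).1 (ae_le_eLpNormEssSup (f := f))
  have h2 : IsOpen (U ∩ {y | eLpNormEssSup f (volume.restrict U) < ‖f y‖ₑ}) :=
    hU.inter (isOpen_lt continuous_const hf.enorm)
  refine (h2.measure_pos volume ⟨x, hx, hlt⟩).ne' ?_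
  refine measure_mono_null ?_ h1
  rintro y ⟨hy1, hy2⟩ h
  exact not_le.2 hy2 (h hy1)

/-- Cauchy–Schwarz in time. The larger function need not be measurable. -/
lemma lintegral_le_sqrt_mul {T : ℝ} (hT : 0 ≤ T) {f F : ℝ → ℝ≥0∞}
    (hf : AEMeasurable f (volume.restrict (Ioo 0 T)))
    (h : ∀ᵐ t ∂(volume.restrict (Ioo 0 T)), f t ≤ F t) :
    ∫⁻ t in Ioo 0 T, f t ≤ ENNReal.ofReal √T * (∫⁻ t in Ioo 0 T, F t ^ 2) ^ (1 / 2 : ℝ) := by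
  have h1 := ENNReal.lintegral_mul_le_Lp_mul_Lq (volume.restrict (Ioo 0 T))
    Real.HolderConjugate.two_two (f := fun _ => (1 : ℝ≥0∞)) aemeasurable_const hf
  simp only [Pi.mul_apply, one_mul, one_pow, lintegral_const, Measure.restrict_apply_univ,
    Real.volume_Ioo, sub_zero, ENNReal.rpow_two] at h1
  refine h1.trans ?_
  rw [ENNReal.ofReal_rpow_of_nonneg hT (by norm_num), ← Real.sqrt_eq_rpow]
  gcongr ENNReal.ofReal √T * ?_ ^ (1 / 2 : ℝ)
  refine lintegral_mono_ae (h.mono fun t ht => ?_)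
  gcongr

lemma ofReal_integral_norm_le_lintegral {T : ℝ} (hT : 0 ≤ T) {g : ℝ → Plane}
    (hg : IntervalIntegrable g volume 0 T) :
    ENNReal.ofReal (∫ r in (0)..T, ‖g r‖) = ∫⁻ r in Ioo 0 T, ‖g r‖ₑ := by
  rw [intervalIntegral.integral_of_le hT, integral_Ioc_eq_integral_Ioo]
  exact ofReal_integral_norm_eq_lintegral_enorm
    ((intervalIntegrable_iff_integrableOn_Ioo_of_le hT).1 hg)

section Lipschitz

variable {T : ℝ} {ybar : ℝ → Plane → Plane} {L : ℝ≥0}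

lemma IsTrajectory.integrable_add_force
    (hc : ContinuousOn (Function.uncurry ybar) (Icc 0 T ×ˢ univ)) {g : ℝ → Plane} {γ : ℝ → Plane}
    (h : IsTrajectory T (fun t x => ybar t x + g t) γ) (hT : 0 ≤ T) :
    IntervalIntegrable (fun r => ybar r (γ r)) volume 0 T ∧ IntervalIntegrable g volume 0 T := by
  have h1 : ContinuousOn (fun r => ybar r (γ r)) (Icc 0 T) := by
    have := hc.comp (continuousOn_id.prodMk (h.continuousOn hT)) fun r hr => ⟨hr, trivial⟩
    exact this
  rw [← uIcc_of_le hT] at h1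
  have h2 := h1.intervalIntegrable (μ := volume)
  refine ⟨h2, ?_⟩
  simpa using h.integrable.sub h2

/-- Grönwall's estimate: effect of a forcing `g` on a trajectory of a Lipschitz field. -/
lemma dist_le_of_force (hc : ContinuousOn (Function.uncurry ybar) (Icc 0 T ×ˢ univ))
    (hL : ∀ t ∈ Icc 0 T, LipschitzWith L (ybar t)) {g γ₁ γ₂ : ℝ → Plane}
    (h₁ : IsTrajectory T ybar γ₁) (h₂ : IsTrajectory T (fun t x => ybar t x + g t) γ₂)
    {s : ℝ} (hs : s ∈ Icc 0 T) {t : ℝ} (ht : t ∈ Icc 0 T) :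
    ‖γ₂ t - γ₁ t‖ ≤ (‖γ₂ s - γ₁ s‖ + ∫ r in (0)..T, ‖g r‖) * Real.exp (L * T) := by
  have hT : 0 ≤ T := ht.1.trans ht.2
  obtain ⟨i2, ig⟩ := h₂.integrable_add_force hc hT
  have hcont : ContinuousOn (fun t => ‖γ₂ t - γ₁ t‖) (Icc 0 T) :=
    ((h₂.continuousOn hT).sub (h₁.continuousOn hT)).norm
  have hgi : 0 ≤ ∫ r in (0)..T, ‖g r‖ := intervalIntegral.integral_nonneg hT fun r _ => norm_nonneg _
  have key := gronwall_integral_two_sided (f := fun t => ‖γ₂ t - γ₁ t‖) (k := fun _ => (L : ℝ))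
    (δ := ‖γ₂ s - γ₁ s‖ + ∫ r in (0)..T, ‖g r‖) hs hcont intervalIntegrable_const
    (fun _ => L.2) (by positivity) ?_ (fun t => norm_nonneg _) t ht
  · simpa [mul_comm T] using key
  intro q hq
  have hsub := uIcc_subset_time hs hq
  have j1 := h₁.integrable.mono_set hsub
  have j2 := h₂.integrable.mono_set hsub
  have jg := (ig.mono_set hsub).norm
  have e : γ₂ q - γ₁ q = (γ₂ s - γ₁ s) +
      ∫ r in s..q, (ybar r (γ₂ r) + g r - ybar r (γ₁ r)) := by
    rw [intervalIntegral.integral_sub j2 j1, h₂.eqn s hs q hq, h₁.eqn s hs q hq]; abel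
  have jk : IntervalIntegrable (fun r => (L : ℝ) * ‖γ₂ r - γ₁ r‖) volume s q :=
    ContinuousOn.intervalIntegrable
      (continuousOn_const.mul (hcont.mono (by rwa [uIcc_of_le hT] at hsub)))
  have h3 : ‖∫ r in s..q, (ybar r (γ₂ r) + g r - ybar r (γ₁ r))‖ ≤
      |∫ r in s..q, (‖g r‖ + L * ‖γ₂ r - γ₁ r‖)| := by
    refine intervalIntegral.norm_integral_le_abs_of_norm_le ?_ (jg.add jk)
    rw [ae_restrict_iff' measurableSet_uIoc]
    refine Eventually.of_forall fun r hr => ?_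
    have hr' : r ∈ Icc 0 T := Ioc_subset_Icc_self (uIoc_subset_Ioc_time hs hq hr)
    have := (hL r hr').norm_sub_le (γ₂ r) (γ₁ r)
    calc ‖ybar r (γ₂ r) + g r - ybar r (γ₁ r)‖ = ‖g r + (ybar r (γ₂ r) - ybar r (γ₁ r))‖ := by
          congr 1; abel
      _ ≤ _ := (norm_add_le _ _).trans (by gcongr)
  have h4 : |∫ r in s..q, ‖g r‖| ≤ ∫ r in (0)..T, ‖g r‖ := by
    refine (intervalIntegral.abs_integral_mono_interval (c := 0) (d := T) ?_ ?_
      ig.norm).trans (le_of_eq (abs_of_nonneg hgi))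
    · rw [uIoc_of_le hT]; exact uIoc_subset_Ioc_time hs hq
    · exact Eventually.of_forall fun _ => norm_nonneg _
  rw [intervalIntegral.integral_add jg jk] at h3
  rw [e]
  refine (norm_add_le _ _).trans ?_
  rw [add_assoc]
  refine add_le_add_right (h3.trans ((abs_add_le _ _).trans ?_)) _
  exact add_le_add_left h4 _

lemma IsTrajectory.add_zero_force {γ : ℝ → Plane} (h : IsTrajectory T ybar γ) :
    IsTrajectory T (fun t x => ybar t x + (fun _ => (0 : Plane)) t) γ := by
  simpa only [add_zero] using h

/-- Displacement of a particle during a short time. -/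
lemma dist_start_le (hc : ContinuousOn (Function.uncurry ybar) (Icc 0 T ×ˢ univ))
    (hL : ∀ t ∈ Icc 0 T, LipschitzWith L (ybar t)) {M : ℝ} {x : Plane}
    (hM : ∀ t ∈ Icc 0 T, ‖ybar t x‖ ≤ M) {γ : ℝ → Plane} (h : IsTrajectory T ybar γ)
    (h0 : γ 0 = x) {τ : ℝ} (hτ : τ ∈ Icc 0 T) :
    ‖x - γ τ‖ ≤ τ * M * Real.exp (L * T) := by
  have hsub : Icc 0 τ ⊆ Icc 0 T := Icc_subset_Icc le_rfl hτ.2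
  have hγ : IsTrajectory τ ybar γ := by
    refine ⟨h.integrable.mono_set ?_, fun s hs t ht => h.eqn s (hsub hs) t (hsub ht)⟩
    exact uIcc_subset_time (left_mem_Icc.2 (hτ.1.trans hτ.2)) hτ
  have hx : IsTrajectory τ (fun t z => ybar t z + (fun t => -ybar t x) t) (fun _ => x) := by
    constructor <;> simp
  have key := dist_le_of_force (hc.mono (prod_mono hsub le_rfl)) (fun t ht => hL t (hsub ht)) hγ hx
    (left_mem_Icc.2 hτ.1) (right_mem_Icc.2 hτ.1)
  simp only [h0, sub_self, norm_zero, zero_add, norm_neg] at key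
  have hM0 : 0 ≤ M := (norm_nonneg _).trans (hM τ hτ)
  have h1 : ∫ r in (0)..τ, ‖ybar r x‖ ≤ τ * M := by
    have h2 : ContinuousOn (fun r => ‖ybar r x‖) (uIcc 0 τ) := by
      rw [uIcc_of_le hτ.1]
      refine (hc.comp (f := fun r => (r, x)) (by fun_prop) fun r hr => ⟨hsub hr, trivial⟩).norm
    have h3 := intervalIntegral.integral_mono_on hτ.1 h2.intervalIntegrable
      (intervalIntegrable_const (c := M) (μ := volume)) fun r hr => hM r (hsub hr)
    simpa using h3
  refine key.trans ?_
  gcongr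
  · exact mul_nonneg hτ.1 hM0
  · exact hτ.2

/-- Deviation due to a perturbation `w` of the velocity, in terms of its `L²(0,T; L^∞)` norm. -/
lemma integral_norm_perturbation_le (hc : ContinuousOn (Function.uncurry ybar) (Icc 0 T ×ˢ univ))
    {w : ℝ → Plane → Plane} (hw : IsContinuousRep T w) {a : ℝ} (ha : 0 ≤ a)
    (hwa : l2linfnorm T univ w ≤ ENNReal.ofReal a) {γ : ℝ → Plane} (hT : 0 ≤ T)
    (h : IsTrajectory T (fun t x => ybar t x + w t x) γ) :
    ∫ r in (0)..T, ‖w r (γ r)‖ ≤ √T * a := by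
  have ig := (IsTrajectory.integrable_add_force hc (g := fun r => w r (γ r))
    (γ := γ) ⟨h.integrable, h.eqn⟩ hT).2
  have ig' := (intervalIntegrable_iff_integrableOn_Ioo_of_le hT).1 ig
  have h1 : ∀ᵐ r ∂(volume.restrict (Ioo 0 T)),
      ‖w r (γ r)‖ₑ ≤ eLpNorm (w r) ⊤ (volume.restrict univ) := by
    filter_upwards [hw.continuous] with r hr
    exact enorm_le_eLpNorm_top hr isOpen_univ (mem_univ _)
  have h2 := (lintegral_le_sqrt_mul hT ig'.aestronglyMeasurable.enorm h1).trans
    (mul_le_mul_right hwa _)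
  rw [← ofReal_integral_norm_le_lintegral hT ig, ← ENNReal.ofReal_mul (Real.sqrt_nonneg T)] at h2
  exact (ENNReal.ofReal_le_ofReal_iff (by positivity)).1 h2

end Lipschitz

lemma infDist_sub_le {Ω : Set Plane} (x y : Plane) :
    Metric.infDist x Ω - ‖y - x‖ ≤ Metric.infDist y Ω := by
  have := Metric.infDist_le_infDist_add_dist (s := Ω) (x := x) (y := y)
  rw [dist_comm, dist_eq_norm] at this
  linarith

/-- By compactness, the particles of `closure Ω` exit in a uniform way. -/
lemma exists_uniform_exit {T : ℝ} {Ω : Set Plane} {ybar : ℝ → Plane → Plane}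
    {Xbar : ℝ → ℝ → Plane → Plane} (hT : 0 < T) (hne : Ω.Nonempty) (hb : Bornology.IsBounded Ω)
    (hc : ContinuousOn (Function.uncurry ybar) (Icc 0 T ×ˢ univ)) {L : ℝ≥0}
    (hL : ∀ t ∈ Icc 0 T, LipschitzWith L (ybar t)) (hX : IsFlow T ybar Xbar)
    (hexit : AllParticlesExit T Ω Xbar) :
    ∃ d > 0, ∃ a > 0, ∃ b < T, ∀ x ∈ closure Ω, ∃ t ∈ Icc a b, d ≤ Metric.infDist (Xbar t 0 x) Ω := by
  have h0 : (0 : ℝ) ∈ Icc 0 T := left_mem_Icc.2 hT.le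
  refine hb.isCompact_closure.induction_on (p := fun S => ∃ d > 0, ∃ a > 0, ∃ b < T, ∀ x ∈ S,
    ∃ t ∈ Icc a b, d ≤ Metric.infDist (Xbar t 0 x) Ω) ?_ ?_ ?_ ?_
  · exact ⟨1, one_pos, 1, one_pos, 0, hT, by simp⟩
  · rintro S S' hS ⟨d, hd, a, ha, b, hb, h⟩
    exact ⟨d, hd, a, ha, b, hb, fun x hx => h x (hS hx)⟩
  · rintro S S' ⟨d, hd, a, ha, b, hb, h⟩ ⟨d', hd', a', ha', b', hb', h'⟩
    refine ⟨min d d', lt_min hd hd', min a a', lt_min ha ha', max b b', max_lt hb hb', ?_⟩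
    rintro x (hx | hx)
    · obtain ⟨t, ht, h2⟩ := h x hx
      exact ⟨t, ⟨(min_le_left _ _).trans ht.1, ht.2.trans (le_max_left _ _)⟩,
        (min_le_left _ _).trans h2⟩
    · obtain ⟨t, ht, h2⟩ := h' x hx
      exact ⟨t, ⟨(min_le_right _ _).trans ht.1, ht.2.trans (le_max_right _ _)⟩,
        (min_le_right _ _).trans h2⟩
  · intro x hx
    obtain ⟨t, ht, hout⟩ := hexit x hx
    set d := Metric.infDist (Xbar t 0 x) Ω with hd
    have hdpos : 0 < d := by
      rw [hd, ← Metric.infDist_closure]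
      exact (isClosed_closure.notMem_iff_infDist_pos hne.closure).1 hout
    refine ⟨Metric.ball x (d / 2 / Real.exp (L * T)), mem_nhdsWithin_of_mem_nhds
      (Metric.ball_mem_nhds x (by positivity)), d / 2, half_pos hdpos, t, ht.1, t, ht.2,
      fun x' hx' => ⟨t, ⟨le_rfl, le_rfl⟩, ?_⟩⟩
    have h1 := dist_le_of_force hc hL (hX.isTrajectory h0 x) (hX.isTrajectory h0 x').add_zero_force
      h0 (Ioo_subset_Icc_self ht)
    simp only [hX.self h0, norm_zero, intervalIntegral.integral_zero, add_zero] at h1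
    rw [Metric.mem_ball, dist_eq_norm, lt_div_iff₀ (Real.exp_pos _)] at hx'
    have h2 := infDist_sub_le (Ω := Ω) (Xbar t 0 x) (Xbar t 0 x')
    linarith

/-- Exit constants exist: the exit at a positive distance is stable under a small change of the initial
time and a small perturbation of the velocity. -/
theorem exists_isExitData {T : ℝ} {Ω : Set Plane} {ybar : ℝ → Plane → Plane}
    {Xbar : ℝ → ℝ → Plane → Plane} (hT : 0 < T) (hne : Ω.Nonempty) (hb : Bornology.IsBounded Ω)
    (hy : IsTargetVelocity T Ω ybar) (hX : IsFlow T ybar Xbar)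
    (hexit : AllParticlesExit T Ω Xbar) :
    ∃ T0s T1s sig : ℝ, IsExitData T Ω ybar Xbar T0s T1s sig := by
  obtain ⟨L, hL⟩ := hy.lipschitz
  have hc := hy.contDiffOn.continuousOn
  obtain ⟨d, hd, a, ha, b, hbT, h⟩ := exists_uniform_exit hT hne hb hc hL hX hexit
  obtain ⟨M, hM⟩ : ∃ M, ∀ t ∈ Icc 0 T, ∀ x ∈ closure Ω, ‖ybar t x‖ ≤ M := by
    obtain ⟨M, hM⟩ := (isCompact_Icc.prod hb.isCompact_closure).exists_bound_of_continuousOn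
      (hc.mono (prod_mono le_rfl (subset_univ _)))
    exact ⟨M, fun t ht x hx => hM (t, x) ⟨ht, hx⟩⟩
  set E := Real.exp (L * T)
  have hE : 0 < E := Real.exp_pos _
  have hM1 : 0 < |M| + 1 := by positivity
  have h0 : (0 : ℝ) ∈ Icc 0 T := left_mem_Icc.2 hT.le
  have hmem : ∀ {T0}, T0 ∈ Ioo 0 (min (min a T) (d / 2 / ((|M| + 1) * E * E))) → T0 ∈ Icc 0 T :=
    fun h => ⟨h.1.le, h.2.le.trans ((min_le_left _ _).trans (min_le_right _ _))⟩
  -- a particle of `closure Ω` at time `T0` has left `Ω`, with some margin, by the time `b`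
  have key : ∀ T0 ∈ Ioo 0 (min (min a T) (d / 2 / ((|M| + 1) * E * E))), ∀ T1 ∈ Ioo 0 ((T - b) / 2),
      ∀ x ∈ closure Ω, ∃ t ∈ Icc T0 (T - 2 * T1), t ∈ Icc 0 T ∧
        d / 2 ≤ Metric.infDist (Xbar t T0 x) Ω := by
    intro T0 hT0 T1 hT1 x hx
    obtain ⟨t, ht, h1⟩ := h x hx
    have ht0 : t ∈ Icc 0 T := ⟨ha.le.trans ht.1, ht.2.trans hbT.le⟩
    refine ⟨t, ⟨hT0.2.le.trans (((min_le_left _ _).trans (min_le_left _ _)).trans ht.1), ?_⟩,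
      ht0, ?_⟩
    · linarith [hT1.2, ht.2]
    have h2 := dist_start_le hc hL (fun t ht => (hM t ht x hx).trans
      ((le_abs_self M).trans (le_add_of_nonneg_right zero_le_one)))
      (hX.isTrajectory h0 x) (hX.self h0 x) (hmem hT0)
    have h3 := dist_le_of_force hc hL (hX.isTrajectory h0 x)
      (hX.isTrajectory (hmem hT0) x).add_zero_force (hmem hT0) ht0
    simp only [hX.self (hmem hT0), norm_zero, intervalIntegral.integral_zero, add_zero] at h3
    have h4 : T0 * ((|M| + 1) * E * E) ≤ d / 2 :=
      (le_div_iff₀ (by positivity)).1 (hT0.2.le.trans (min_le_right _ _))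
    have h5 : ‖x - Xbar T0 0 x‖ * E ≤ T0 * (|M| + 1) * E * E :=
      mul_le_mul_of_nonneg_right h2 hE.le
    have h6 := infDist_sub_le (Ω := Ω) (Xbar t 0 x) (Xbar t T0 x)
    nlinarith
  -- each of the two changes, of the initial time and of the velocity, costs a part of the margin `d`
  refine ⟨min (min a T) (d / 2 / ((|M| + 1) * E * E)), (T - b) / 2,
    d / 4 / (2 * (E * (√T + 1))), lt_min (lt_min ha hT) (by positivity),
    half_pos (sub_pos.2 hbT), by positivity, d / 4, by positivity, fun T0 hT0 T1 hT1 x hx => ?_,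
    fun w hw _ hwn X hXw T0 hT0 T1 hT1 x hx => ?_⟩
  · obtain ⟨t, ht, -, h1⟩ := key T0 hT0 T1 hT1 x hx
    exact ⟨t, ht, by linarith⟩
  · obtain ⟨t, ht, ht0, h1⟩ := key T0 hT0 T1 hT1 x hx
    refine ⟨t, ht, ?_⟩
    have hγ := hXw.isTrajectory (hmem hT0) x
    have h2 := integral_norm_perturbation_le hc hw (by positivity) hwn hT.le hγ
    have h3 := dist_le_of_force hc hL (hX.isTrajectory (hmem hT0) x)
      (g := fun r => w r (X r T0 x)) (γ₂ := fun r => X r T0 x) ⟨hγ.integrable, hγ.eqn⟩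
      (hmem hT0) ht0
    simp only [hX.self (hmem hT0), hXw.self (hmem hT0), sub_self, norm_zero, zero_add] at h3
    have h4 := infDist_sub_le (Ω := Ω) (Xbar t T0 x) (X t T0 x)
    have hs := Real.sqrt_nonneg T
    have h5 : √T * (2 * (d / 4 / (2 * (E * (√T + 1))))) * E ≤ d / 4 := by
      have : √T * (2 * (d / 4 / (2 * (E * (√T + 1))))) * E = d / 4 * (√T / (√T + 1)) := by
        field_simp
      rw [this]
      refine mul_le_of_le_one_right (by positivity) ?_
      rw [div_le_one (by positivity)]
      linarith
    have h6 := mul_le_mul_of_nonneg_right h2 hE.le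
    linarith

/-! ### The weights -/

section TimeWeight

variable {T T0 T1 m μ : ℝ} {θ : ℝ → ℝ}

lemma IsTimeWeight.antitoneOn (h : IsTimeWeight T T0 T1 m μ θ) (hT0 : 0 < T0)
    (hT : T0 + 2 * T1 < T) (hμ : 0 ≤ μ) : AntitoneOn θ (Icc 0 (T - 2 * T1)) := by
  have h1 : AntitoneOn θ (Icc 0 T0) := by
    intro a ha b hb hab
    rw [h.initial a ha, h.initial b hb]
    have h2 : 0 ≤ 1 - b / T0 := by
      rw [sub_nonneg, div_le_one hT0]; exact hb.2
    have h3 : 1 - b / T0 ≤ 1 - a / T0 := by gcongr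
    have := Real.rpow_le_rpow h2 h3 hμ
    linarith
  have h2 : AntitoneOn θ (Icc T0 (T - 2 * T1)) := by
    intro a ha b hb _
    rw [h.middle a ha, h.middle b hb]
  have h3 : T0 ≤ T - 2 * T1 := by linarith
  rw [← Icc_union_Icc_eq_Icc hT0.le h3]
  exact h1.union_right h2 (isGreatest_Icc hT0.le) (isLeast_Icc h3)

lemma IsTimeWeight.monotoneOn (h : IsTimeWeight T T0 T1 m μ θ) (hT1 : 0 < T1)
    (hT : T0 + 2 * T1 < T) (hm : 0 ≤ m) : MonotoneOn θ (Ico T0 T) := by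
  have h1 : MonotoneOn θ (Icc T0 (T - 2 * T1)) := by
    intro a ha b hb _
    rw [h.middle a ha, h.middle b hb]
  have h2 : MonotoneOn θ (Ico (T - T1) T) := by
    intro a ha b hb hab
    rw [h.final a ha, h.final b hb]
    have h3 : 0 < T - b := by linarith [hb.2]
    gcongr
  have e1 : T0 ≤ T - 2 * T1 := by linarith
  have e2 : T - 2 * T1 ≤ T - T1 := by linarith
  have e3 : T - T1 < T := by linarith
  have h4 := h1.union_right h.mono (isGreatest_Icc e1) (isLeast_Icc e2)
  rw [Icc_union_Icc_eq_Icc e1 e2] at h4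
  have h5 := h4.union_right h2 (isGreatest_Icc (e1.trans e2)) (isLeast_Ico e3)
  rwa [Icc_union_Ico_eq_Ico (e1.trans e2) e3] at h5

lemma IsTimeWeight.apply_zero (h : IsTimeWeight T T0 T1 m μ θ) (hT0 : 0 < T0) : θ 0 = 2 := by
  rw [h.initial 0 ⟨le_rfl, hT0.le⟩]; norm_num

lemma IsTimeWeight.one_le (h : IsTimeWeight T T0 T1 m μ θ) (hT0 : 0 < T0) (hT1 : 0 < T1)
    (hT : T0 + 2 * T1 < T) (hm : 0 ≤ m) (hμ : 0 ≤ μ) {t : ℝ} (ht : t ∈ Ico 0 T) : 1 ≤ θ t := by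
  have e : T0 ≤ T - 2 * T1 := by linarith
  rw [← h.middle T0 ⟨le_rfl, e⟩]
  rcases le_total t T0 with h1 | h1
  · exact h.antitoneOn hT0 hT hμ ⟨ht.1, h1.trans e⟩ ⟨hT0.le, e⟩ h1
  · exact h.monotoneOn hT1 hT hm ⟨le_rfl, by linarith⟩ ⟨h1, ht.2⟩ h1

end TimeWeight

/-- The bound `e^{λ(6m+1)}` of `e^{λψ}`. -/
def expTop (m lam : ℝ) : ℝ := Real.exp (lam * (6 * m + 1))

section Scalars

variable {m s lam : ℝ} {θ : ℝ → ℝ} {ψ : ℝ → Plane → ℝ}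

lemma one_le_expTop (hm : 1 ≤ m) (hl : 1 ≤ lam) : 1 ≤ expTop m lam :=
  Real.one_le_exp (by positivity)

lemma le_bigLam (hl : 1 ≤ lam) : 6 * (lam * expTop m lam) ≤ bigLam m lam := by
  have e : bigLam m lam = lam * expTop m lam * Real.exp (5 * lam) := by
    rw [bigLam, expTop, mul_assoc lam, ← Real.exp_add]; ring_nf
  have h1 : 6 ≤ Real.exp (5 * lam) := by linarith [Real.add_one_le_exp (5 * lam)]
  have h2 : 0 ≤ lam * expTop m lam := mul_nonneg (by linarith) (Real.exp_pos _).le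
  rw [e]
  nlinarith

lemma le_bigLam_sub (hl : 1 ≤ lam) :
    5 * (lam * expTop m lam) ≤ bigLam m lam - expTop m lam := by
  have h1 := le_bigLam (m := m) hl
  have h2 : 0 < expTop m lam := Real.exp_pos _
  nlinarith

lemma exp_psi_le {a : ℝ} (hl : 1 ≤ lam) (ha : a ≤ 6 * m + 1) : Real.exp (lam * a) ≤ expTop m lam :=
  Real.exp_le_exp.2 (by gcongr)

lemma aleph_eq_exp {t : ℝ} {x : Plane} (ht : 0 < θ t) :
    aleph m s lam θ ψ t x =
      Real.exp (s * (θ t * (bigLam m lam - Real.exp (lam * ψ t x))) - 2 * (lam * ψ t x)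
        - 2 * Real.log (θ t)) := by
  have h : ∀ a : ℝ, Real.exp (2 * a) = Real.exp a ^ 2 := fun a => by
    rw [two_mul, Real.exp_add, sq]
  rw [aleph, xi, phi, Real.exp_sub, Real.exp_sub, h, h, Real.exp_log ht]
  field_simp

lemma aleph_pos {t : ℝ} {x : Plane} (ht : 0 < θ t) : 0 < aleph m s lam θ ψ t x := by
  rw [aleph_eq_exp ht]; exact Real.exp_pos _

/-- Comparison of the weight at two points, in terms of the variation of `ψ`. -/
lemma aleph_le (hm : 1 ≤ m) (hs : 1 ≤ s) (hl : 1 ≤ lam) {t r : ℝ} {x y : Plane} {δ : ℝ}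
    (ht : 1 ≤ θ t) (htr : θ t ≤ θ r) (hδ : |ψ t x - ψ r y| ≤ δ) (hy : ψ r y ≤ 6 * m + 1) :
    aleph m s lam θ ψ t x ≤
      Real.exp (3 * (s * θ t * lam * expTop m lam * δ)) * aleph m s lam θ ψ r y := by
  rw [aleph_eq_exp (by linarith), aleph_eq_exp (by linarith), ← Real.exp_add, Real.exp_le_exp]
  set a := ψ t x
  set b := ψ r y
  have hδ0 : 0 ≤ δ := (abs_nonneg _).trans hδ
  have hab := abs_le.1 hδ
  have hE1 := one_le_expTop hm hl
  have hb := exp_psi_le hl hy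
  have hst : 1 ≤ s * θ t := one_le_mul_of_one_le_of_one_le hs ht
  have h1 : Real.exp (lam * b) - Real.exp (lam * a) ≤ expTop m lam * (lam * δ) := by
    have h2 := Real.add_one_le_exp (lam * a - lam * b)
    have h3 : Real.exp (lam * a) = Real.exp (lam * b) * Real.exp (lam * a - lam * b) := by
      rw [← Real.exp_add]; ring_nf
    have h4 : 0 < Real.exp (lam * b) := Real.exp_pos _
    have h5 : lam * b - lam * a ≤ lam * δ := by nlinarith
    calc Real.exp (lam * b) - Real.exp (lam * a)
        ≤ Real.exp (lam * b) * (lam * b - lam * a) := by rw [h3]; nlinarith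
      _ ≤ Real.exp (lam * b) * (lam * δ) := by gcongr
      _ ≤ _ := by gcongr
  have h2 : s * θ t * (Real.exp (lam * b) - Real.exp (lam * a)) ≤
      s * θ t * lam * expTop m lam * δ := by
    calc _ ≤ s * θ t * (expTop m lam * (lam * δ)) := by gcongr
      _ = _ := by ring
  have h3 : lam * (b - a) ≤ s * θ t * lam * expTop m lam * δ := by
    calc lam * (b - a) ≤ lam * δ := by gcongr; linarith
      _ = 1 * 1 * (lam * δ) := by ring
      _ ≤ (s * θ t) * expTop m lam * (lam * δ) := by gcongr
      _ = _ := by ring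
  have h4 : Real.log (θ r) - Real.log (θ t) ≤ θ r - θ t := by
    rw [← Real.log_div (by linarith) (by linarith)]
    have h5 : 0 < θ r / θ t := div_pos (by linarith) (by linarith)
    refine (Real.log_le_sub_one_of_pos h5).trans ?_
    rw [div_sub_one (by linarith)]
    exact div_le_self (by linarith) ht
  have h5 : 5 ≤ s * (bigLam m lam - Real.exp (lam * b)) := by
    have h6 := le_bigLam_sub (m := m) hl
    have h7 : 1 ≤ lam * expTop m lam := one_le_mul_of_one_le_of_one_le hl hE1
    calc (5 : ℝ) = 1 * 5 := by norm_num
      _ ≤ _ := by gcongr; linarith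
  nlinarith

end Scalars

section SpaceWeight

variable {T m s lam : ℝ} {θ : ℝ → ℝ} {O : Set Plane} {psit : ℝ → Plane → ℝ}

lemma IsSpaceWeight.psi_le (h : IsSpaceWeight T O psit) {t : ℝ} (ht : t ∈ Icc 0 T) {x : Plane}
    (hx : x ∈ closure O) : psi m psit t x ≤ 6 * m + 1 := by
  have := (h.range t ht x hx).2
  unfold psi; linarith

lemma IsSpaceWeight.psi_nonneg (h : IsSpaceWeight T O psit) (hm : 1 ≤ m) {t : ℝ} (ht : t ∈ Icc 0 T)
    {x : Plane} (hx : x ∈ closure O) : 0 ≤ psi m psit t x := by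
  have := (h.range t ht x hx).1
  unfold psi; linarith

lemma phi_le_phiStar {t : ℝ} (hθ : 0 ≤ θ t) {x : Plane} (hx : x ∈ closure O) :
    phi m lam θ (psi m psit) t x ≤ phiStar O m lam θ (psi m psit) t := by
  refine le_csSup ⟨θ t * bigLam m lam, ?_⟩ (mem_image_of_mem _ hx)
  rintro _ ⟨y, -, rfl⟩
  unfold phi
  gcongr
  linarith [Real.exp_pos (lam * psi m psit t y)]

lemma IsSpaceWeight.le_phiStar (h : IsSpaceWeight T O psit) (hO : O.Nonempty) (hl : 1 ≤ lam) {t : ℝ}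
    (ht : t ∈ Icc 0 T) (hθ : 0 ≤ θ t) :
    5 * (θ t * lam * expTop m lam) ≤ phiStar O m lam θ (psi m psit) t := by
  obtain ⟨x, hx⟩ := hO.closure
  refine le_trans ?_ (phi_le_phiStar hθ hx)
  have h1 := le_bigLam_sub (m := m) hl
  have h2 := exp_psi_le hl (h.psi_le (m := m) ht hx)
  unfold phi
  calc 5 * (θ t * lam * expTop m lam) = θ t * (5 * (lam * expTop m lam)) := by ring
    _ ≤ _ := by gcongr; linarith

/-- The weight of `û` in `L²(0,T; H²)` absorbs any power of `ξ`. -/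
lemma IsSpaceWeight.le_exp_phiStar (h : IsSpaceWeight T O psit) (hO : O.Nonempty) (hs : 1 ≤ s)
    (hl : 1 ≤ lam) {t : ℝ} (ht : t ∈ Icc 0 T) (hθ : 0 ≤ θ t) :
    s * θ t * lam * expTop m lam ≤ Real.exp (3 * s * phiStar O m lam θ (psi m psit) t / 4) := by
  have h1 := h.le_phiStar (m := m) (θ := θ) hO hl ht hθ
  have h2 : 0 ≤ s * (θ t * lam * expTop m lam) := by
    have : 0 < expTop m lam := Real.exp_pos _
    positivity
  have h3 := Real.add_one_le_exp (3 * s * phiStar O m lam θ (psi m psit) t / 4)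
  nlinarith [mul_le_mul_of_nonneg_left h1 (zero_le_one.trans hs)]

lemma aleph_zero_le (h : IsSpaceWeight T O psit) (hT : 0 ≤ T) (hm : 1 ≤ m) (hs : 1 ≤ s)
    (hl : 1 ≤ lam) (hθ : 1 ≤ θ 0) {x : Plane} (hx : x ∈ closure O) :
    aleph m s lam θ (psi m psit) 0 x ≤ Real.exp (s * phiStar O m lam θ (psi m psit) 0) := by
  have h1 : 1 ≤ xi lam θ (psi m psit) 0 x := by
    have h2 : 1 ≤ Real.exp (lam * psi m psit 0 x) :=
      Real.one_le_exp (mul_nonneg (by linarith) (h.psi_nonneg hm (left_mem_Icc.2 hT) hx))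
    exact one_le_mul_of_one_le_of_one_le hθ h2
  have h2 := phi_le_phiStar (m := m) (lam := lam) (psit := psit) (zero_le_one.trans hθ) hx
  unfold aleph
  calc _ ≤ 1 * Real.exp (s * phi m lam θ (psi m psit) 0 x) := by
        gcongr
        exact inv_le_one_of_one_le₀ (one_le_pow₀ h1)
    _ ≤ _ := by rw [one_mul]; gcongr

end SpaceWeight

section Scaling

lemma IsWeakPartial.const_smul {U : Set Plane} {i : Fin 2} {v D : Plane → Plane}
    (h : IsWeakPartial U i v D) (c : ℝ) :
    IsWeakPartial U i (fun x => c • v x) (fun x => c • D x) := by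
  intro η h1 h2 h3
  simp_rw [smul_comm _ c]
  rw [integral_smul, integral_smul, h η h1 h2 h3, smul_neg]

lemma ofReal_mul_h2norm_le {U : Set Plane} {v : Plane → Plane} {c : ℝ} (hc : 0 < c) :
    ENNReal.ofReal c * h2norm U v ≤ h2norm U fun x => c • v x := by
  conv_rhs => rw [h2norm]
  refine le_iInf fun D₁ => le_iInf fun D₂ => le_iInf fun h => ?_
  have hv : v = fun x => c⁻¹ • (c • v x) := by
    ext1 x; rw [inv_smul_smul₀ hc.ne']
  have hj : IsH2Jet U v (fun i x => c⁻¹ • D₁ i x) (fun i j x => c⁻¹ • D₂ i j x) := by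
    refine ⟨?_, fun i => (h.memLp₁ i).const_smul c⁻¹, fun i j => (h.memLp₂ i j).const_smul c⁻¹,
      fun i => ?_, fun i j => (h.weak₂ i j).const_smul _⟩
    · rw [hv]; exact h.memLp.const_smul c⁻¹
    · rw [hv]; exact (h.weak₁ i).const_smul _
  have h0 : ENNReal.ofReal c ≠ 0 := by simpa using hc
  rw [ENNReal.mul_le_iff_le_inv h0 ENNReal.ofReal_ne_top]
  refine (iInf₂_le_of_le _ _ (iInf_le _ hj)).trans (le_of_eq ?_)
  have e : ∀ f : Plane → Plane, eLpNorm (fun x => c⁻¹ • f x) 2 (volume.restrict U) ^ 2 =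
      (ENNReal.ofReal c)⁻¹ ^ 2 * eLpNorm f 2 (volume.restrict U) ^ 2 := fun f => by
    have : (fun x => c⁻¹ • f x) = c⁻¹ • f := rfl
    rw [this, eLpNorm_const_smul, mul_pow, Real.enorm_eq_ofReal (inv_nonneg.2 hc.le),
      ENNReal.ofReal_inv_of_pos hc]
  have e0 : eLpNorm v 2 (volume.restrict U) ^ 2 =
      (ENNReal.ofReal c)⁻¹ ^ 2 * eLpNorm (fun x => c • v x) 2 (volume.restrict U) ^ 2 := by
    rw [← e, ← hv]
  simp_rw [e, e0, ← Finset.mul_sum]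
  rw [← mul_add, ← mul_add, ENNReal.mul_rpow_of_nonneg _ _ (by norm_num), ← ENNReal.rpow_two,
    ← ENNReal.rpow_mul]
  norm_num

end Scaling

/-! ### Variation of the weights along trajectories -/

/-- A function which is `C²` up to the boundary has a bounded derivative in the interior. The
derivative at the boundary is not mentioned, since it need not be unique there. -/
lemma exists_fderiv_bound {T : ℝ} {S : Set Plane} (hb : Bornology.IsBounded S)
    (hS : IsOpen S) {g : ℝ → Plane → ℝ}
    (hg : ContDiffOn ℝ 2 (Function.uncurry g) (Icc 0 T ×ˢ closure S)) :
    ∃ G : ℝ≥0, ∀ t ∈ Ioo 0 T, ∀ x ∈ S, ‖fderiv ℝ (Function.uncurry g) (t, x)‖ ≤ G := by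
  suffices h : ∃ G : ℝ≥0, ∀ q ∈ Icc 0 T ×ˢ closure S, q ∈ Ioo 0 T ×ˢ S →
      ‖fderiv ℝ (Function.uncurry g) q‖ ≤ G by
    obtain ⟨G, hG⟩ := h
    exact ⟨G, fun t ht x hx => hG (t, x) ⟨Ioo_subset_Icc_self ht, subset_closure hx⟩ ⟨ht, hx⟩⟩
  refine (isCompact_Icc.prod hb.isCompact_closure).induction_on
    (p := fun W => ∃ G : ℝ≥0, ∀ q ∈ W, q ∈ Ioo 0 T ×ˢ S →
      ‖fderiv ℝ (Function.uncurry g) q‖ ≤ G) ⟨0, by simp⟩ ?_ ?_ ?_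
  · rintro W W' hW ⟨G, hG⟩
    exact ⟨G, fun q hq => hG q (hW hq)⟩
  · rintro W W' ⟨G, hG⟩ ⟨G', hG'⟩
    refine ⟨max G G', ?_⟩
    rintro q (hq | hq) hq'
    · exact (hG q hq hq').trans (NNReal.coe_le_coe.2 (le_max_left _ _))
    · exact (hG' q hq hq').trans (NNReal.coe_le_coe.2 (le_max_right _ _))
  · intro p hp
    have h1 : ContDiffWithinAt ℝ (1 + 1) (Function.uncurry g) (Icc 0 T ×ˢ closure S) p := by
      have := hg p hp
      rwa [one_add_one_eq_two]
    obtain ⟨W, hW, -, f', hf', hc⟩ := (contDiffWithinAt_succ_iff_hasFDerivWithinAt (by simp)).1 h1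
    rw [insert_eq_of_mem hp] at hW
    have h2 : ∀ᶠ q in 𝓝[W] p, ‖f' q‖ < ‖f' p‖ + 1 :=
      hc.continuousWithinAt.norm.eventually (gt_mem_nhds (lt_add_one _))
    have h3 : ∀ᶠ q in 𝓝[Icc 0 T ×ˢ closure S] p, ‖f' q‖ < ‖f' p‖ + 1 :=
      h2.filter_mono (nhdsWithin_le_of_mem hW)
    obtain ⟨V, hV, hpV, hVW⟩ := mem_nhdsWithin.1 (inter_mem hW h3)
    refine ⟨V ∩ Icc 0 T ×ˢ closure S, inter_mem (mem_nhdsWithin_of_mem_nhds (hV.mem_nhds hpV))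
      self_mem_nhdsWithin, ⟨‖f' p‖ + 1, by positivity⟩, fun q hq hq' => ?_⟩
    have h4 := hVW hq
    have h5 : W ∈ 𝓝 q := by
      refine mem_of_superset ((hV.inter (isOpen_Ioo.prod hS)).mem_nhds ⟨hq.1, hq'⟩) fun z hz => ?_
      exact (hVW ⟨hz.1, Ioo_subset_Icc_self hz.2.1, subset_closure hz.2.2⟩).1
    rw [((hf' q h4.1).hasFDerivAt h5).fderiv]
    exact h4.2.le

section Chain

variable {T : ℝ} {Ω O : Set Plane} {ybar u : ℝ → Plane → Plane} {psit : ℝ → Plane → ℝ}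

/-- Along a trajectory of `ybar + u`, only `u` contributes to the variation of `ψ`. -/
lemma abs_psi_sub_le_of_pos {m : ℝ} {G : ℝ≥0} (hO : IsOpen O) (hΩO : Ω ⊆ O)
    (hψ : ContDiffOn ℝ 2 (Function.uncurry psit) (Icc 0 T ×ˢ closure O))
    (htr : IsTransportedBy T Ω ybar (psi m psit))
    (hG : ∀ t ∈ Ioo 0 T, ∀ x ∈ Ω, ‖fderiv ℝ (Function.uncurry psit) (t, x)‖ ≤ G)
    {a : ℝ → ℝ} (ha : IntervalIntegrable a volume 0 T)
    (hua : ∀ᵐ t ∂(volume.restrict (Ioo 0 T)), ∀ x, ‖u t x‖ ≤ a t)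
    {γ : ℝ → Plane} (hγ : IsTrajectory T (totalField T ybar u) γ)
    {r t : ℝ} (hr : r ∈ Ioo 0 T) (ht : t ∈ Ioo 0 T) (hrt : r ≤ t) (hin : ∀ q ∈ Icc r t, γ q ∈ Ω) :
    |psi m psit t (γ t) - psi m psit r (γ r)| ≤ G * ∫ q in r..t, a q := by
  have hT : 0 ≤ T := hr.1.le.trans hr.2.le
  have hsub : Icc r t ⊆ Ioo 0 T := Icc_subset_Ioo hr.1 ht.2
  have hsub' : uIcc r t ⊆ uIcc 0 T :=
    uIcc_subset_time (Ioo_subset_Icc_self hr) (Ioo_subset_Icc_self ht)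
  set c : ℝ → ℝ × Plane := fun q => (q, γ q) with hc
  have hcin : ∀ q ∈ Icc r t, c q ∈ Ioo 0 T ×ˢ Ω := fun q hq => ⟨hsub hq, hin q hq⟩
  have hdiff : ∀ z ∈ Ioo 0 T ×ˢ Ω, ContDiffAt ℝ 2 (Function.uncurry psit) z := fun z hz =>
    contDiffAt_uncurry hψ hz.1 (interior_maximal subset_closure hO (hΩO hz.2))
  have hint := hγ.integrable.mono_set hsub'
  have hγeq : ∀ q ∈ Icc 0 T, γ q = γ r + ∫ z in r..q, totalField T ybar u z (γ z) := fun q hq =>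
    hγ.eqn r (Ioo_subset_Icc_self hr) q hq
  -- the path `c` is absolutely continuous, and `psit` is Lipschitz on its compact image
  have hcAC : AbsolutelyContinuousOnInterval c r t := by
    have h1 : AbsolutelyContinuousOnInterval
        (fun q => ∫ z in r..q, (1 + ‖totalField T ybar u z (γ z)‖)) r t :=
      absolutelyContinuousOnInterval_integral (intervalIntegrable_const.add hint.norm) left_mem_uIcc
    refine absolutelyContinuousOnInterval_of_dist_le 1 h1 fun x hx y hy => ?_
    have hi : ∀ z ∈ uIcc r t, IntervalIntegrable (fun z => totalField T ybar u z (γ z)) volume r z :=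
      fun z hz => hint.mono_set (uIcc_subset_uIcc left_mem_uIcc hz)
    have hxy : uIcc y x ⊆ uIcc r t := uIcc_subset_uIcc hy hx
    have hmem : ∀ z ∈ uIcc r t, z ∈ Icc 0 T := fun z hz =>
      Ioo_subset_Icc_self (hsub (by rwa [uIcc_of_le hrt] at hz))
    rw [one_mul, dist_eq_norm (∫ z in r..x, _), intervalIntegral.integral_interval_sub_left
      (intervalIntegrable_const.add (hi x hx).norm) (intervalIntegrable_const.add (hi y hy).norm),
      intervalIntegral.integral_add intervalIntegrable_const ((hint.mono_set hxy).norm),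
      Prod.dist_eq, Real.norm_eq_abs]
    have h2 : γ x - γ y = ∫ z in y..x, totalField T ybar u z (γ z) := by
      rw [hγ.eqn y (hmem y hy) x (hmem x hx)]; abel
    have h3 : ‖γ x - γ y‖ ≤ |∫ z in y..x, ‖totalField T ybar u z (γ z)‖| := by
      rw [h2]; exact intervalIntegral.norm_integral_le_abs_integral_norm
    have h4 : |∫ z in y..x, (1 : ℝ)| = |x - y| := by simp
    have h5 : |∫ z in y..x, (1 : ℝ)| + |∫ z in y..x, ‖totalField T ybar u z (γ z)‖| =
        |(∫ z in y..x, (1 : ℝ)) + ∫ z in y..x, ‖totalField T ybar u z (γ z)‖| := by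
      have hnn : ∀ y x : ℝ, y ≤ x → 0 ≤ ∫ z in y..x, ‖totalField T ybar u z (γ z)‖ := fun y x h =>
        intervalIntegral.integral_nonneg h fun _ _ => norm_nonneg _
      rcases le_total y x with hle | hle
      · rw [abs_of_nonneg (hnn y x hle), intervalIntegral.integral_const, smul_eq_mul, mul_one, abs_of_nonneg (sub_nonneg.2 hle),
          abs_of_nonneg (add_nonneg (sub_nonneg.2 hle) (hnn y x hle))]
      · have hJ : ∫ z in y..x, ‖totalField T ybar u z (γ z)‖ ≤ 0 := by
          rw [intervalIntegral.integral_symm]; exact neg_nonpos.2 (hnn x y hle)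
        have hxy0 : x - y ≤ 0 := sub_nonpos.2 hle
        rw [intervalIntegral.integral_const, smul_eq_mul, mul_one, abs_of_nonpos hxy0,
          abs_of_nonpos hJ, abs_of_nonpos (add_nonpos hxy0 hJ)]
        ring
    rw [← h5, h4]
    refine max_le ?_ ?_
    · rw [Real.dist_eq]; exact le_add_of_nonneg_right (abs_nonneg _)
    · rw [dist_eq_norm]; exact h3.trans (le_add_of_nonneg_left (abs_nonneg _))
  have hccont : ContinuousOn c (Icc r t) :=
    continuousOn_id.prodMk ((hγ.continuousOn hT).mono (hsub.trans Ioo_subset_Icc_self))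
  obtain ⟨Lc, hLc⟩ : ∃ K, LipschitzOnWith K (Function.uncurry psit) (c '' Icc r t) := by
    refine LocallyLipschitzOn.exists_lipschitzOnWith_of_compact
      (isCompact_Icc.image_of_continuousOn hccont) ?_
    rintro _ ⟨q, hq, rfl⟩
    obtain ⟨K, W, hW, hK⟩ := ((hdiff _ (hcin q hq)).of_le one_le_two).exists_lipschitzOnWith
    exact ⟨K, W, mem_nhdsWithin_of_mem_nhds hW, hK⟩
  have hfAC : AbsolutelyContinuousOnInterval (fun q => Function.uncurry psit (c q)) r t := by
    refine absolutelyContinuousOnInterval_of_dist_le Lc hcAC fun x hx y hy => ?_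
    rw [uIcc_of_le hrt] at hx hy
    exact hLc.dist_le_mul _ (mem_image_of_mem c hx) _ (mem_image_of_mem c hy)
  have hderiv : ∀ᵐ q, q ∈ uIoc r t → ‖deriv (fun q => Function.uncurry psit (c q)) q‖ ≤ G * a q := by
    filter_upwards [hγ.integrable.ae_hasDerivAt_integral, ae_uIoc_of_ae_restrict hua
      (Ioo_subset_Icc_self hr) (Ioo_subset_Icc_self ht)] with q h1 h2 hq
    have hqI : q ∈ Icc r t := by
      rw [uIoc_of_le hrt] at hq; exact Ioc_subset_Icc_self hq
    have hqT := hsub hqI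
    have h3 : HasDerivAt γ (totalField T ybar u q (γ q)) q := by
      have h4 := (h1 (by rw [uIcc_of_le hT]; exact Ioo_subset_Icc_self hqT) r
        (by rw [uIcc_of_le hT]; exact Ioo_subset_Icc_self hr)).const_add (γ r)
      refine h4.congr_of_eventuallyEq ?_
      filter_upwards [Icc_mem_nhds hqT.1 hqT.2] with z hz using hγeq z hz
    have h5 : HasDerivAt c ((1 : ℝ), totalField T ybar u q (γ q)) q := (hasDerivAt_id q).prodMk h3
    have h6 : HasFDerivAt (Function.uncurry psit) (fderiv ℝ (Function.uncurry psit) (c q)) (c q) :=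
      ((hdiff _ (hcin q hqI)).differentiableAt (by simp)).hasFDerivAt
    have h7 : HasDerivAt (fun q => Function.uncurry psit (c q)) _ q := h6.comp_hasDerivAt q h5
    rw [h7.deriv]
    have h8 : fderiv ℝ (Function.uncurry psit) (c q) ((1 : ℝ), ybar q (γ q)) = 0 := by
      have h9 := htr q hqT (γ q) (hin q hqI)
      have d1 : HasDerivAt (fun r => psi m psit r (γ q))
          (fderiv ℝ (Function.uncurry psit) (c q) ((1 : ℝ), (0 : Plane))) q := by
        have := HasFDerivAt.comp_hasDerivAt (f := fun r => (r, γ q)) q h6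
          ((hasDerivAt_id q).prodMk (hasDerivAt_const q (γ q)))
        exact this.add_const (6 * m)
      have d2 : HasFDerivAt (psi m psit q) ((fderiv ℝ (Function.uncurry psit) (c q)).comp
          (ContinuousLinearMap.inr ℝ ℝ Plane)) (γ q) :=
        (h6.comp (γ q) (hasFDerivAt_prodMk_right q (γ q))).add_const (6 * m)
      rw [d1.deriv, d2.fderiv, ContinuousLinearMap.comp_apply, ContinuousLinearMap.inr_apply,
        ← map_add] at h9
      simpa using h9
    have e : ((1 : ℝ), totalField T ybar u q (γ q)) =
        ((1 : ℝ), ybar q (γ q)) + ((0 : ℝ), u q (γ q)) := by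
      rw [totalField_of_mem hqT]; simp
    rw [e, map_add, h8, zero_add]
    refine (ContinuousLinearMap.le_opNorm _ _).trans ?_
    refine mul_le_mul (hG q hqT _ (hin q hqI)) ?_ (norm_nonneg _) G.2
    rw [Prod.norm_mk, norm_zero, max_eq_right (norm_nonneg _)]
    exact h2 hq _
  have e1 : psi m psit t (γ t) - psi m psit r (γ r) =
      ∫ q in r..t, deriv (fun q => Function.uncurry psit (c q)) q := by
    rw [hfAC.integral_deriv_eq_sub]
    simp [psi, hc]
  rw [e1, ← intervalIntegral.integral_const_mul, ← Real.norm_eq_abs]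
  refine intervalIntegral.norm_integral_le_of_norm_le hrt ?_ ((ha.mono_set hsub').const_mul _)
  filter_upwards [hderiv] with q hq hq'
  exact hq (by rwa [uIoc_of_le hrt])

/-- The bound of `abs_psi_sub_le_of_pos` up to the initial time, by continuity. -/
lemma abs_psi_sub_le {m : ℝ} {G : ℝ≥0} (hO : IsOpen O) (hΩO : Ω ⊆ O)
    (hψ : ContDiffOn ℝ 2 (Function.uncurry psit) (Icc 0 T ×ˢ closure O))
    (htr : IsTransportedBy T Ω ybar (psi m psit))
    (hG : ∀ t ∈ Ioo 0 T, ∀ x ∈ Ω, ‖fderiv ℝ (Function.uncurry psit) (t, x)‖ ≤ G)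
    {a : ℝ → ℝ} (ha : IntervalIntegrable a volume 0 T) (ha0 : ∀ t, 0 ≤ a t)
    (hua : ∀ᵐ t ∂(volume.restrict (Ioo 0 T)), ∀ x, ‖u t x‖ ≤ a t)
    {γ : ℝ → Plane} (hγ : IsTrajectory T (totalField T ybar u) γ)
    {r t : ℝ} (hr : r ∈ Ico 0 T) (ht : t ∈ Ioo 0 T) (hrt : r ≤ t) (hin : ∀ q ∈ Icc r t, γ q ∈ Ω) :
    |psi m psit t (γ t) - psi m psit r (γ r)| ≤ G * ∫ q in r..t, a q := by
  rcases hrt.eq_or_lt with rfl | hlt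
  · simp
  have hT : 0 ≤ T := hr.1.trans hr.2.le
  have hsub : Icc r t ⊆ Icc 0 T := Icc_subset_Icc hr.1 ht.2.le
  have hcont : ContinuousOn (fun q => psi m psit q (γ q)) (Icc r t) := by
    have h1 : ContinuousOn (fun q => (q, γ q)) (Icc r t) :=
      continuousOn_id.prodMk ((hγ.continuousOn hT).mono hsub)
    have h2 : ContinuousOn (fun q => Function.uncurry psit (q, γ q)) (Icc r t) :=
      hψ.continuousOn.comp h1 fun q hq => ⟨hsub hq, subset_closure (hΩO (hin q hq))⟩
    exact h2.add continuousOn_const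
  have hlim : Tendsto (fun q => |psi m psit t (γ t) - psi m psit q (γ q)|) (𝓝[>] r)
      (𝓝 |psi m psit t (γ t) - psi m psit r (γ r)|) := by
    refine (tendsto_const_nhds.sub ?_).abs
    refine (hcont r ⟨le_rfl, hrt⟩).tendsto.mono_left ?_
    rw [← nhdsWithin_Ioc_eq_nhdsGT hlt]
    exact nhdsWithin_mono _ Ioc_subset_Icc_self
  refine le_of_tendsto hlim ?_
  filter_upwards [Ioc_mem_nhdsGT hlt] with q hq
  refine (abs_psi_sub_le_of_pos hO hΩO hψ htr hG ha hua hγ ⟨hr.1.trans_lt hq.1,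
    hq.2.trans_lt ht.2⟩ ht hq.2 fun z hz => hin z ⟨hq.1.le.trans hz.1, hz.2⟩).trans ?_
  gcongr
  exact intervalIntegral.integral_mono_interval hq.1.le hq.2 le_rfl (Eventually.of_forall ha0)
    (ha.mono_set (uIcc_subset_time (Ico_subset_Icc_self hr) (Ioo_subset_Icc_self ht)))

end Chain

/-! ### Consequences of admissibility -/

lemma rpow_half_lintegral_const_mul {α : Type*} [MeasurableSpace α] {ν : Measure α} {c : ℝ≥0∞}
    (hc : c ≠ ⊤) (f : α → ℝ≥0∞) :
    (∫⁻ t, (c * f t) ^ 2 ∂ν) ^ (1 / 2 : ℝ) = c * (∫⁻ t, f t ^ 2 ∂ν) ^ (1 / 2 : ℝ) := by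
  simp_rw [mul_pow]
  rw [lintegral_const_mul' _ _ (ENNReal.pow_ne_top hc), ENNReal.mul_rpow_of_nonneg _ _ (by norm_num),
    ← ENNReal.rpow_two, ← ENNReal.rpow_mul]
  norm_num

section Admissible

variable {T : ℝ} {Ω O : Set Plane} {K : ℝ≥0} {sig m s lam : ℝ} {θ : ℝ → ℝ} {psit : ℝ → Plane → ℝ}
  {u : ℝ → Plane → Plane}

lemma IsAdmissible.mul_h2norm_le (h : IsAdmissible T Ω O K sig m s lam θ (psi m psit) u)
    (hw : IsSpaceWeight T O psit) (hO : O.Nonempty) (hs : 1 ≤ s) (hl : 1 ≤ lam)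
    (hθ : ∀ t ∈ Ico 0 T, 1 ≤ θ t) :
    ∀ᵐ t ∂(volume.restrict (Ioo 0 T)),
      ENNReal.ofReal (s * θ t * lam * expTop m lam) * h2norm univ (u t) ≤ K * h2norm Ω fun x =>
        Real.exp (3 * s * phiStar O m lam θ (psi m psit) t / 4) • u t x := by
  filter_upwards [h.extension, ae_restrict_mem measurableSet_Ioo] with t h1 ht
  have hθt := hθ t ⟨ht.1.le, ht.2⟩
  calc _ ≤ ENNReal.ofReal (s * θ t * lam * expTop m lam) * (K * h2norm Ω (u t)) := by gcongr
    _ = K * (ENNReal.ofReal (s * θ t * lam * expTop m lam) * h2norm Ω (u t)) := mul_left_comm _ _ _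
    _ ≤ K * (ENNReal.ofReal (Real.exp (3 * s * phiStar O m lam θ (psi m psit) t / 4)) *
          h2norm Ω (u t)) := by
        gcongr
        exact hw.le_exp_phiStar hO hs hl (Ioo_subset_Icc_self ht) (by linarith)
    _ ≤ _ := by
        gcongr
        exact ofReal_mul_h2norm_le (Real.exp_pos _)

lemma le_time_factor (hm : 1 ≤ m) (hs : 1 ≤ s) (hl : 1 ≤ lam) {t : ℝ} (hθ : 1 ≤ θ t) :
    s ≤ s * θ t * lam * expTop m lam := by
  have h1 : 1 ≤ θ t * lam * expTop m lam := one_le_mul_of_one_le_of_one_le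
    (one_le_mul_of_one_le_of_one_le hθ hl) (one_le_expTop hm hl)
  nlinarith

lemma IsAdmissible.h2norm_univ_le (h : IsAdmissible T Ω O K sig m s lam θ (psi m psit) u)
    (hw : IsSpaceWeight T O psit) (hO : O.Nonempty) (hm : 1 ≤ m) (hs : 1 ≤ s) (hl : 1 ≤ lam)
    (hθ : ∀ t ∈ Ico 0 T, 1 ≤ θ t) :
    ∀ᵐ t ∂(volume.restrict (Ioo 0 T)),
      ENNReal.ofReal s * h2norm univ (u t) ≤ K * h2norm Ω fun x =>
        Real.exp (3 * s * phiStar O m lam θ (psi m psit) t / 4) • u t x := by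
  filter_upwards [h.mul_h2norm_le hw hO hs hl hθ, ae_restrict_mem measurableSet_Ioo] with t h1 ht
  refine le_trans ?_ h1
  gcongr
  exact le_time_factor hm hs hl (hθ t ⟨ht.1.le, ht.2⟩)

lemma IsAdmissible.memL2H2_univ (h : IsAdmissible T Ω O K sig m s lam θ (psi m psit) u)
    (hw : IsSpaceWeight T O psit) (hO : O.Nonempty) (hm : 1 ≤ m) (hs : 1 ≤ s) (hl : 1 ≤ lam)
    (hθ : ∀ t ∈ Ico 0 T, 1 ≤ θ t) : MemL2H2 T univ u := by
  have h1 : ∀ᵐ t ∂(volume.restrict (Ioo 0 T)), h2norm univ (u t) ≤ K * h2norm Ω fun x =>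
      Real.exp (3 * s * phiStar O m lam θ (psi m psit) t / 4) • u t x := by
    filter_upwards [h.h2norm_univ_le hw hO hm hs hl hθ] with t ht
    refine le_trans ?_ ht
    refine le_mul_of_one_le_left zero_le ?_
    rwa [ENNReal.one_le_ofReal]
  constructor
  · filter_upwards [h1, h.memL2H2.1] with t h2 h3
    exact h2.trans_lt (ENNReal.mul_lt_top ENNReal.coe_lt_top h3)
  · refine lt_of_le_of_lt ?_ (ENNReal.mul_lt_top (ENNReal.coe_lt_top (r := K)) h.memL2H2.2)
    rw [l2h2norm, l2h2norm, ← rpow_half_lintegral_const_mul ENNReal.coe_ne_top]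
    gcongr ?_ ^ (1 / 2 : ℝ)
    refine lintegral_mono_ae (h1.mono fun t ht => ?_)
    gcongr

/-- For `s` large, an admissible perturbation is small enough for the exit property. -/
lemma IsAdmissible.l2linfnorm_le (h : IsAdmissible T Ω O K sig m s lam θ (psi m psit) u)
    (hw : IsSpaceWeight T O psit) (hO : O.Nonempty) (hm : 1 ≤ m) (hs : 1 ≤ s) (hl : 1 ≤ lam)
    (hθ : ∀ t ∈ Ico 0 T, 1 ≤ θ t) (hsK : sobolevConst * K ≤ s) :
    l2linfnorm T univ u ≤ ENNReal.ofReal sig := by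
  refine le_trans ?_ h.small
  rw [l2linfnorm, l2h2norm]
  gcongr ?_ ^ (1 / 2 : ℝ)
  refine lintegral_mono_ae ?_
  filter_upwards [h.h2norm_univ_le hw hO hm hs hl hθ, h.rep.continuous] with t h1 hc
  gcongr
  set H := h2norm Ω fun x => Real.exp (3 * s * phiStar O m lam θ (psi m psit) t / 4) • u t x
  have h2 : eLpNorm (u t) ⊤ (volume.restrict univ) ≤
      ENNReal.ofReal sobolevConst * h2norm univ (u t) := by
    rw [eLpNorm_exponent_top]
    exact eLpNormEssSup_le_of_ae_enorm_bound (Eventually.of_forall fun x =>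
      (enorm_le_supMod hc x).trans (supMod_le_h2norm hc))
  have hs0 : ENNReal.ofReal s ≠ 0 := by
    simp only [ne_eq, ENNReal.ofReal_eq_zero, not_le]; linarith
  rw [← ENNReal.mul_le_mul_iff_right hs0 ENNReal.ofReal_ne_top]
  calc _ ≤ ENNReal.ofReal s * (ENNReal.ofReal sobolevConst * h2norm univ (u t)) := by gcongr
    _ = ENNReal.ofReal sobolevConst * (ENNReal.ofReal s * h2norm univ (u t)) := mul_left_comm _ _ _
    _ ≤ ENNReal.ofReal sobolevConst * (K * H) := mul_le_mul_right h1 _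
    _ = ENNReal.ofReal (sobolevConst * K) * H := by
        rw [ENNReal.ofReal_mul sobolevConst_pos.le, ENNReal.ofReal_coe_nnreal]
        exact (mul_assoc _ _ _).symm
    _ ≤ _ := by gcongr

/-- The integral of `û`, weighted by the size of `s ∂ξ`, is bounded independently of `s`, `λ`
and `θ`. -/
lemma IsAdmissible.lintegral_time_factor_le
    (h : IsAdmissible T Ω O K sig m s lam θ (psi m psit) u) (hT : 0 ≤ T)
    (hw : IsSpaceWeight T O psit) (hO : O.Nonempty) (hs : 1 ≤ s) (hl : 1 ≤ lam)
    (hθ : ∀ t ∈ Ico 0 T, 1 ≤ θ t) (hθc : ContinuousOn θ (Ico 0 T)) :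
    ∫⁻ t in Ioo 0 T, ENNReal.ofReal (s * θ t * lam * expTop m lam) * supMod (u t) ≤
      ENNReal.ofReal (√T * (sobolevConst * K * sig)) := by
  have h1 : ∀ᵐ t ∂(volume.restrict (Ioo 0 T)),
      ENNReal.ofReal (s * θ t * lam * expTop m lam) * supMod (u t) ≤
        ENNReal.ofReal (sobolevConst * K) * h2norm Ω fun x =>
          Real.exp (3 * s * phiStar O m lam θ (psi m psit) t / 4) • u t x := by
    filter_upwards [h.mul_h2norm_le hw hO hs hl hθ, h.rep.continuous] with t h1 hc
    calc _ ≤ ENNReal.ofReal (s * θ t * lam * expTop m lam) *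
          (ENNReal.ofReal sobolevConst * h2norm univ (u t)) := by
          gcongr; exact supMod_le_h2norm hc
      _ = ENNReal.ofReal sobolevConst *
          (ENNReal.ofReal (s * θ t * lam * expTop m lam) * h2norm univ (u t)) :=
          mul_left_comm _ _ _
      _ ≤ ENNReal.ofReal sobolevConst * (K * _) := mul_le_mul_right h1 _
      _ = _ := by
          rw [ENNReal.ofReal_mul sobolevConst_pos.le, ENNReal.ofReal_coe_nnreal]
          exact (mul_assoc _ _ _).symm
  have hmeas : AEMeasurable (fun t => ENNReal.ofReal (s * θ t * lam * expTop m lam) *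
      supMod (u t)) (volume.restrict (Ioo 0 T)) := by
    refine AEMeasurable.mul ?_ (measurable_supMod h.rep.measurable).aemeasurable
    refine ENNReal.measurable_ofReal.comp_aemeasurable ?_
    refine ContinuousOn.aemeasurable ?_ measurableSet_Ioo
    exact (((continuousOn_const.mul (hθc.mono Ioo_subset_Ico_self)).mul continuousOn_const).mul
      continuousOn_const)
  refine (lintegral_le_sqrt_mul hT hmeas h1).trans ?_
  rw [rpow_half_lintegral_const_mul ENNReal.ofReal_ne_top, ENNReal.ofReal_mul (Real.sqrt_nonneg _),
    ENNReal.ofReal_mul (mul_nonneg sobolevConst_pos.le K.coe_nonneg)]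
  gcongr
  exact h.small

/-- The constant in the comparison of `ℵ` at two points of a trajectory. -/
def transportConst (T : ℝ) (K G : ℝ≥0) (sig : ℝ) : ℝ :=
  Real.exp (3 * (G * (√T * (sobolevConst * K * sig))))

/-- On a piece of trajectory in `Ω` with an endpoint `t` at which `θ` is smallest, the weight `ℵ` is
smallest at `t`, up to a constant. -/
lemma IsAdmissible.aleph_le_along {ybar : ℝ → Plane → Plane} {G : ℝ≥0}
    (h : IsAdmissible T Ω O K sig m s lam θ (psi m psit) u)
    (hw : IsSpaceWeight T O psit) (hOne : O.Nonempty) (hO : IsOpen O)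
    (hΩO : Ω ⊆ O) (htr : IsTransportedBy T Ω ybar (psi m psit))
    (hG : ∀ t ∈ Ioo 0 T, ∀ x ∈ Ω, ‖fderiv ℝ (Function.uncurry psit) (t, x)‖ ≤ G)
    (hm : 1 ≤ m) (hs : 1 ≤ s) (hl : 1 ≤ lam) (hsig : 0 ≤ sig)
    (hθ : ∀ t ∈ Ico 0 T, 1 ≤ θ t) (hθc : ContinuousOn θ (Ico 0 T))
    {γ : ℝ → Plane} (hγ : IsTrajectory T (totalField T ybar u) γ)
    {r t : ℝ} (hr : r ∈ Ico 0 T) (ht : t ∈ Ioo 0 T) (hin : ∀ q ∈ uIcc r t, γ q ∈ Ω)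
    (hθt : ∀ q ∈ uIcc r t, θ t ≤ θ q) :
    aleph m s lam θ (psi m psit) t (γ t) ≤
      transportConst T K G sig * aleph m s lam θ (psi m psit) r (γ r) := by
  have hT : 0 ≤ T := hr.1.trans hr.2.le
  have hmem := h.memL2H2_univ hw hOne hm hs hl hθ
  set a : ℝ → ℝ := fun t => (supMod (u t)).toReal with ha_def
  have ha : IntervalIntegrable a volume 0 T := by
    have h := intervalIntegrable_totalBound hT h.rep hmem 0
    unfold totalBound at h
    simpa only [add_zero] using h
  have ha0 : ∀ t, 0 ≤ a t := fun t => ENNReal.toReal_nonneg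
  have hua : ∀ᵐ t ∂(volume.restrict (Ioo 0 T)), ∀ x, ‖u t x‖ ≤ a t := by
    filter_upwards [h.rep.continuous, ae_supMod_lt_top h.rep hmem] with t hc hfin x
    exact toReal_le_of_enorm_le hfin (enorm_le_supMod hc x)
  set p := min r t
  set q := max r t
  have hpq : p ≤ q := min_le_max
  have hp : p ∈ Ico 0 T := ⟨le_min hr.1 ht.1.le, (min_le_left _ _).trans_lt hr.2⟩
  have hq : q ∈ Ioo 0 T := ⟨ht.1.trans_le (le_max_right _ _), max_lt hr.2 ht.2⟩
  have h1 : |psi m psit t (γ t) - psi m psit r (γ r)| ≤ G * ∫ z in p..q, a z := by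
    have h2 := abs_psi_sub_le hO hΩO hw.contDiffOn htr hG ha ha0 hua hγ hp hq hpq
      (fun z hz => hin z hz)
    rcases le_total r t with hle | hle
    · simpa only [p, q, min_eq_left hle, max_eq_right hle] using h2
    · rw [abs_sub_comm]
      simpa only [p, q, min_eq_right hle, max_eq_left hle] using h2
  have hrO : γ r ∈ closure O := subset_closure (hΩO (hin r left_mem_uIcc))
  refine (aleph_le hm hs hl (hθ t ⟨ht.1.le, ht.2⟩) (hθt r left_mem_uIcc) h1
    (hw.psi_le (Ico_subset_Icc_self hr) hrO)).trans ?_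
  have hal : 0 < aleph m s lam θ (psi m psit) r (γ r) := aleph_pos (zero_lt_one.trans_le (hθ r hr))
  refine mul_le_mul_of_nonneg_right ?_ hal.le
  rw [transportConst, Real.exp_le_exp]
  refine mul_le_mul_of_nonneg_left ?_ (by norm_num : (0 : ℝ) ≤ 3)
  rw [mul_left_comm]
  refine mul_le_mul_of_nonneg_left ?_ G.2
  -- `θ` is smallest at `t`, so that the factor can be moved inside of the integral
  set z : ℝ → ℝ := fun t => s * θ t * lam * expTop m lam with hz
  have hE : 0 < expTop m lam := Real.exp_pos _
  have hz0 : 0 ≤ z t := (zero_le_one.trans hs).trans (le_time_factor hm hs hl (hθ t ⟨ht.1.le, ht.2⟩))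
  have hsub : Ioc p q ⊆ Ioo 0 T := fun x hx => ⟨hp.1.trans_lt hx.1, hx.2.trans_lt hq.2⟩
  have hi : IntegrableOn a (Ioc p q) :=
    ((intervalIntegrable_iff_integrableOn_Ioo_of_le hT).1 ha).mono_set hsub
  have h3 : ENNReal.ofReal (z t * ∫ x in p..q, a x) ≤
      ENNReal.ofReal (√T * (sobolevConst * K * sig)) := by
    refine le_trans ?_ (h.lintegral_time_factor_le hT hw hOne hs hl hθ hθc)
    rw [ENNReal.ofReal_mul hz0, intervalIntegral.integral_of_le hpq,
      ofReal_integral_eq_lintegral_ofReal hi (Eventually.of_forall ha0),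
      ← lintegral_const_mul' _ _ ENNReal.ofReal_ne_top]
    refine le_trans ?_ (lintegral_mono_set hsub)
    refine setLIntegral_mono_ae' measurableSet_Ioc (Eventually.of_forall fun x hx => ?_)
    refine mul_le_mul' (ENNReal.ofReal_le_ofReal ?_) ENNReal.ofReal_toReal_le
    have h4 := hθt x (Ioc_subset_Icc_self hx)
    simp only [hz]
    gcongr
  have := sobolevConst_pos
  exact (ENNReal.ofReal_le_ofReal_iff (by positivity)).1 h3

end Admissible

/-! ### Solutions along the characteristics -/

/-- A path which ends in an open set, and is not always in it, has a last entrance. -/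
lemma exists_entrance {Ω : Set Plane} (hΩ : IsOpen Ω) {γ : ℝ → Plane} {a t : ℝ}
    (hγ : ContinuousOn γ (Icc a t)) (ht : γ t ∈ Ω) (h : ¬ ∀ q ∈ Icc a t, γ q ∈ Ω) :
    ∃ τ ∈ Ico a t, γ τ ∉ Ω ∧ γ τ ∈ frontier Ω ∧ ∀ r ∈ Ioc τ t, γ r ∈ Ω := by
  push Not at h
  obtain ⟨q₀, hq₀, hq₀'⟩ := h
  have hZc : IsCompact (Icc a t ∩ γ ⁻¹' Ωᶜ) :=
    isCompact_Icc.of_isClosed_subset (hγ.preimage_isClosed_of_isClosed isClosed_Icc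
      hΩ.isClosed_compl) inter_subset_left
  obtain ⟨τ, ⟨hτ, hτ'⟩, hmax⟩ := hZc.exists_isGreatest ⟨q₀, hq₀, hq₀'⟩
  have hlt : τ < t := lt_of_le_of_ne hτ.2 fun e => hτ' (e ▸ ht)
  have hin : ∀ r ∈ Ioc τ t, γ r ∈ Ω := fun r hr => by
    by_contra hr'
    exact not_le.2 hr.1 (hmax ⟨⟨hτ.1.trans hr.1.le, hr.2⟩, hr'⟩)
  refine ⟨τ, ⟨hτ.1, hlt⟩, hτ', ?_, hin⟩
  rw [frontier, hΩ.interior_eq]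
  refine ⟨?_, hτ'⟩
  have h1 : Tendsto γ (𝓝[>] τ) (𝓝 (γ τ)) := by
    refine (hγ τ hτ).tendsto.mono_left ?_
    rw [← nhdsWithin_Ioc_eq_nhdsGT hlt]
    exact nhdsWithin_mono _ fun r hr => ⟨hτ.1.trans hr.1.le, hr.2⟩
  exact mem_closure_of_tendsto h1 (mem_of_superset (Ioc_mem_nhdsGT hlt) hin)

lemma exists_exit {Ω : Set Plane} (hΩ : IsOpen Ω) {γ : ℝ → Plane} {t b : ℝ}
    (hγ : ContinuousOn γ (Icc t b)) (ht : γ t ∈ Ω) (h : ¬ ∀ q ∈ Icc t b, γ q ∈ Ω) :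
    ∃ τ ∈ Ioc t b, γ τ ∉ Ω ∧ γ τ ∈ frontier Ω ∧ ∀ r ∈ Ico t τ, γ r ∈ Ω := by
  have h1 : ContinuousOn (fun q => γ (-q)) (Icc (-b) (-t)) :=
    hγ.comp continuousOn_neg fun q hq => ⟨by linarith [hq.2], by linarith [hq.1]⟩
  obtain ⟨τ, hτ, h2, h3, h4⟩ := exists_entrance hΩ h1 (by simpa using ht) fun hall => h fun q hq => by
    simpa using hall (-q) ⟨neg_le_neg hq.2, neg_le_neg hq.1⟩
  refine ⟨-τ, ⟨by linarith [hτ.2], by linarith [hτ.1]⟩, h2, h3, fun r hr => ?_⟩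
  simpa using h4 (-r) ⟨by linarith [hr.2], by linarith [hr.1]⟩

section Characteristics

variable {T : ℝ} {Ω : Set Plane} {X : ℝ → ℝ → Plane → Plane} {g f : ℝ → Plane → ℝ} {b h : ℝ → ℝ}
  {t : ℝ} {x : Plane}

lemma integral_source_eq (hh : ∀ r ∈ Ioo 0 T, X r t x ∈ Ω → g r (X r t x) = h r) {p q : ℝ}
    (hp : p ∈ Icc 0 T) (hq : q ∈ Icc 0 T) (hin : ∀ r ∈ uIcc p q, X r t x ∈ Ω) :
    ∫ r in p..q, g r (X r t x) = ∫ r in p..q, h r := by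
  refine intervalIntegral.integral_congr_ae ?_
  filter_upwards [ae_uIoc_of_ae_restrict (p := fun r => X r t x ∈ Ω → g r (X r t x) = h r)
    ((ae_restrict_iff' measurableSet_Ioo).2 (Eventually.of_forall hh)) hp hq] with r hr hr'
  exact hr hr' (hin r (uIoc_subset_uIcc hr'))

lemma IsTransported.eq_add_integral (hf : IsTransported T Ω X g f) (ht : t ∈ Icc 0 T) (hx : x ∈ Ω)
    (hh : ∀ r ∈ Ioo 0 T, X r t x ∈ Ω → g r (X r t x) = h r) {a : ℝ} (ha : a ∈ Icc 0 T)
    (hin : ∀ q ∈ uIcc a t, X q t x ∈ Ω) : f t x = f a (X a t x) + ∫ r in a..t, h r := by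
  rw [← integral_source_eq hh ha ht hin, ← hf t ht x hx a ha hin]; ring

/-- Value of a solution at a point whose characteristic enters the domain after the time `a`. -/
lemma IsTransported.eq_inflow (hf : IsTransported T Ω X g f) (hb : HasInflowData T Ω X b f)
    (hΩ : IsOpen Ω) (ht : t ∈ Icc 0 T) (hx : x ∈ Ω) (hX : X t t x = x)
    (hXc : ContinuousOn (fun q => X q t x) (Icc 0 T)) (hint : IntervalIntegrable h volume 0 T)
    (hh : ∀ r ∈ Ioo 0 T, X r t x ∈ Ω → g r (X r t x) = h r) {a : ℝ} (ha : a ∈ Icc 0 T)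
    (hnot : ¬ ∀ q ∈ Icc a t, X q t x ∈ Ω) :
    ∃ τ ∈ Ico a t, X τ t x ∉ Ω ∧ (∀ r ∈ Ioc τ t, X r t x ∈ Ω) ∧
      f t x = b τ + ∫ r in τ..t, h r := by
  have hT : 0 ≤ T := ht.1.trans ht.2
  obtain ⟨τ, hτ, h1, h2, h3⟩ := exists_entrance hΩ (hXc.mono (Icc_subset_Icc ha.1 ht.2))
    (by rwa [hX]) hnot
  refine ⟨τ, hτ, h1, h3, ?_⟩
  have hτ' : τ ∈ Ico 0 t := ⟨ha.1.trans hτ.1, hτ.2⟩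
  have hτT : τ ∈ Icc 0 T := ⟨hτ'.1, hτ'.2.le.trans ht.2⟩
  have l1 := hb t ht x hx τ hτ' h2 h3
  have l2 : Tendsto (fun r => ∫ q in r..t, h q) (𝓝[>] τ) (𝓝 (∫ q in τ..t, h q)) := by
    have hi : IntervalIntegrable h volume τ t := hint.mono_set (uIcc_subset_time hτT ht)
    have c := intervalIntegral.continuousOn_primitive_interval_left
      ((intervalIntegrable_iff' (by simp)).1 hi)
    refine (c τ left_mem_uIcc).tendsto.mono_left ?_
    rw [uIcc_of_le hτ.2.le, ← nhdsWithin_Ioc_eq_nhdsGT hτ.2]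
    exact nhdsWithin_mono _ Ioc_subset_Icc_self
  refine tendsto_nhds_unique (f := fun _ => f t x) tendsto_const_nhds
    ((l1.add l2).congr' ?_)
  filter_upwards [Ioc_mem_nhdsGT hτ.2] with r hr
  refine (hf.eq_add_integral ht hx hh ⟨hτ'.1.trans hr.1.le, hr.2.trans ht.2⟩ fun q hq => ?_).symm
  rw [uIcc_of_le hr.2] at hq
  exact h3 q ⟨hr.1.trans_le hq.1, hq.2⟩

/-- Value of a solution at a point whose characteristic leaves the domain before the time `a`. -/
lemma IsTransported.eq_outflow (hf : IsTransported T Ω X g f) (hb : HasOutflowData T Ω X b f)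
    (hΩ : IsOpen Ω) (ht : t ∈ Icc 0 T) (hx : x ∈ Ω) (hX : X t t x = x)
    (hXc : ContinuousOn (fun q => X q t x) (Icc 0 T)) (hint : IntervalIntegrable h volume 0 T)
    (hh : ∀ r ∈ Ioo 0 T, X r t x ∈ Ω → g r (X r t x) = h r) {a : ℝ} (ha : a ∈ Icc 0 T)
    (hnot : ¬ ∀ q ∈ Icc t a, X q t x ∈ Ω) :
    ∃ τ ∈ Ioc t a, X τ t x ∉ Ω ∧ (∀ r ∈ Ico t τ, X r t x ∈ Ω) ∧
      f t x = b τ + ∫ r in τ..t, h r := by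
  have hT : 0 ≤ T := ht.1.trans ht.2
  obtain ⟨τ, hτ, h1, h2, h3⟩ := exists_exit hΩ (hXc.mono (Icc_subset_Icc ht.1 ha.2))
    (by rwa [hX]) hnot
  refine ⟨τ, hτ, h1, h3, ?_⟩
  have hτ' : τ ∈ Ioc t T := ⟨hτ.1, hτ.2.trans ha.2⟩
  have hτT : τ ∈ Icc 0 T := ⟨ht.1.trans hτ.1.le, hτ'.2⟩
  have l1 := hb t ht x hx τ hτ' h2 h3
  have l2 : Tendsto (fun r => ∫ q in r..t, h q) (𝓝[<] τ) (𝓝 (∫ q in τ..t, h q)) := by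
    have hi : IntervalIntegrable h volume τ t := hint.mono_set (uIcc_subset_time hτT ht)
    have c := intervalIntegral.continuousOn_primitive_interval_left
      ((intervalIntegrable_iff' (by simp)).1 hi)
    refine (c τ left_mem_uIcc).tendsto.mono_left ?_
    rw [uIcc_of_ge hτ.1.le, ← nhdsWithin_Ico_eq_nhdsLT hτ.1]
    exact nhdsWithin_mono _ Ico_subset_Icc_self
  refine tendsto_nhds_unique (f := fun _ => f t x) tendsto_const_nhds
    ((l1.add l2).congr' ?_)
  filter_upwards [Ico_mem_nhdsLT hτ.1] with r hr
  refine (hf.eq_add_integral ht hx hh ⟨ht.1.trans hr.1, hr.2.le.trans hτ'.2⟩ fun q hq => ?_).symm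
  rw [uIcc_of_ge hr.1] at hq
  exact h3 q ⟨hq.1, hq.2.trans_lt hr.2⟩

/-- The characteristic through `(t, x)` stays in `Ω` between the times `r` and `t`. -/
def Stays (Ω : Set Plane) (X : ℝ → ℝ → Plane → Plane) (t : ℝ) (x : Plane) (r : ℝ) : Prop :=
  ∀ q ∈ uIcc r t, X q t x ∈ Ω

open Classical in
/-- The integral since the last entrance in `Ω`, written without reference to the entrance time, which
gives formulas that are measurable in `(t, x)`. -/
lemma integral_stays_of_entrance {τ : ℝ} (hτ : τ ∈ Ico 0 t) (h1 : X τ t x ∉ Ω)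
    (h2 : ∀ r ∈ Ioc τ t, X r t x ∈ Ω) :
    ∫ r in τ..t, h r = ∫ r in (0)..t, if Stays Ω X t x r then h r else 0 := by
  have e : ∀ r ∈ Ioc 0 t, (if Stays Ω X t x r then h r else 0) = (Ioc τ t).indicator h r := by
    intro r hr
    by_cases hrτ : r ∈ Ioc τ t
    · rw [indicator_of_mem hrτ, if_pos]
      intro q hq
      rw [uIcc_of_le hr.2] at hq
      exact h2 q ⟨hrτ.1.trans_le hq.1, hq.2⟩
    · rw [indicator_of_notMem hrτ, if_neg]
      intro hst
      refine h1 (hst τ ?_)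
      rw [uIcc_of_le hr.2]
      exact ⟨not_lt.1 fun hlt => hrτ ⟨hlt, hr.2⟩, hτ.2.le⟩
  rw [intervalIntegral.integral_of_le hτ.2.le, intervalIntegral.integral_of_le (hτ.1.trans hτ.2.le),
    setIntegral_congr_fun measurableSet_Ioc e, setIntegral_indicator measurableSet_Ioc,
    inter_eq_right.2 (Ioc_subset_Ioc_left hτ.1)]

open Classical in
lemma integral_stays_of_exit {τ : ℝ} (hτ : τ ∈ Ioc t T) (h1 : X τ t x ∉ Ω)
    (h2 : ∀ r ∈ Ico t τ, X r t x ∈ Ω) :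
    ∫ r in t..τ, h r = ∫ r in t..T, if Stays Ω X t x r then h r else 0 := by
  have e : ∀ r ∈ Ioc t T, (if Stays Ω X t x r then h r else 0) = (Ioo t τ).indicator h r := by
    intro r hr
    by_cases hrτ : r ∈ Ioo t τ
    · rw [indicator_of_mem hrτ, if_pos]
      intro q hq
      rw [uIcc_of_ge hr.1.le] at hq
      exact h2 q ⟨hq.1, hq.2.trans_lt hrτ.2⟩
    · rw [indicator_of_notMem hrτ, if_neg]
      intro hst
      refine h1 (hst τ ?_)
      rw [uIcc_of_ge hr.1.le]
      exact ⟨hτ.1.le, not_lt.1 fun hlt => hrτ ⟨hr.1, hlt⟩⟩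
  rw [intervalIntegral.integral_of_le hτ.1.le, intervalIntegral.integral_of_le (hτ.1.le.trans hτ.2),
    setIntegral_congr_fun measurableSet_Ioc e, setIntegral_indicator measurableSet_Ioo,
    inter_eq_right.2 (Ioo_subset_Ioc_self.trans (Ioc_subset_Ioc_right hτ.2)),
    integral_Ioc_eq_integral_Ioo]

open Classical in
lemma integral_stays_of_forall {a : ℝ} (hst : Stays Ω X t x a) :
    ∫ r in a..t, h r = ∫ r in a..t, if Stays Ω X t x r then h r else 0 := by
  refine intervalIntegral.integral_congr fun r hr => ?_
  have hr' : Stays Ω X t x r := fun q hq => hst q (uIcc_subset_uIcc hr right_mem_uIcc hq)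
  rw [if_pos hr']

open Classical in
/-- Integral formula for the forward density. -/
lemma IsForwardDensity.eq {sigbar : ℝ → Plane → ℝ} {u : ℝ → Plane → Plane} {ρ₀ : Plane → ℝ}
    {ρf : ℝ → Plane → ℝ} (hf : IsForwardDensity T Ω X sigbar u ρ₀ ρf)
    (hΩ : IsOpen Ω) (ht : t ∈ Icc 0 T) (hx : x ∈ Ω) (hX : X t t x = x)
    (hXc : ContinuousOn (fun q => X q t x) (Icc 0 T)) (hint : IntervalIntegrable h volume 0 T)
    (hh : ∀ r ∈ Ioo 0 T, X r t x ∈ Ω → source sigbar u r (X r t x) = h r) :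
    ρf t x = (if Stays Ω X t x 0 then ρ₀ (X 0 t x) else 0) +
      ∫ r in (0)..t, if Stays Ω X t x r then h r else 0 := by
  have h0 : (0 : ℝ) ∈ Icc 0 T := left_mem_Icc.2 (ht.1.trans ht.2)
  by_cases hst : Stays Ω X t x 0
  · rw [if_pos hst, ← integral_stays_of_forall hst, hf.eqn.eq_add_integral ht hx hh h0 hst,
      hf.initial _ (hst 0 left_mem_uIcc)]
  · have hst' : ¬ ∀ q ∈ Icc 0 t, X q t x ∈ Ω := by rwa [Stays, uIcc_of_le ht.1] at hst
    obtain ⟨τ, hτ, h1, h2, h3⟩ := hf.eqn.eq_inflow hf.inflow hΩ ht hx hX hXc hint hh h0 hst'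
    rw [if_neg hst, h3, integral_stays_of_entrance hτ h1 h2]

open Classical in
/-- Integral formula for the backward density. -/
lemma IsBackwardDensity.eq {sigbar : ℝ → Plane → ℝ} {u : ℝ → Plane → Plane}
    {ρb : ℝ → Plane → ℝ} (hf : IsBackwardDensity T Ω X sigbar u ρb)
    (hΩ : IsOpen Ω) (ht : t ∈ Icc 0 T) (hx : x ∈ Ω) (hX : X t t x = x)
    (hXc : ContinuousOn (fun q => X q t x) (Icc 0 T)) (hint : IntervalIntegrable h volume 0 T)
    (hh : ∀ r ∈ Ioo 0 T, X r t x ∈ Ω → source sigbar u r (X r t x) = h r) :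
    ρb t x = - ∫ r in t..T, if Stays Ω X t x r then h r else 0 := by
  have h0 : T ∈ Icc 0 T := right_mem_Icc.2 (ht.1.trans ht.2)
  rw [← intervalIntegral.integral_symm]
  by_cases hst : Stays Ω X t x T
  · rw [← integral_stays_of_forall hst, hf.eqn.eq_add_integral ht hx hh h0 hst,
      hf.final _ (hst T left_mem_uIcc), zero_add]
  · have hst' : ¬ ∀ q ∈ Icc t T, X q t x ∈ Ω := by rwa [Stays, uIcc_of_ge ht.2] at hst
    obtain ⟨τ, hτ, h1, h2, h3⟩ := hf.eqn.eq_outflow hf.outflow hΩ ht hx hX hXc hint hh h0 hst'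
    rw [h3, zero_add, intervalIntegral.integral_symm, integral_stays_of_exit hτ h1 h2,
      intervalIntegral.integral_symm, neg_neg]

open Classical in
/-- The cut-off is one exactly on the characteristics which stay in the domain since `T₀`. -/
lemma IsCutoff.eq {T0 : ℝ} {χ : ℝ → Plane → ℝ} (hf : IsCutoff T T0 Ω X χ) (hT0 : T0 ∈ Icc 0 T)
    (hΩ : IsOpen Ω) (ht : t ∈ Icc 0 T) (hx : x ∈ Ω) (hX : X t t x = x)
    (hXc : ContinuousOn (fun q => X q t x) (Icc 0 T)) :
    χ t x = if t < T0 ∨ Stays Ω X t x T0 then 1 else 0 := by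
  have h0 : (0 : ℝ) ∈ Icc 0 T := left_mem_Icc.2 (ht.1.trans ht.2)
  have hh : ∀ r ∈ Ioo 0 T, X r t x ∈ Ω → (fun (_ : ℝ) (_ : Plane) => (0 : ℝ)) r (X r t x) =
    (fun _ => (0 : ℝ)) r := fun _ _ _ => rfl
  split_ifs with hc
  · by_cases hst : Stays Ω X t x 0
    · rw [hf.eqn.eq_add_integral ht hx hh h0 hst, hf.initial _ (hst 0 left_mem_uIcc)]
      simp
    · have hst' : ¬ ∀ q ∈ Icc 0 t, X q t x ∈ Ω := by rwa [Stays, uIcc_of_le ht.1] at hst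
      obtain ⟨τ, hτ, h1, -, h3⟩ := hf.eqn.eq_inflow hf.inflow hΩ ht hx hX hXc
        intervalIntegrable_const hh h0 hst'
      have hlt : τ < T0 := by
        rcases hc with hc | hc
        · exact hτ.2.trans hc
        · by_contra! hle
          exact h1 (hc τ (Icc_subset_uIcc ⟨hle, hτ.2.le⟩))
      rw [h3, if_pos hlt]
      simp
  · push Not at hc
    have hst' : ¬ ∀ q ∈ Icc T0 t, X q t x ∈ Ω := by
      have := hc.2
      rwa [Stays, uIcc_of_le hc.1] at this
    obtain ⟨τ, hτ, -, -, h3⟩ := hf.eqn.eq_inflow hf.inflow hΩ ht hx hX hXc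
      intervalIntegrable_const hh hT0 hst'
    rw [h3, if_neg (not_lt.2 hτ.1)]
    simp

end Characteristics

/-- Under the assumptions which make `T₀`, `T₁` admissible, no characteristic stays in the domain
from `T₀` to `T - 2 T₁`. -/
lemma IsExitData.not_stays {T : ℝ} {Ω : Set Plane} {ybar u : ℝ → Plane → Plane}
    {Xbar X : ℝ → ℝ → Plane → Plane} {T0s T1s sig T0 T1 : ℝ}
    (h : IsExitData T Ω ybar Xbar T0s T1s sig) (hu : IsContinuousRep T u) (hmem : MemL2H2 T univ u)
    (hnorm : l2linfnorm T univ u ≤ ENNReal.ofReal (2 * sig))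
    (hX : IsFlow T (fun t x => ybar t x + u t x) X) (hT0 : T0 ∈ Ioo 0 T0s) (hT1 : T1 ∈ Ioo 0 T1s)
    (hT : T0 + 2 * T1 < T) {t : ℝ} (ht : t ∈ Icc (T - 2 * T1) T) (x : Plane) :
    ¬ Stays Ω X t x T0 := by
  classical
  intro hst
  obtain ⟨-, -, -, ε, hε, -, hex⟩ := h
  have hT0t : T0 ≤ t := by linarith [ht.1]
  have hT0I : T0 ∈ Icc 0 T := ⟨hT0.1.le, hT0t.trans ht.2⟩
  have htI : t ∈ Icc 0 T := ⟨hT0.1.le.trans hT0t, ht.2⟩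
  -- trajectories need not be known to be unique: the one through `(t, x)` is taken as the
  -- trajectory of the flow through its position at `T₀`
  set y := X T0 t x with hy
  set X' : ℝ → ℝ → Plane → Plane := fun r τ z => if τ = T0 ∧ z = y then X r t x else X r τ z with hX'
  have hflow : IsFlow T (fun t x => ybar t x + u t x) X' := by
    intro τ hτ z
    by_cases hc : τ = T0 ∧ z = y
    · obtain ⟨rfl, rfl⟩ := hc
      have e : ∀ r, X' r τ y = X r t x := fun r => if_pos ⟨rfl, rfl⟩
      simp only [e]
      have htraj := hX.isTrajectory htI x
      exact ⟨htraj.integrable, fun r hr => htraj.eqn τ hτ r hr⟩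
    · have e : ∀ r, X' r τ z = X r τ z := fun r => if_neg hc
      simp only [e]
      exact hX τ hτ z
  have hyΩ : y ∈ Ω := hst T0 left_mem_uIcc
  obtain ⟨r, hr, hd⟩ := hex u hu hmem hnorm X' hflow T0 hT0 T1 hT1 y (subset_closure hyΩ)
  have e : X' r T0 y = X r t x := if_pos ⟨rfl, rfl⟩
  rw [e, Metric.infDist_zero_of_mem (hst r (Icc_subset_uIcc ⟨hr.1, hr.2.trans ht.1⟩))] at hd
  exact not_le.2 hε hd

/-! ### Measurability and transport of integrals along the flow -/

section Transport

variable {T : ℝ} {Ω : Set Plane} {v : ℝ → Plane → Plane} {b : ℝ → ℝ} {X : ℝ → ℝ → Plane → Plane}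

/-- The flow, with times clamped to `[0,T]`; the argument is `(t, τ, x)`. -/
def clampFlow (T : ℝ) (X : ℝ → ℝ → Plane → Plane) (p : ℝ × ℝ × Plane) : Plane :=
  X (max 0 (min T p.1)) (max 0 (min T p.2.1)) p.2.2

lemma clampFlow_eq {r t : ℝ} (hr : r ∈ Icc 0 T) (ht : t ∈ Icc 0 T) (x : Plane) :
    clampFlow T X (r, t, x) = X r t x := by
  simp [clampFlow, min_eq_right hr.2, min_eq_right ht.2, max_eq_right hr.1, max_eq_right ht.1]

lemma IsRegularField.continuous_clampFlow (hT : 0 ≤ T) (hv : IsRegularField T v b)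
    (hX : IsFlow T v X) : Continuous (clampFlow T X) := by
  have h : ∀ r : ℝ, max 0 (min T r) ∈ Icc 0 T := fun r =>
    ⟨le_max_left _ _, max_le hT (min_le_left _ _)⟩
  refine (hv.continuousOn_flow hX).comp_continuous
    (f := fun p : ℝ × ℝ × Plane => (max 0 (min T p.1), max 0 (min T p.2.1), p.2.2))
    (by fun_prop) fun p => ⟨h _, h _, trivial⟩

/-- The points `(r, t, x)` such that the characteristic through `(t, x)` stays in `Ω` between the
times `r` and `t`. -/
def staySet (T : ℝ) (Ω : Set Plane) (X : ℝ → ℝ → Plane → Plane) : Set (ℝ × ℝ × Plane) :=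
  {p | ∀ q ∈ uIcc p.1 p.2.1, clampFlow T X (q, p.2) ∈ Ω}

lemma mem_staySet {r t : ℝ} (hr : r ∈ Icc 0 T) (ht : t ∈ Icc 0 T) {x : Plane} :
    (r, t, x) ∈ staySet T Ω X ↔ Stays Ω X t x r := by
  refine forall₂_congr fun q hq => ?_
  rw [clampFlow_eq (uIcc_subset_Icc hr ht hq) ht]

lemma isOpen_staySet (hΩ : IsOpen Ω) (hc : Continuous (clampFlow T X)) :
    IsOpen (staySet T Ω X) := by
  rw [isOpen_iff_mem_nhds]
  intro p hp
  have h := isCompact_Icc.eventually_forall_of_forall_eventually (x₀ := p) (K := Icc (0 : ℝ) 1)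
    (P := fun p s => clampFlow T X (AffineMap.lineMap p.1 p.2.1 s, p.2) ∈ Ω) fun s hs => by
      have hcont : Continuous fun z : (ℝ × ℝ × Plane) × ℝ =>
          clampFlow T X (AffineMap.lineMap z.1.1 z.1.2.1 z.2, z.1.2) := by
        refine hc.comp ?_
        simp only [AffineMap.lineMap_apply_ring']
        fun_prop
      refine hcont.continuousAt.eventually (hΩ.mem_nhds (hp _ ?_))
      rw [← segment_eq_uIcc, segment_eq_image_lineMap]
      exact mem_image_of_mem _ hs
  filter_upwards [h] with z hz q hq
  rw [← segment_eq_uIcc, segment_eq_image_lineMap] at hq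
  obtain ⟨s, hs, rfl⟩ := hq
  exact hz s hs

/-- The flow between two times does not concentrate the characteristics that stay in `Ω`. -/
lemma IsRegularField.lintegral_flow_le (hΩ : IsOpen Ω) (hv : IsRegularField T v b)
    (ha : IsApproximable T Ω v b) (hX : IsFlow T v X) {r t : ℝ} (hr : r ∈ Icc 0 T)
    (ht : t ∈ Icc 0 T) {H : Plane → ℝ≥0∞} (hH : Measurable H) :
    ∫⁻ x in {x | (r, t, x) ∈ staySet T Ω X}, H (clampFlow T X (r, t, x)) ≤ 2 * ∫⁻ y in Ω, H y := by
  have hc := hv.continuous_clampFlow (ht.1.trans ht.2) hX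
  have hm : Measurable fun x => clampFlow T X (r, t, x) :=
    (hc.comp (continuous_const.prodMk (continuous_const.prodMk continuous_id))).measurable
  rw [← lintegral_map hH hm, ← smul_eq_mul, ← lintegral_smul_measure]
  refine lintegral_mono' (Measure.le_iff.2 fun B hB => ?_) le_rfl
  rw [Measure.map_apply hm hB, Measure.restrict_apply (hm hB), Measure.smul_apply,
    Measure.restrict_apply hB, smul_eq_mul]
  refine (measure_mono ?_).trans (hv.volume_flow_le hΩ ha hX ht hr (B ∩ Ω))
  rintro x ⟨h1, h2⟩
  have h3 : Stays Ω X t x r := (mem_staySet hr ht).1 h2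
  refine ⟨fun q hq => h3 q (by rwa [uIcc_comm]), ?_, h3 r left_mem_uIcc⟩
  rw [← clampFlow_eq (X := X) hr ht x]
  exact h1

lemma cylMeasure_eq_prod :
    cylMeasure T Ω = (volume.restrict (Ioo 0 T)).prod (volume.restrict Ω) := by
  rw [cylMeasure, Measure.volume_eq_prod, Measure.prod_restrict]

instance : SFinite (cylMeasure T Ω) := by
  rw [cylMeasure]; infer_instance

/-- Integral over space and time of a function transported to the time `r`. -/
lemma IsRegularField.lintegral_stay_le (hT : 0 ≤ T) (hΩ : IsOpen Ω) (hv : IsRegularField T v b)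
    (ha : IsApproximable T Ω v b) (hX : IsFlow T v X) {r : ℝ} (hr : r ∈ Icc 0 T)
    {H : Plane → ℝ≥0∞} (hH : Measurable H) :
    ∫⁻ p, (staySet T Ω X).indicator (fun q => H (clampFlow T X q)) (r, p) ∂(cylMeasure T Ω) ≤
      ENNReal.ofReal T * (2 * ∫⁻ y in Ω, H y) := by
  have hc := hv.continuous_clampFlow hT hX
  have hA := (isOpen_staySet hΩ hc).measurableSet
  have hE : Measurable ((staySet T Ω X).indicator fun q => H (clampFlow T X q)) :=
    (hH.comp hc.measurable).indicator hA
  have hEr : Measurable fun p =>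
      (staySet T Ω X).indicator (fun q => H (clampFlow T X q)) (r, p) :=
    hE.comp measurable_prodMk_left
  rw [cylMeasure_eq_prod, lintegral_prod _ hEr.aemeasurable]
  calc _ ≤ ∫⁻ t in Ioo 0 T, 2 * ∫⁻ y in Ω, H y := by
        refine setLIntegral_mono' measurableSet_Ioo fun t ht => ?_
        refine le_trans ?_ (hv.lintegral_flow_le hΩ ha hX hr (Ioo_subset_Icc_self ht) hH)
        have hAx : MeasurableSet {x | (r, t, x) ∈ staySet T Ω X} := hA.preimage
          (measurable_prodMk_left.comp measurable_prodMk_left)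
        rw [← lintegral_indicator hAx]
        exact setLIntegral_le_lintegral _ _
    _ = _ := by
        rw [lintegral_const, Measure.restrict_apply_univ, Real.volume_Ioo, sub_zero, mul_comm]

/-- Integral over space and time of the transport to all times. -/
lemma IsRegularField.lintegral_lintegral_stay_le (hT : 0 ≤ T) (hΩ : IsOpen Ω)
    (hv : IsRegularField T v b) (ha : IsApproximable T Ω v b) (hX : IsFlow T v X)
    {H : ℝ × Plane → ℝ≥0∞} (hH : Measurable H) :
    ∫⁻ p, (∫⁻ r in Ioo 0 T,
      (staySet T Ω X).indicator (fun q => H (q.1, clampFlow T X q)) (r, p)) ∂(cylMeasure T Ω) ≤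
      ENNReal.ofReal T * (2 * ∫⁻ p, H p ∂(cylMeasure T Ω)) := by
  have hc := hv.continuous_clampFlow hT hX
  have hA := (isOpen_staySet hΩ hc).measurableSet
  have hE : Measurable ((staySet T Ω X).indicator fun q => H (q.1, clampFlow T X q)) :=
    (hH.comp (measurable_fst.prodMk hc.measurable)).indicator hA
  rw [lintegral_lintegral_swap (f := fun p r => (staySet T Ω X).indicator
    (fun q => H (q.1, clampFlow T X q)) (r, p)) (hE.comp measurable_swap).aemeasurable]
  calc _ ≤ ∫⁻ r in Ioo 0 T, ENNReal.ofReal T * (2 * ∫⁻ y in Ω, H (r, y)) := by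
        refine setLIntegral_mono' measurableSet_Ioo fun r hr => ?_
        exact hv.lintegral_stay_le hT hΩ ha hX (Ioo_subset_Icc_self hr)
          (hH.comp measurable_prodMk_left)
    _ = _ := by
        rw [lintegral_const_mul' _ _ ENNReal.ofReal_ne_top,
          lintegral_const_mul' _ _ ENNReal.ofNat_ne_top, cylMeasure_eq_prod,
          lintegral_prod _ hH.aemeasurable]

/-- The characteristics which come from a negligible set are negligible. -/
lemma IsRegularField.ae_notMem_of_stay (hT : 0 ≤ T) (hΩ : IsOpen Ω)
    (hv : IsRegularField T v b) (ha : IsApproximable T Ω v b) (hX : IsFlow T v X)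
    {N : Set Plane} (hN : volume.restrict Ω N = 0) :
    ∀ᵐ p ∂(cylMeasure T Ω), (0, p) ∈ staySet T Ω X → clampFlow T X (0, p) ∉ N := by
  have hc := hv.continuous_clampFlow hT hX
  have hA := (isOpen_staySet hΩ hc).measurableSet
  set N' := toMeasurable (volume.restrict Ω) N
  have hN' : MeasurableSet N' := measurableSet_toMeasurable _ _
  have hH : Measurable (N'.indicator fun _ => (1 : ℝ≥0∞)) := measurable_const.indicator hN'
  have hE : Measurable ((staySet T Ω X).indicator fun q =>
      N'.indicator (fun _ => (1 : ℝ≥0∞)) (clampFlow T X q)) := (hH.comp hc.measurable).indicator hA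
  have hE0 : Measurable fun p => (staySet T Ω X).indicator (fun q =>
      N'.indicator (fun _ => (1 : ℝ≥0∞)) (clampFlow T X q)) (0, p) :=
    hE.comp measurable_prodMk_left
  have h1 := hv.lintegral_stay_le hT hΩ ha hX (left_mem_Icc.2 hT) hH
  rw [lintegral_indicator_const hN', measure_toMeasurable, hN, mul_zero, mul_zero, mul_zero,
    nonpos_iff_eq_zero, lintegral_eq_zero_iff hE0] at h1
  filter_upwards [h1] with p hp hst hmem
  simp only [Pi.zero_apply] at hp
  rw [indicator_of_mem hst, indicator_of_mem (subset_toMeasurable _ _ hmem)] at hp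
  exact one_ne_zero hp

end Transport

/-! ### The controlled density -/

/-- `X` is the flow of the velocity `ybar + u`, which is regular, and approximable by fields that are
divergence free in `Ω`; `b` is the integrable function of time that controls this velocity. -/
structure IsPerturbedFlow (T : ℝ) (Ω : Set Plane) (ybar u : ℝ → Plane → Plane) (b : ℝ → ℝ)
    (X : ℝ → ℝ → Plane → Plane) : Prop where
  time_pos : 0 < T
  isOpen : IsOpen Ω
  regular : IsRegularField T (totalField T ybar u) b
  approximable : IsApproximable T Ω (totalField T ybar u) b
  flow : IsFlow T (totalField T ybar u) X
  rep : IsContinuousRep T u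
  memL2H2 : MemL2H2 T univ u

/-- The source term, set to zero outside of `(0,T) × Ω`. -/
def sourceOn (T : ℝ) (Ω : Set Plane) (sigbar : ℝ → Plane → ℝ) (u : ℝ → Plane → Plane)
    (p : ℝ × Plane) : ℝ :=
  (Ioo 0 T ×ˢ Ω).indicator (fun p => source sigbar u p.1 p.2) p

section Source

variable {T : ℝ} {Ω : Set Plane} {sigbar : ℝ → Plane → ℝ} {u : ℝ → Plane → Plane} {G : ℝ≥0}

lemma source_eq (hΩ : IsOpen Ω)
    (hsig : ContDiffOn ℝ 2 (Function.uncurry sigbar) (Icc 0 T ×ˢ closure Ω)) {t : ℝ}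
    (ht : t ∈ Ioo 0 T) {x : Plane} (hx : x ∈ Ω) :
    source sigbar u t x = - fderiv ℝ (Function.uncurry sigbar) (t, x) (0, u t x) := by
  rw [source, (hasFDerivAt_slice hsig ht (interior_maximal subset_closure hΩ hx)).fderiv]
  simp

lemma norm_sourceOn_le (hΩ : IsOpen Ω)
    (hsig : ContDiffOn ℝ 2 (Function.uncurry sigbar) (Icc 0 T ×ˢ closure Ω))
    (hG : ∀ t ∈ Ioo 0 T, ∀ x ∈ Ω, ‖fderiv ℝ (Function.uncurry sigbar) (t, x)‖ ≤ G)
    (p : ℝ × Plane) : ‖sourceOn T Ω sigbar u p‖ ≤ G * ‖u p.1 p.2‖ := by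
  by_cases hp : p ∈ Ioo 0 T ×ˢ Ω
  · rw [sourceOn, indicator_of_mem hp, source_eq hΩ hsig hp.1 hp.2, norm_neg]
    refine (ContinuousLinearMap.le_opNorm _ _).trans ?_
    refine mul_le_mul (hG _ hp.1 _ hp.2) ?_ (norm_nonneg _) G.2
    rw [Prod.norm_mk, norm_zero, max_eq_right (norm_nonneg _)]
  · rw [sourceOn, indicator_of_notMem hp, norm_zero]
    positivity

lemma measurable_sourceOn (hΩ : IsOpen Ω)
    (hsig : ContDiffOn ℝ 2 (Function.uncurry sigbar) (Icc 0 T ×ˢ closure Ω))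
    (hu : Measurable (Function.uncurry u)) : Measurable (sourceOn T Ω sigbar u) := by
  classical
  have hS : IsOpen (Ioo 0 T ×ˢ Ω) := isOpen_Ioo.prod hΩ
  have hc : ContinuousOn (fderiv ℝ (Function.uncurry sigbar)) (Ioo 0 T ×ˢ Ω) := by
    intro p hp
    exact ((contDiffAt_uncurry hsig hp.1 (interior_maximal subset_closure hΩ hp.2)).fderiv_right
      (m := 1) (by norm_num)).continuousAt.continuousWithinAt
  have hi : ∀ i : Fin 2, Measurable ((Ioo 0 T ×ˢ Ω).piecewise
      (fun p => fderiv ℝ (Function.uncurry sigbar) p (0, unitVec i)) 0) := fun i =>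
    ContinuousOn.measurable_piecewise (hc.clm_apply continuousOn_const) continuousOn_const
      hS.measurableSet
  have hui : ∀ i : Fin 2, Measurable fun p : ℝ × Plane => (u p.1 p.2) i := fun i =>
    (EuclideanSpace.proj i : Plane →L[ℝ] ℝ).continuous.measurable.comp hu
  have h := (Finset.univ.measurable_fun_sum fun i _ => (hui i).mul (hi i)).neg
  convert h using 1
  ext1 p
  by_cases hp : p ∈ Ioo 0 T ×ˢ Ω
  · rw [sourceOn, indicator_of_mem hp, source_eq hΩ hsig hp.1 hp.2]
    simp only [Pi.neg_apply]
    congr 1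
    have e : ((0 : ℝ), u p.1 p.2) = ∑ i : Fin 2, (u p.1 p.2) i • ((0 : ℝ), unitVec i) := by
      have hv : ∑ i : Fin 2, (u p.1 p.2) i • unitVec i = u p.1 p.2 := by
        have := (EuclideanSpace.basisFun (Fin 2) ℝ).sum_repr (u p.1 p.2)
        simpa [unitVec] using this
      refine Prod.ext ?_ ?_
      · simp
      · rw [Prod.snd_sum]; simpa using hv.symm
    rw [e, map_sum]
    simp only [map_smul, smul_eq_mul, Pi.mul_apply, piecewise_eq_of_mem _ _ _ hp]
  · rw [sourceOn, indicator_of_notMem hp]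
    simp [hp]

end Source

section Density

variable {T : ℝ} {Ω : Set Plane} {ybar u : ℝ → Plane → Plane} {b : ℝ → ℝ}
  {X : ℝ → ℝ → Plane → Plane} {sigbar : ℝ → Plane → ℝ} {G : ℝ≥0} {T0 : ℝ} {ρ₀ : Plane → ℝ}
  {ρf ρb χ : ℝ → Plane → ℝ}

/-- The source at `(r, X(r,t,x))`, if the characteristic stays in `Ω` between `r` and `t`. -/
def staySource (T : ℝ) (Ω : Set Plane) (X : ℝ → ℝ → Plane → Plane) (sigbar : ℝ → Plane → ℝ)
    (u : ℝ → Plane → Plane) : ℝ × ℝ × Plane → ℝ :=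
  (staySet T Ω X).indicator fun q => sourceOn T Ω sigbar u (q.1, clampFlow T X q)

lemma IsPerturbedFlow.measurableSet_staySet (hP : IsPerturbedFlow T Ω ybar u b X) :
    MeasurableSet (staySet T Ω X) :=
  (isOpen_staySet hP.isOpen (hP.regular.continuous_clampFlow hP.time_pos.le hP.flow)).measurableSet

lemma IsPerturbedFlow.measurable_clampFlow (hP : IsPerturbedFlow T Ω ybar u b X) :
    Measurable (clampFlow T X) :=
  (hP.regular.continuous_clampFlow hP.time_pos.le hP.flow).measurable

lemma IsPerturbedFlow.measurable_staySource (hP : IsPerturbedFlow T Ω ybar u b X)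
    (hsig : ContDiffOn ℝ 2 (Function.uncurry sigbar) (Icc 0 T ×ˢ closure Ω)) :
    Measurable (staySource T Ω X sigbar u) :=
  ((measurable_sourceOn hP.isOpen hsig hP.rep.measurable).comp
    (measurable_fst.prodMk hP.measurable_clampFlow)).indicator hP.measurableSet_staySet

/-- The controlled density in terms of the initial density `ρ₀` and the source term. The first branch
is the forward solution, the second one the backward solution. -/
def densityFormula (T T0 : ℝ) (Ω : Set Plane) (X : ℝ → ℝ → Plane → Plane) (sigbar : ℝ → Plane → ℝ)
    (u : ℝ → Plane → Plane) (ρ₀ : Plane → ℝ) (p : ℝ × Plane) : ℝ :=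
  open Classical in
  if p.1 < T0 ∨ (T0, p) ∈ staySet T Ω X then
    (staySet T Ω X).indicator (fun q => ρ₀ (clampFlow T X q)) (0, p) +
      ∫ r in Ioo 0 T, (Iic p.1).indicator (fun r => staySource T Ω X sigbar u (r, p)) r
  else -∫ r in Ioo 0 T, (Ioi p.1).indicator (fun r => staySource T Ω X sigbar u (r, p)) r

lemma IsPerturbedFlow.measurable_densityFormula (hP : IsPerturbedFlow T Ω ybar u b X)
    (hsig : ContDiffOn ℝ 2 (Function.uncurry sigbar) (Icc 0 T ×ˢ closure Ω))
    (hρ : Measurable ρ₀) : Measurable (densityFormula T T0 Ω X sigbar u ρ₀) := by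
  have hA := hP.measurableSet_staySet
  have hE := hP.measurable_staySource hsig
  have hswap : Measurable fun q : (ℝ × Plane) × ℝ => staySource T Ω X sigbar u (q.2, q.1) :=
    hE.comp measurable_swap
  refine Measurable.ite ?_ (Measurable.add ?_ ?_) (Measurable.neg ?_)
  · exact (measurableSet_lt measurable_fst measurable_const).union
      (hA.preimage measurable_prodMk_left)
  · exact ((hρ.comp hP.measurable_clampFlow).indicator hA).comp measurable_prodMk_left
  · have h : Measurable fun q : (ℝ × Plane) × ℝ =>
        (Iic q.1.1).indicator (fun r => staySource T Ω X sigbar u (r, q.1)) q.2 := by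
      have h1 := hswap.indicator (measurableSet_le (measurable_snd (α := ℝ × Plane) (β := ℝ))
        measurable_fst.fst)
      exact h1
    exact (StronglyMeasurable.integral_prod_right (f := fun (p : ℝ × Plane) (r : ℝ) =>
      (Iic p.1).indicator (fun r => staySource T Ω X sigbar u (r, p)) r)
      h.stronglyMeasurable).measurable
  · have h : Measurable fun q : (ℝ × Plane) × ℝ =>
        (Ioi q.1.1).indicator (fun r => staySource T Ω X sigbar u (r, q.1)) q.2 := by
      have h1 := hswap.indicator (measurableSet_lt measurable_fst.fst
        (measurable_snd (α := ℝ × Plane) (β := ℝ)))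
      exact h1
    exact (StronglyMeasurable.integral_prod_right (f := fun (p : ℝ × Plane) (r : ℝ) =>
      (Ioi p.1).indicator (fun r => staySource T Ω X sigbar u (r, p)) r)
      h.stronglyMeasurable).measurable

lemma IsPerturbedFlow.ae_norm_le_supMod (hP : IsPerturbedFlow T Ω ybar u b X) :
    ∀ᵐ t ∂(volume.restrict (Ioo 0 T)), ∀ x, ‖u t x‖ ≤ (supMod (u t)).toReal := by
  filter_upwards [hP.rep.continuous, ae_supMod_lt_top hP.rep hP.memL2H2] with t hc hfin x
  exact toReal_le_of_enorm_le hfin (enorm_le_supMod hc x)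

lemma IsPerturbedFlow.intervalIntegrable_sourceOn (hP : IsPerturbedFlow T Ω ybar u b X)
    (hsig : ContDiffOn ℝ 2 (Function.uncurry sigbar) (Icc 0 T ×ˢ closure Ω))
    (hG : ∀ t ∈ Ioo 0 T, ∀ x ∈ Ω, ‖fderiv ℝ (Function.uncurry sigbar) (t, x)‖ ≤ G)
    (p : ℝ × Plane) :
    IntervalIntegrable (fun r => sourceOn T Ω sigbar u (r, clampFlow T X (r, p))) volume 0 T := by
  have hT := hP.time_pos.le
  have hsup : IntervalIntegrable (fun t => (supMod (u t)).toReal) volume 0 T := by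
    have h := intervalIntegrable_totalBound hT hP.rep hP.memL2H2 0
    unfold totalBound at h
    simpa only [add_zero] using h
  rw [intervalIntegrable_iff_integrableOn_Ioo_of_le hT] at hsup ⊢
  refine (hsup.const_mul (G : ℝ)).mono' ?_ ?_
  · exact ((measurable_sourceOn hP.isOpen hsig hP.rep.measurable).comp
      (measurable_id.prodMk (hP.measurable_clampFlow.comp
        measurable_prodMk_right))).aestronglyMeasurable
  · filter_upwards [hP.ae_norm_le_supMod] with r hr
    exact (norm_sourceOn_le hP.isOpen hsig hG _).trans (by gcongr; exact hr _)

/-- The formula for the controlled density: the cut-off selects the forward or the backward solution,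
each of which is the integral of the source over the part of the characteristic that is connected to
`(t, x)` in `Ω`. -/
lemma IsPerturbedFlow.glue_eq (hP : IsPerturbedFlow T Ω ybar u b X)
    (hsig : ContDiffOn ℝ 2 (Function.uncurry sigbar) (Icc 0 T ×ˢ closure Ω))
    (hG : ∀ t ∈ Ioo 0 T, ∀ x ∈ Ω, ‖fderiv ℝ (Function.uncurry sigbar) (t, x)‖ ≤ G)
    (hf : IsForwardDensity T Ω X sigbar u ρ₀ ρf) (hb : IsBackwardDensity T Ω X sigbar u ρb)
    (hχ : IsCutoff T T0 Ω X χ) (hT0 : T0 ∈ Icc 0 T) {t : ℝ} (ht : t ∈ Ioo 0 T) {x : Plane}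
    (hx : x ∈ Ω) : glue χ ρb ρf t x = densityFormula T T0 Ω X sigbar u ρ₀ (t, x) := by
  classical
  have hT := hP.time_pos.le
  have h0 : (0 : ℝ) ∈ Icc 0 T := left_mem_Icc.2 hT
  have ht' := Ioo_subset_Icc_self ht
  have hself := hP.flow.self ht' x
  have hc := (hP.flow.isTrajectory ht' x).continuousOn hT
  set h : ℝ → ℝ := fun r => sourceOn T Ω sigbar u (r, clampFlow T X (r, t, x)) with hh_def
  have hint : IntervalIntegrable h volume 0 T := hP.intervalIntegrable_sourceOn hsig hG (t, x)
  have hh : ∀ r ∈ Ioo 0 T, X r t x ∈ Ω → source sigbar u r (X r t x) = h r := fun r hr hin => by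
    simp only [hh_def]
    rw [clampFlow_eq (Ioo_subset_Icc_self hr) ht', sourceOn,
      indicator_of_mem (show (r, X r t x) ∈ Ioo 0 T ×ˢ Ω from ⟨hr, hin⟩)]
  have hst : ∀ r ∈ Icc 0 T, (if Stays Ω X t x r then h r else 0) =
      staySource T Ω X sigbar u (r, t, x) := fun r hr => by
    rw [staySource, indicator_apply]
    simp only [mem_staySet hr ht', hh_def]
  have e1 : ∫ r in (0)..t, (if Stays Ω X t x r then h r else 0) =
      ∫ r in Ioo 0 T, (Iic t).indicator (fun r => staySource T Ω X sigbar u (r, t, x)) r := by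
    rw [intervalIntegral.integral_of_le ht.1.le, setIntegral_indicator measurableSet_Iic]
    have : Ioo 0 T ∩ Iic t = Ioc 0 t := by
      ext r; exact ⟨fun hr => ⟨hr.1.1, hr.2⟩, fun hr => ⟨⟨hr.1, hr.2.trans_lt ht.2⟩, hr.2⟩⟩
    rw [this]
    exact setIntegral_congr_fun measurableSet_Ioc fun r hr => hst r ⟨hr.1.le, hr.2.trans ht.2.le⟩
  have e2 : ∫ r in t..T, (if Stays Ω X t x r then h r else 0) =
      ∫ r in Ioo 0 T, (Ioi t).indicator (fun r => staySource T Ω X sigbar u (r, t, x)) r := by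
    rw [intervalIntegral.integral_of_le ht.2.le, setIntegral_indicator measurableSet_Ioi,
      integral_Ioc_eq_integral_Ioo]
    have : Ioo 0 T ∩ Ioi t = Ioo t T := by
      ext r; exact ⟨fun hr => ⟨hr.2, hr.1.2⟩, fun hr => ⟨⟨ht.1.trans hr.1, hr.2⟩, hr.1⟩⟩
    rw [this]
    exact setIntegral_congr_fun measurableSet_Ioo fun r hr => hst r ⟨ht.1.le.trans hr.1.le, hr.2.le⟩
  rw [glue, hχ.eq hT0 hP.isOpen ht' hx hself hc, hf.eq hP.isOpen ht' hx hself hc hint hh,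
    hb.eq hP.isOpen ht' hx hself hc hint hh, e1, e2, densityFormula, indicator_apply]
  simp only [mem_staySet hT0 ht', mem_staySet h0 ht', clampFlow_eq h0 ht']
  split_ifs <;> simp

end Density

/-! ### Weighted estimates of the controlled density -/

/-- A weight which, up to the constant `C`, is larger at `(r, X(r,t,x))` than at `(t,x)`, for `r`
before `t` if `t ≤ T'`, and for `r` after `t` if `t ≥ T₀`; the number `M` is a bound of the weight on
the characteristics that start in `Ω` at time `0`. -/
structure IsTransportWeight (T T0 T' : ℝ) (Ω : Set Plane) (X : ℝ → ℝ → Plane → Plane)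
    (W : ℝ → Plane → ℝ) (C M : ℝ) : Prop where
  nonneg : ∀ t ∈ Ioo 0 T, ∀ x ∈ Ω, 0 ≤ W t x
  initial : ∀ t ∈ Ioo 0 T, t ≤ T' → ∀ x ∈ Ω, Stays Ω X t x 0 → W t x ≤ M
  transport : ∀ t ∈ Ioo 0 T, ∀ r ∈ Ioo 0 T, ∀ x ∈ Ω, Stays Ω X t x r →
    (r ≤ t ∧ t ≤ T' ∨ t ≤ r ∧ T0 ≤ t) → W t x ≤ C * W r (X r t x)
  measurable : Measurable ((Ioo 0 T ×ˢ Ω).indicator (Function.uncurry W))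

/-- The weighted norm of `u`, set to zero outside of `(0,T) × Ω`. -/
def weightedOn (T : ℝ) (Ω : Set Plane) (W : ℝ → Plane → ℝ) (u : ℝ → Plane → Plane)
    (p : ℝ × Plane) : ℝ≥0∞ :=
  (Ioo 0 T ×ˢ Ω).indicator (fun p => ‖W p.1 p.2 • u p.1 p.2‖ₑ) p

/-- The weighted norm of `u` at `(r, X(r,t,x))`, if the characteristic stays in `Ω` between `r` and
`t`. -/
def stayWeighted (T : ℝ) (Ω : Set Plane) (X : ℝ → ℝ → Plane → Plane) (W : ℝ → Plane → ℝ)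
    (u : ℝ → Plane → Plane) : ℝ × ℝ × Plane → ℝ≥0∞ :=
  (staySet T Ω X).indicator fun q => weightedOn T Ω W u (q.1, clampFlow T X q)

section Estimate

variable {T T0 T' C M : ℝ} {Ω : Set Plane} {ybar u : ℝ → Plane → Plane} {b : ℝ → ℝ}
  {X : ℝ → ℝ → Plane → Plane} {sigbar W : ℝ → Plane → ℝ} {G : ℝ≥0} {ρ₀ : Plane → ℝ}

lemma IsTransportWeight.measurable_weightedOn (hW : IsTransportWeight T T0 T' Ω X W C M)
    (hΩ : IsOpen Ω) (hu : Measurable (Function.uncurry u)) :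
    Measurable (weightedOn T Ω W u) := by
  have hS : MeasurableSet (Ioo 0 T ×ˢ Ω) := measurableSet_Ioo.prod hΩ.measurableSet
  convert ((hW.measurable.smul hu).enorm.indicator hS) using 1
  ext1 p
  rw [weightedOn]
  by_cases hp : p ∈ Ioo 0 T ×ˢ Ω
  · rw [indicator_of_mem hp, indicator_of_mem hp]
    simp only [Pi.smul_apply', indicator_of_mem hp]
    rfl
  · rw [indicator_of_notMem hp, indicator_of_notMem hp]

lemma IsTransportWeight.measurable_stayWeighted (hW : IsTransportWeight T T0 T' Ω X W C M)
    (hP : IsPerturbedFlow T Ω ybar u b X) : Measurable (stayWeighted T Ω X W u) :=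
  ((hW.measurable_weightedOn hP.isOpen hP.rep.measurable).comp
    (measurable_fst.prodMk hP.measurable_clampFlow)).indicator hP.measurableSet_staySet

lemma IsTransportWeight.enorm_mul_staySource_le (hW : IsTransportWeight T T0 T' Ω X W C M)
    (hC : 0 ≤ C) (hΩ : IsOpen Ω)
    (hsig : ContDiffOn ℝ 2 (Function.uncurry sigbar) (Icc 0 T ×ˢ closure Ω))
    (hG : ∀ t ∈ Ioo 0 T, ∀ x ∈ Ω, ‖fderiv ℝ (Function.uncurry sigbar) (t, x)‖ ≤ G)
    {t : ℝ} (ht : t ∈ Ioo 0 T) {r : ℝ} (hr : r ∈ Ioo 0 T) {x : Plane} (hx : x ∈ Ω)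
    (hc : r ≤ t ∧ t ≤ T' ∨ t ≤ r ∧ T0 ≤ t) :
    ‖W t x‖ₑ * ‖staySource T Ω X sigbar u (r, t, x)‖ₑ ≤
      ENNReal.ofReal (C * G) * stayWeighted T Ω X W u (r, t, x) := by
  by_cases hA : (r, t, x) ∈ staySet T Ω X
  · have hst := (mem_staySet (Ioo_subset_Icc_self hr) (Ioo_subset_Icc_self ht)).1 hA
    have hyΩ : X r t x ∈ Ω := hst r left_mem_uIcc
    rw [staySource, stayWeighted, indicator_of_mem hA, indicator_of_mem hA,
      clampFlow_eq (Ioo_subset_Icc_self hr) (Ioo_subset_Icc_self ht), weightedOn,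
      indicator_of_mem (show (r, X r t x) ∈ Ioo 0 T ×ˢ Ω from ⟨hr, hyΩ⟩)]
    have h1 := hW.transport t ht r hr x hx hst hc
    have h2 := norm_sourceOn_le (u := u) hΩ hsig hG (r, X r t x)
    have h3 := hW.nonneg t ht x hx
    rw [← enorm_mul, ← ofReal_norm, ← ofReal_norm, ← ENNReal.ofReal_mul (by positivity)]
    refine ENNReal.ofReal_le_ofReal ?_
    rw [norm_mul, norm_smul, Real.norm_eq_abs, abs_of_nonneg h3,
      Real.norm_eq_abs (W r (X r t x)), abs_of_nonneg (hW.nonneg r hr _ hyΩ)]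
    calc W t x * ‖sourceOn T Ω sigbar u (r, X r t x)‖
        ≤ (C * W r (X r t x)) * (G * ‖u r (X r t x)‖) :=
          mul_le_mul h1 h2 (norm_nonneg _) (h3.trans h1)
      _ = _ := by ring
  · rw [staySource, indicator_of_notMem hA, enorm_zero, mul_zero]
    exact zero_le

/-- Pointwise estimate of the controlled density along the characteristics. -/
lemma IsTransportWeight.enorm_mul_densityFormula_le (hW : IsTransportWeight T T0 T' Ω X W C M)
    (hC : 0 ≤ C) (hΩ : IsOpen Ω) (hT0 : T0 ∈ Icc 0 T) (hT' : T0 ≤ T')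
    (hns : ∀ t ∈ Icc T' T, ∀ x, ¬ Stays Ω X t x T0)
    (hsig : ContDiffOn ℝ 2 (Function.uncurry sigbar) (Icc 0 T ×ˢ closure Ω))
    (hG : ∀ t ∈ Ioo 0 T, ∀ x ∈ Ω, ‖fderiv ℝ (Function.uncurry sigbar) (t, x)‖ ≤ G)
    {t : ℝ} (ht : t ∈ Ioo 0 T) {x : Plane} (hx : x ∈ Ω) :
    ‖W t x * densityFormula T T0 Ω X sigbar u ρ₀ (t, x)‖ₑ ≤
      ENNReal.ofReal M * (staySet T Ω X).indicator (fun q => ‖ρ₀ (clampFlow T X q)‖ₑ) (0, t, x) +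
        ENNReal.ofReal (C * G) * ∫⁻ r in Ioo 0 T, stayWeighted T Ω X W u (r, t, x) := by
  classical
  have hT : 0 ≤ T := ht.1.le.trans ht.2.le
  have ht' := Ioo_subset_Icc_self ht
  have hint : ∀ S : Set ℝ, (∀ r ∈ Ioo 0 T, r ∈ S → (r ≤ t ∧ t ≤ T' ∨ t ≤ r ∧ T0 ≤ t)) →
      ‖W t x‖ₑ * ‖∫ r in Ioo 0 T, S.indicator (fun r => staySource T Ω X sigbar u (r, t, x)) r‖ₑ ≤
      ENNReal.ofReal (C * G) * ∫⁻ r in Ioo 0 T, stayWeighted T Ω X W u (r, t, x) := by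
    intro S hS
    calc _ ≤ ‖W t x‖ₑ * ∫⁻ r in Ioo 0 T,
          ‖S.indicator (fun r => staySource T Ω X sigbar u (r, t, x)) r‖ₑ := by
          gcongr; exact enorm_integral_le_lintegral_enorm _
      _ = ∫⁻ r in Ioo 0 T,
          ‖W t x‖ₑ * ‖S.indicator (fun r => staySource T Ω X sigbar u (r, t, x)) r‖ₑ :=
          (lintegral_const_mul' _ _ enorm_ne_top).symm
      _ ≤ ∫⁻ r in Ioo 0 T, ENNReal.ofReal (C * G) * stayWeighted T Ω X W u (r, t, x) := by
          refine setLIntegral_mono' measurableSet_Ioo fun r hr => ?_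
          by_cases hrS : r ∈ S
          · rw [indicator_of_mem hrS]
            exact hW.enorm_mul_staySource_le hC hΩ hsig hG ht hr hx (hS r hr hrS)
          · rw [indicator_of_notMem hrS, enorm_zero, mul_zero]
            exact zero_le
      _ = _ := lintegral_const_mul' _ _ ENNReal.ofReal_ne_top
  rw [enorm_mul, densityFormula]
  split_ifs with hc
  · have htT' : t ≤ T' := by
      rcases hc with hc | hc
      · exact hc.le.trans hT'
      · by_contra! hlt
        exact hns t ⟨hlt.le, ht.2.le⟩ x ((mem_staySet hT0 ht').1 hc)
    refine (mul_le_mul_right (enorm_add_le _ _) _).trans ?_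
    rw [mul_add]
    refine add_le_add ?_ (hint _ fun r _ hr => Or.inl ⟨hr, htT'⟩)
    by_cases hA : (0, t, x) ∈ staySet T Ω X
    · rw [indicator_of_mem hA, indicator_of_mem hA]
      gcongr
      rw [Real.enorm_eq_ofReal (hW.nonneg t ht x hx)]
      exact ENNReal.ofReal_le_ofReal (hW.initial t ht htT' x hx
        ((mem_staySet (left_mem_Icc.2 hT) ht').1 hA))
    · rw [indicator_of_notMem hA, enorm_zero, mul_zero]
      exact zero_le
  · push Not at hc
    rw [enorm_neg]
    exact (hint _ fun r _ hr => Or.inr ⟨(mem_Ioi.1 hr).le, hc.1⟩).trans le_add_self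

lemma sq_add_le (a b : ℝ≥0∞) : (a + b) ^ 2 ≤ 4 * (a ^ 2 + b ^ 2) := by
  have h : a + b ≤ 2 * max a b := by
    rw [two_mul]; exact add_le_add (le_max_left _ _) (le_max_right _ _)
  calc (a + b) ^ 2 ≤ (2 * max a b) ^ 2 := by gcongr
    _ = 4 * max a b ^ 2 := by rw [mul_pow]; norm_num
    _ ≤ _ := by
        gcongr
        rcases max_choice a b with e | e <;> rw [e]
        · exact le_self_add
        · exact le_add_self

/-- The weighted `L²` estimate: the pointwise bound along the characteristics is integrated over the
cylinder, and the flow distorts areas by a factor `2` at most. -/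
theorem IsTransportWeight.eLpNorm_two_le (hW : IsTransportWeight T T0 T' Ω X W C M)
    (hP : IsPerturbedFlow T Ω ybar u b X) (hC : 0 ≤ C) (hT0 : T0 ∈ Icc 0 T)
    (hT' : T0 ≤ T') (hns : ∀ t ∈ Icc T' T, ∀ x, ¬ Stays Ω X t x T0)
    (hsig : ContDiffOn ℝ 2 (Function.uncurry sigbar) (Icc 0 T ×ˢ closure Ω))
    (hG : ∀ t ∈ Ioo 0 T, ∀ x ∈ Ω, ‖fderiv ℝ (Function.uncurry sigbar) (t, x)‖ ≤ G)
    (hρ : Measurable ρ₀) :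
    eLpNorm (fun p : ℝ × Plane => W p.1 p.2 * densityFormula T T0 Ω X sigbar u ρ₀ p) 2
        (cylMeasure T Ω) ≤ ENNReal.ofReal (3 * (1 + T) * (1 + C * G)) *
      (eLpNorm (fun p : ℝ × Plane => W p.1 p.2 • u p.1 p.2) 2 (cylMeasure T Ω) +
        ENNReal.ofReal M * eLpNorm ρ₀ 2 (volume.restrict Ω)) := by
  have hT := hP.time_pos.le
  have hS : MeasurableSet (Ioo 0 T ×ˢ Ω) := measurableSet_Ioo.prod hP.isOpen.measurableSet
  have hm := hW.measurable_stayWeighted hP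
  set B : ℝ × Plane → ℝ≥0∞ := fun p =>
    (staySet T Ω X).indicator (fun q => ‖ρ₀ (clampFlow T X q)‖ₑ) (0, p) with hB
  set D : ℝ × Plane → ℝ≥0∞ := fun p => ∫⁻ r in Ioo 0 T, stayWeighted T Ω X W u (r, p) with hD
  have hBm : Measurable B :=
    ((hρ.comp hP.measurable_clampFlow).enorm.indicator hP.measurableSet_staySet).comp
      measurable_prodMk_left
  have hB2 : ∫⁻ p, B p ^ 2 ∂(cylMeasure T Ω) ≤
      ENNReal.ofReal T * (2 * eLpNorm ρ₀ 2 (volume.restrict Ω) ^ 2) := by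
    have h1 := hP.regular.lintegral_stay_le hT hP.isOpen hP.approximable hP.flow
      (left_mem_Icc.2 hT) (H := fun y => ‖ρ₀ y‖ₑ ^ 2) (hρ.enorm.pow_const 2)
    rw [sq_eLpNorm_two]
    refine (lintegral_mono fun p => ?_).trans h1
    simp only [hB]
    by_cases hA : (0, p) ∈ staySet T Ω X
    · rw [indicator_of_mem hA, indicator_of_mem hA]
    · rw [indicator_of_notMem hA, indicator_of_notMem hA]; simp
  have hWu : ∫⁻ p, weightedOn T Ω W u p ^ 2 ∂(cylMeasure T Ω) =
      eLpNorm (fun p : ℝ × Plane => W p.1 p.2 • u p.1 p.2) 2 (cylMeasure T Ω) ^ 2 := by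
    rw [sq_eLpNorm_two, cylMeasure]
    refine setLIntegral_congr_fun hS fun p hp => ?_
    simp only [weightedOn, indicator_of_mem hp]
  have hD2 : ∫⁻ p, D p ^ 2 ∂(cylMeasure T Ω) ≤ ENNReal.ofReal T * (ENNReal.ofReal T *
      (2 * eLpNorm (fun p : ℝ × Plane => W p.1 p.2 • u p.1 p.2) 2 (cylMeasure T Ω) ^ 2)) := by
    have h1 := hP.regular.lintegral_lintegral_stay_le hT hP.isOpen hP.approximable hP.flow
      (H := fun p => weightedOn T Ω W u p ^ 2)
      ((hW.measurable_weightedOn hP.isOpen hP.rep.measurable).pow_const 2)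
    rw [hWu] at h1
    refine le_trans ?_ (mul_le_mul_right h1 _)
    rw [← lintegral_const_mul' _ _ ENNReal.ofReal_ne_top]
    refine lintegral_mono fun p => ?_
    have h2 := lintegral_le_sqrt_mul hT (f := fun r => stayWeighted T Ω X W u (r, p))
      (hm.comp measurable_prodMk_right).aemeasurable (Eventually.of_forall fun _ => le_rfl)
    calc D p ^ 2 ≤ (ENNReal.ofReal √T *
          (∫⁻ r in Ioo 0 T, stayWeighted T Ω X W u (r, p) ^ 2) ^ (1 / 2 : ℝ)) ^ 2 := by
          gcongr
      _ = ENNReal.ofReal T * ∫⁻ r in Ioo 0 T, stayWeighted T Ω X W u (r, p) ^ 2 := by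
          rw [mul_pow, ← ENNReal.ofReal_pow (Real.sqrt_nonneg _), Real.sq_sqrt hT,
            ← ENNReal.rpow_mul_natCast]
          norm_num
      _ = _ := by
          congr 1
          refine lintegral_congr fun r => ?_
          rw [stayWeighted]
          by_cases hA : (r, p) ∈ staySet T Ω X
          · rw [indicator_of_mem hA, indicator_of_mem hA]
          · rw [indicator_of_notMem hA, indicator_of_notMem hA]; simp
  set N₁ := eLpNorm (fun p : ℝ × Plane => W p.1 p.2 • u p.1 p.2) 2 (cylMeasure T Ω)
  set N₂ := eLpNorm ρ₀ 2 (volume.restrict Ω)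
  have hcg : (0 : ℝ) ≤ C * G := mul_nonneg hC G.2
  -- the pointwise bound is squared and integrated; `8 T ≤ (3 (1 + T))²` gives the constant
  refine (ENNReal.pow_le_pow_left_iff two_ne_zero).1 ?_
  rw [sq_eLpNorm_two]
  calc _ ≤ ∫⁻ p, 4 * ((ENNReal.ofReal M * B p) ^ 2 + (ENNReal.ofReal (C * G) * D p) ^ 2)
        ∂(cylMeasure T Ω) := by
        rw [cylMeasure]
        refine setLIntegral_mono' hS fun p hp => ?_
        refine le_trans ?_ (sq_add_le _ _)
        gcongr
        exact hW.enorm_mul_densityFormula_le hC hP.isOpen hT0 hT' hns hsig hG hp.1 hp.2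
    _ = 4 * (ENNReal.ofReal M ^ 2 * ∫⁻ p, B p ^ 2 ∂(cylMeasure T Ω) +
          ENNReal.ofReal (C * G) ^ 2 * ∫⁻ p, D p ^ 2 ∂(cylMeasure T Ω)) := by
        simp_rw [mul_pow]
        rw [lintegral_const_mul' _ _ (by norm_num), lintegral_add_left ((hBm.pow_const 2).const_mul _),
          lintegral_const_mul' _ _ (ENNReal.pow_ne_top ENNReal.ofReal_ne_top),
          lintegral_const_mul' _ _ (ENNReal.pow_ne_top ENNReal.ofReal_ne_top)]
    _ ≤ 4 * (ENNReal.ofReal M ^ 2 * (ENNReal.ofReal T * (2 * N₂ ^ 2)) +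
          ENNReal.ofReal (C * G) ^ 2 * (ENNReal.ofReal T * (ENNReal.ofReal T * (2 * N₁ ^ 2)))) := by
        gcongr
    _ = ENNReal.ofReal (8 * T) * (ENNReal.ofReal M * N₂) ^ 2 +
          ENNReal.ofReal (8 * T ^ 2 * (C * G) ^ 2) * N₁ ^ 2 := by
        have h1 : ENNReal.ofReal (8 * T) = 8 * ENNReal.ofReal T := by
          rw [ENNReal.ofReal_mul (by norm_num), ENNReal.ofReal_ofNat]
        have h2 : ENNReal.ofReal (8 * T ^ 2 * (C * G) ^ 2) =
            8 * ENNReal.ofReal T ^ 2 * ENNReal.ofReal (C * G) ^ 2 := by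
          rw [← ENNReal.ofReal_pow hT, ← ENNReal.ofReal_pow hcg,
            ENNReal.ofReal_mul (p := 8 * T ^ 2) (by positivity),
            ENNReal.ofReal_mul (p := 8) (by norm_num), ENNReal.ofReal_ofNat]
        rw [h1, h2]
        ring
    _ ≤ ENNReal.ofReal ((3 * (1 + T) * (1 + C * G)) ^ 2) * (ENNReal.ofReal M * N₂) ^ 2 +
          ENNReal.ofReal ((3 * (1 + T) * (1 + C * G)) ^ 2) * N₁ ^ 2 := by
        have h2 : 1 ≤ (1 + C * G) ^ 2 := one_le_pow₀ (by linarith)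
        have h3 : (C * G) ^ 2 ≤ (1 + C * G) ^ 2 := by gcongr; linarith
        have h4 : T ^ 2 ≤ (1 + T) ^ 2 := by gcongr; linarith
        have h5 : 8 * T ≤ 9 * (1 + T) ^ 2 := by nlinarith
        gcongr
        · calc 8 * T ≤ 9 * (1 + T) ^ 2 * 1 := by linarith
            _ ≤ 9 * (1 + T) ^ 2 * (1 + C * G) ^ 2 := by gcongr
            _ = _ := by ring
        · calc 8 * T ^ 2 * (C * G) ^ 2 ≤ 9 * (1 + T) ^ 2 * (1 + C * G) ^ 2 := by gcongr; norm_num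
            _ = _ := by ring
    _ ≤ _ := by
        rw [← mul_add, mul_pow _ (N₁ + _), ENNReal.ofReal_pow (by positivity)]
        gcongr
        rw [add_comm]
        calc N₁ ^ 2 + (ENNReal.ofReal M * N₂) ^ 2 ≤
            N₁ ^ 2 + (ENNReal.ofReal M * N₂) ^ 2 + 2 * N₁ * (ENNReal.ofReal M * N₂) := le_self_add
          _ = _ := by ring

/-- The weighted `L^∞` estimate. The pointwise bound holds everywhere, except that `ρ₀` is bounded by
its norm outside of a null set only. -/
theorem IsTransportWeight.eLpNorm_top_le (hW : IsTransportWeight T T0 T' Ω X W C M)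
    (hP : IsPerturbedFlow T Ω ybar u b X) (hC : 0 ≤ C) (hT0 : T0 ∈ Icc 0 T)
    (hT' : T0 ≤ T') (hns : ∀ t ∈ Icc T' T, ∀ x, ¬ Stays Ω X t x T0)
    (hsig : ContDiffOn ℝ 2 (Function.uncurry sigbar) (Icc 0 T ×ˢ closure Ω))
    (hG : ∀ t ∈ Ioo 0 T, ∀ x ∈ Ω, ‖fderiv ℝ (Function.uncurry sigbar) (t, x)‖ ≤ G)
    (hWc : ∀ᵐ t ∂(volume.restrict (Ioo 0 T)), Continuous fun x => W t x • u t x) :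
    eLpNorm (fun p : ℝ × Plane => W p.1 p.2 * densityFormula T T0 Ω X sigbar u ρ₀ p) ⊤
        (cylMeasure T Ω) ≤ ENNReal.ofReal (1 + C * G * √T) *
      (l2linfnorm T Ω (fun t x => W t x • u t x) +
        ENNReal.ofReal M * eLpNorm ρ₀ ⊤ (volume.restrict Ω)) := by
  have hT := hP.time_pos.le
  have hS : MeasurableSet (Ioo 0 T ×ˢ Ω) := measurableSet_Ioo.prod hP.isOpen.measurableSet
  have hm := hW.measurable_stayWeighted hP
  have hcg : (0 : ℝ) ≤ C * G := mul_nonneg hC G.2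
  have hnull : volume.restrict Ω {y | ¬ ‖ρ₀ y‖ₑ ≤ eLpNorm ρ₀ ⊤ (volume.restrict Ω)} = 0 := by
    rw [eLpNorm_exponent_top]
    exact ae_le_eLpNormEssSup (f := ρ₀)
  rw [eLpNorm_exponent_top]
  refine eLpNormEssSup_le_of_ae_enorm_bound ?_
  filter_upwards [hP.regular.ae_notMem_of_stay hT hP.isOpen hP.approximable hP.flow hnull,
    ae_restrict_mem hS] with p hp hpS
  refine (hW.enorm_mul_densityFormula_le hC hP.isOpen hT0 hT' hns hsig hG hpS.1 hpS.2).trans ?_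
  have h1 : (staySet T Ω X).indicator (fun q => ‖ρ₀ (clampFlow T X q)‖ₑ) (0, p) ≤
      eLpNorm ρ₀ ⊤ (volume.restrict Ω) := by
    by_cases hA : (0, p) ∈ staySet T Ω X
    · rw [indicator_of_mem hA]
      simpa using hp hA
    · rw [indicator_of_notMem hA]
      exact zero_le
  have h2 : ∫⁻ r in Ioo 0 T, stayWeighted T Ω X W u (r, p) ≤
      ENNReal.ofReal √T * l2linfnorm T Ω (fun t x => W t x • u t x) := by
    refine lintegral_le_sqrt_mul hT (hm.comp measurable_prodMk_right).aemeasurable ?_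
    filter_upwards [hWc] with r hr
    rw [stayWeighted]
    by_cases hA : (r, p) ∈ staySet T Ω X
    · rw [indicator_of_mem hA, weightedOn]
      by_cases hq : (r, clampFlow T X (r, p)) ∈ Ioo 0 T ×ˢ Ω
      · rw [indicator_of_mem hq]
        exact enorm_le_eLpNorm_top hr hP.isOpen hq.2
      · rw [indicator_of_notMem hq]
        exact zero_le
    · rw [indicator_of_notMem hA]
      exact zero_le
  calc _ ≤ ENNReal.ofReal M * eLpNorm ρ₀ ⊤ (volume.restrict Ω) + ENNReal.ofReal (C * G) *
        (ENNReal.ofReal √T * l2linfnorm T Ω (fun t x => W t x • u t x)) := by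
        exact add_le_add (mul_le_mul_right h1 _) (mul_le_mul_right h2 _)
    _ = 1 * (ENNReal.ofReal M * eLpNorm ρ₀ ⊤ (volume.restrict Ω)) + ENNReal.ofReal (C * G * √T) *
        l2linfnorm T Ω (fun t x => W t x • u t x) := by
        rw [ENNReal.ofReal_mul hcg, one_mul, mul_assoc]
    _ ≤ ENNReal.ofReal (1 + C * G * √T) * (ENNReal.ofReal M * eLpNorm ρ₀ ⊤ (volume.restrict Ω)) +
        ENNReal.ofReal (1 + C * G * √T) * l2linfnorm T Ω (fun t x => W t x • u t x) := by
        have h3 : 0 ≤ C * G * √T := mul_nonneg hcg (Real.sqrt_nonneg _)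
        gcongr
        · rw [ENNReal.one_le_ofReal]; linarith
        · linarith
    _ = _ := by rw [← mul_add, add_comm (ENNReal.ofReal M * _)]

end Estimate

/-! ### The two weights of the estimates -/

/-- The weight in time decreases before `T - 2 T₁` and increases after `T₀`: on a piece of
characteristic of the kind used by the controlled density, it is smallest at the endpoint `t`. -/
lemma IsTimeWeight.le_of_mem_uIcc {T T0 T1 m μ : ℝ} {θ : ℝ → ℝ} (h : IsTimeWeight T T0 T1 m μ θ)
    (hT0 : 0 < T0) (hT1 : 0 < T1) (hT : T0 + 2 * T1 < T) (hm : 0 ≤ m) (hμ : 0 ≤ μ) {r t q : ℝ}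
    (hr : r ∈ Ico 0 T) (hc : r ≤ t ∧ t ≤ T - 2 * T1 ∨ t ≤ r ∧ T0 ≤ t) (hq : q ∈ uIcc r t) :
    θ t ≤ θ q := by
  rcases hc with ⟨h1, h2⟩ | ⟨h1, h2⟩
  · rw [uIcc_of_le h1] at hq
    exact h.antitoneOn hT0 hT hμ ⟨hr.1.trans hq.1, hq.2.trans h2⟩ ⟨hr.1.trans h1, h2⟩ hq.2
  · rw [uIcc_of_ge h1] at hq
    exact h.monotoneOn hT1 hT hm ⟨h2, h1.trans_lt hr.2⟩ ⟨h2.trans hq.1, hq.2.trans_lt hr.2⟩ hq.1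

lemma muExp_nonneg {m s lam : ℝ} (hs : 0 ≤ s) : 0 ≤ muExp m s lam := by
  unfold muExp; positivity

lemma measurable_indicator_of_continuousOn {T : ℝ} {Ω : Set Plane} (hΩ : IsOpen Ω)
    {W : ℝ × Plane → ℝ} (hW : ContinuousOn W (Ioo 0 T ×ˢ Ω)) :
    Measurable ((Ioo 0 T ×ˢ Ω).indicator W) := by
  classical
  rw [← piecewise_eq_indicator]
  exact hW.measurable_piecewise continuousOn_const (measurableSet_Ioo.prod hΩ.measurableSet)

lemma transportConst_pos (T : ℝ) (K G : ℝ≥0) (sig : ℝ) : 0 < transportConst T K G sig :=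
  Real.exp_pos _

lemma one_le_transportConst {T : ℝ} {K G : ℝ≥0} {sig : ℝ} (hsig : 0 ≤ sig) :
    1 ≤ transportConst T K G sig := by
  have := sobolevConst_pos
  exact Real.one_le_exp (by positivity)

section Weights

variable {T T0 T1 sig m s lam : ℝ} {Ω O : Set Plane} {K G : ℝ≥0} {θ : ℝ → ℝ}
  {psit : ℝ → Plane → ℝ} {ybar u : ℝ → Plane → Plane} {X : ℝ → ℝ → Plane → Plane}

lemma continuousOn_aleph {S : Set Plane} (hθ : ∀ t ∈ Ico 0 T, 1 ≤ θ t)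
    (hθc : ContinuousOn θ (Ico 0 T))
    (hψ : ContinuousOn (Function.uncurry psit) (Icc 0 T ×ˢ S)) :
    ContinuousOn (Function.uncurry (aleph m s lam θ (psi m psit))) (Ico 0 T ×ˢ S) := by
  have h1 : ContinuousOn (fun p : ℝ × Plane => θ p.1) (Ico 0 T ×ˢ S) :=
    hθc.comp continuousOn_fst fun p hp => hp.1
  have h2 : ContinuousOn (fun p : ℝ × Plane => Real.exp (lam * psi m psit p.1 p.2))
      (Ico 0 T ×ˢ S) :=
    (continuousOn_const.mul ((hψ.mono (prod_mono_left Ico_subset_Icc_self)).add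
      continuousOn_const)).rexp
  refine ContinuousOn.mul (ContinuousOn.inv₀ ((h1.mul h2).pow 2) fun p hp => ?_)
    (continuousOn_const.mul (h1.mul (continuousOn_const.sub h2))).rexp
  have h3 : 0 < θ p.1 := zero_lt_one.trans_le (hθ p.1 hp.1)
  exact (pow_pos (mul_pos h3 (Real.exp_pos _)) 2).ne'

/-- The weight `ℵ` of the `L²` estimate is admissible along the perturbed flow. -/
lemma IsAdmissible.isTransportWeight_aleph
    (h : IsAdmissible T Ω O K sig m s lam θ (psi m psit) u) (hT : 0 < T) (hΩ : IsOpen Ω)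
    (hΩO : Ω ⊆ O) (hO : IsOpen O) (hOne : O.Nonempty) (hw : IsSpaceWeight T O psit)
    (htr : IsTransportedBy T Ω ybar (psi m psit))
    (hG : ∀ t ∈ Ioo 0 T, ∀ x ∈ Ω, ‖fderiv ℝ (Function.uncurry psit) (t, x)‖ ≤ G)
    (hm : 1 ≤ m) (hs : 1 ≤ s) (hl : 1 ≤ lam) (hsig : 0 ≤ sig)
    (hθ : IsTimeWeight T T0 T1 m (muExp m s lam) θ) (hT0 : 0 < T0) (hT1 : 0 < T1)
    (hTT : T0 + 2 * T1 < T) (hX : IsFlow T (totalField T ybar u) X) :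
    IsTransportWeight T T0 (T - 2 * T1) Ω X (aleph m s lam θ (psi m psit))
      (transportConst T K G sig)
      (transportConst T K G sig * Real.exp (s * phiStar O m lam θ (psi m psit) 0)) := by
  have hμ : 0 ≤ muExp m s lam := muExp_nonneg (by linarith)
  have hm0 : 0 ≤ m := by linarith
  have hθ1 : ∀ t ∈ Ico 0 T, 1 ≤ θ t := fun t ht => hθ.one_le hT0 hT1 hTT hm0 hμ ht
  have hθc := hθ.contDiffOn.continuousOn
  have h0 : (0 : ℝ) ∈ Ico 0 T := ⟨le_rfl, hT⟩
  have key : ∀ t ∈ Ioo 0 T, ∀ r ∈ Ico 0 T, ∀ x, Stays Ω X t x r →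
      (r ≤ t ∧ t ≤ T - 2 * T1 ∨ t ≤ r ∧ T0 ≤ t) → aleph m s lam θ (psi m psit) t x ≤
        transportConst T K G sig * aleph m s lam θ (psi m psit) r (X r t x) := by
    intro t ht r hr x hst hc
    have h1 := h.aleph_le_along hw hOne hO hΩO htr hG hm hs hl hsig hθ1 hθc
      (hX.isTrajectory (Ioo_subset_Icc_self ht) x) hr ht hst
      fun q hq => hθ.le_of_mem_uIcc hT0 hT1 hTT hm0 hμ hr hc hq
    rwa [hX.self (Ioo_subset_Icc_self ht)] at h1
  refine ⟨fun t ht x _ => (aleph_pos (by linarith [hθ1 t (Ioo_subset_Ico_self ht)])).le,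
    fun t ht htT' x _ hst => ?_, fun t ht r hr x _ => key t ht r (Ioo_subset_Ico_self hr) x, ?_⟩
  · refine (key t ht 0 h0 x hst (Or.inl ⟨ht.1.le, htT'⟩)).trans ?_
    gcongr
    · exact (transportConst_pos _ _ _ _).le
    · exact aleph_zero_le hw hT.le hm hs hl (hθ1 0 h0)
        (subset_closure (hΩO (hst 0 left_mem_uIcc)))
  · exact measurable_indicator_of_continuousOn hΩ ((continuousOn_aleph hθ1 hθc
      hw.contDiffOn.continuousOn).mono
      (prod_mono Ioo_subset_Ico_self (hΩO.trans subset_closure)))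

/-- The weight of the `L^∞` estimate only depends on time, so that the variation of `θ` is all that
matters. -/
lemma IsTimeWeight.isTransportWeight_linfWeight
    (hθ : IsTimeWeight T T0 T1 m (muExp m s lam) θ) (hΩ : IsOpen Ω) (hm : 0 ≤ m)
    (hs : 0 ≤ s) (hl : 0 ≤ lam) (hT0 : 0 < T0) (hT1 : 0 < T1) (hTT : T0 + 2 * T1 < T) :
    IsTransportWeight T T0 (T - 2 * T1) Ω X (fun t _ => linfWeight m s lam θ t) 1
      (Real.exp (s * bigLam m lam)) := by
  have hμ : 0 ≤ muExp m s lam := muExp_nonneg hs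
  have hL : 0 ≤ bigLam m lam := mul_nonneg hl (Real.exp_pos _).le
  have hmono : ∀ {a b : ℝ}, a ≤ b → Real.exp (s * bigLam m lam * a / 2) ≤
      Real.exp (s * bigLam m lam * b / 2) := fun hab => by gcongr
  have h0 : (0 : ℝ) ∈ Ico 0 T := ⟨le_rfl, by linarith⟩
  refine ⟨fun t _ x _ => (Real.exp_pos _).le, fun t ht htT' x _ _ => ?_,
    fun t _ r hr x _ _ hc => ?_, ?_⟩
  · have h1 : θ t ≤ θ 0 := hθ.le_of_mem_uIcc hT0 hT1 hTT hm hμ h0 (Or.inl ⟨ht.1.le, htT'⟩)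
      left_mem_uIcc
    rw [hθ.apply_zero hT0] at h1
    refine (hmono h1).trans_eq ?_
    congr 1; ring
  · rw [one_mul]
    exact hmono (hθ.le_of_mem_uIcc hT0 hT1 hTT hm hμ (Ioo_subset_Ico_self hr) hc left_mem_uIcc)
  · refine measurable_indicator_of_continuousOn hΩ ?_
    have h1 : ContinuousOn (fun p : ℝ × Plane => θ p.1) (Ioo 0 T ×ˢ Ω) :=
      hθ.contDiffOn.continuousOn.comp continuousOn_fst fun p hp => Ioo_subset_Ico_self hp.1
    exact ((continuousOn_const.mul h1).div_const 2).rexp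

/-- The flow of `ybar + û` satisfies the hypotheses of the transport estimates. -/
lemma exists_isPerturbedFlow (hT : 0 < T) (hΩ : IsOpen Ω)
    (hy : IsTargetVelocity T Ω ybar) (hrep : IsContinuousRep T u) (hdiv : IsWeaklyDivFree T Ω u)
    (hmem : MemL2H2 T univ u) (hX : IsFlow T (fun t x => ybar t x + u t x) X) :
    ∃ b, IsPerturbedFlow T Ω ybar u b X := by
  obtain ⟨L, hL⟩ := hy.lipschitz
  obtain ⟨B₀, hB₀⟩ : ∃ B₀, ∀ t ∈ Icc 0 T, ‖ybar t 0‖ ≤ B₀ :=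
    isCompact_Icc.exists_bound_of_continuousOn (f := fun t => ybar t 0)
      (hy.contDiffOn.continuousOn.comp (f := fun t : ℝ => (t, (0 : Plane))) (by fun_prop)
        fun t ht => ⟨ht, mem_univ _⟩)
  exact ⟨totalBound L u, hT, hΩ,
    isRegularField_totalField hT.le hL hrep hmem,
    isApproximable_totalField hT.le hy hL hB₀ hrep hmem hdiv,
    hX.congr fun t ht => (totalField_eq ht).symm, hrep, hmem⟩

/-- The controlled density agrees almost everywhere with the one computed from any representative of
the initial density, since the flow does not concentrate area. -/
lemma IsPerturbedFlow.glue_ae_eq {b : ℝ → ℝ} {sigbar : ℝ → Plane → ℝ} {ρ₀ g₀ : Plane → ℝ}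
    {χ ρb ρf : ℝ → Plane → ℝ} (hP : IsPerturbedFlow T Ω ybar u b X)
    (hsig : ContDiffOn ℝ 2 (Function.uncurry sigbar) (Icc 0 T ×ˢ closure Ω))
    (hG : ∀ t ∈ Ioo 0 T, ∀ x ∈ Ω, ‖fderiv ℝ (Function.uncurry sigbar) (t, x)‖ ≤ G)
    (hf : IsForwardDensity T Ω X sigbar u ρ₀ ρf) (hb : IsBackwardDensity T Ω X sigbar u ρb)
    (hχ : IsCutoff T T0 Ω X χ) (hT0 : T0 ∈ Icc 0 T) (hg : ρ₀ =ᵐ[volume.restrict Ω] g₀) :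
    Function.uncurry (glue χ ρb ρf) =ᵐ[cylMeasure T Ω] densityFormula T T0 Ω X sigbar u g₀ := by
  filter_upwards [hP.regular.ae_notMem_of_stay hP.time_pos.le hP.isOpen hP.approximable hP.flow
    (N := {y | ¬ ρ₀ y = g₀ y}) hg,
    ae_restrict_mem (measurableSet_Ioo.prod hP.isOpen.measurableSet)] with p hp hpS
  rw [Function.uncurry, hP.glue_eq hsig hG hf hb hχ hT0 hpS.1 hpS.2]
  have h1 : (staySet T Ω X).indicator (fun q => ρ₀ (clampFlow T X q)) (0, p) =
      (staySet T Ω X).indicator (fun q => g₀ (clampFlow T X q)) (0, p) := by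
    by_cases hA : (0, p) ∈ staySet T Ω X
    · rw [indicator_of_mem hA, indicator_of_mem hA]
      simpa using hp hA
    · rw [indicator_of_notMem hA, indicator_of_notMem hA]
  unfold densityFormula
  simp only [h1]

end Weights

end DensityControl

end

open DensityControl in
theorem theorem3p6
    (T : ℝ) (hT : 0 < T) (Ω O : Set Plane) (hΩ : IsC2Domain Ω) (hO : IsC2Domain O) (hΩO : Ω ⊆ O)
    (sigbar : ℝ → Plane → ℝ)
    (hsig : ContDiffOn ℝ 2 (Function.uncurry sigbar) (Icc 0 T ×ˢ closure Ω))
    (ybar : ℝ → Plane → Plane) (hy : IsTargetVelocity T Ω ybar)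
    (Xbar : ℝ → ℝ → Plane → Plane) (hXbar : IsFlow T ybar Xbar)
    (hexit : AllParticlesExit T Ω Xbar) :
    (∃ T0s T1s sig : ℝ, IsExitData T Ω ybar Xbar T0s T1s sig) ∧
    ∀ T0s T1s sig : ℝ, IsExitData T Ω ybar Xbar T0s T1s sig →
    ∀ T0 ∈ Ioo 0 T0s, ∀ T1 ∈ Ioo 0 T1s, T1 ≤ 1 / 4 → T0 + 2 * T1 < T →
    ∀ m : ℝ, 1 ≤ m →
    ∀ psit : ℝ → Plane → ℝ, IsSpaceWeight T O psit → IsTransportedBy T Ω ybar (psi m psit) →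
    ∀ K : ℝ≥0,
    ∃ C : ℝ≥0, 0 < C ∧ ∃ s₀ : ℝ, 1 ≤ s₀ ∧
    ∀ s lam : ℝ, s₀ ≤ s → 1 ≤ lam →
    ∀ θ : ℝ → ℝ, IsTimeWeight T T0 T1 m (muExp m s lam) θ →
    ∀ u : ℝ → Plane → Plane, IsAdmissible T Ω O K sig m s lam θ (psi m psit) u →
    ∀ X : ℝ → ℝ → Plane → Plane, IsFlow T (fun t x => ybar t x + u t x) X →
    ∀ ρ₀ : Plane → ℝ, MemLp ρ₀ ∞ (volume.restrict Ω) →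
    ∀ ρf ρb χ : ℝ → Plane → ℝ, IsForwardDensity T Ω X sigbar u ρ₀ ρf →
    IsBackwardDensity T Ω X sigbar u ρb → IsCutoff T T0 Ω X χ →
    AEStronglyMeasurable (Function.uncurry (glue χ ρb ρf)) (cylMeasure T Ω) ∧
    eLpNorm (fun p : ℝ × Plane => aleph m s lam θ (psi m psit) p.1 p.2 * glue χ ρb ρf p.1 p.2) 2
        (cylMeasure T Ω) ≤
      C * (eLpNorm (fun p : ℝ × Plane => aleph m s lam θ (psi m psit) p.1 p.2 • u p.1 p.2) 2
            (cylMeasure T Ω)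
          + ENNReal.ofReal (Real.exp (s * phiStar O m lam θ (psi m psit) 0))
            * eLpNorm ρ₀ 2 (volume.restrict Ω)) ∧
    eLpNorm (fun p : ℝ × Plane => linfWeight m s lam θ p.1 * glue χ ρb ρf p.1 p.2) ∞
        (cylMeasure T Ω) ≤
      C * (l2linfnorm T Ω (fun t x => linfWeight m s lam θ t • u t x)
          + ENNReal.ofReal (Real.exp (s * bigLam m lam)) * eLpNorm ρ₀ ∞ (volume.restrict Ω)) := by
  refine ⟨exists_isExitData hT hΩ.isConnected.nonempty hΩ.isBounded hy hXbar hexit, ?_⟩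
  intro T0s T1s sig hE T0 hT0 T1 hT1 _ hTT m hm psit hw htr K
  have hsig0 : 0 < sig := hE.2.2.1
  obtain ⟨Gσ, hGσ⟩ := exists_fderiv_bound hΩ.isBounded hΩ.isOpen hsig
  obtain ⟨Gψ, hGψ⟩ := exists_fderiv_bound hO.isBounded hO.isOpen hw.contDiffOn
  have hGψ' : ∀ t ∈ Ioo 0 T, ∀ x ∈ Ω, ‖fderiv ℝ (Function.uncurry psit) (t, x)‖ ≤ Gψ :=
    fun t ht x hx => hGψ t ht x (hΩO hx)
  set C₁ := transportConst T K Gψ sig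
  have hC₁ : 1 ≤ C₁ := one_le_transportConst hsig0.le
  set A : ℝ := 3 * (1 + T) * (1 + C₁ * Gσ)
  set B : ℝ := 1 + 1 * Gσ * √T
  have hA : 0 < A := by positivity
  have hB : 0 < B := by positivity
  -- the second lower bound of `s` makes `û` small enough for the exit property
  refine ⟨(A * C₁ + B).toNNReal, by rw [Real.toNNReal_pos]; positivity,
    max 1 (sobolevConst * K), le_max_left _ _, ?_⟩
  intro s lam hs₀ hl θ hθ u hu X hX ρ₀ hρ₀ ρf ρb χ hf hb hχ
  have hs : 1 ≤ s := (le_max_left _ _).trans hs₀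
  have hm0 : 0 ≤ m := by linarith
  have hTI : T0 ∈ Icc 0 T := ⟨hT0.1.le, by linarith [hT1.1]⟩
  have hTT' : T0 ≤ T - 2 * T1 := by linarith
  have hOne : O.Nonempty := hO.isConnected.nonempty
  have hθ1 : ∀ t ∈ Ico 0 T, 1 ≤ θ t := fun t ht =>
    hθ.one_le hT0.1 hT1.1 hTT hm0 (muExp_nonneg (by linarith)) ht
  have hmem := hu.memL2H2_univ hw hOne hm hs hl hθ1
  have hns : ∀ t ∈ Icc (T - 2 * T1) T, ∀ x, ¬ Stays Ω X t x T0 := fun t ht x =>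
    hE.not_stays hu.rep hmem ((hu.l2linfnorm_le hw hOne hm hs hl hθ1
      ((le_max_right _ _).trans hs₀)).trans (ENNReal.ofReal_le_ofReal (by linarith)))
      hX hT0 hT1 hTT ht x
  obtain ⟨b, hP⟩ := exists_isPerturbedFlow hT hΩ.isOpen hy hu.rep hu.divFree hmem hX
  obtain ⟨g₀, hgs, hg⟩ := hρ₀.1
  have hgm := hgs.measurable
  have hae := hP.glue_ae_eq hsig hGσ hf hb hχ hTI hg
  have hWae : ∀ W : ℝ × Plane → ℝ, (fun p : ℝ × Plane => W p * glue χ ρb ρf p.1 p.2)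
      =ᵐ[cylMeasure T Ω] fun p => W p * densityFormula T T0 Ω X sigbar u g₀ p :=
    fun W => hae.mono fun p hp => congrArg (W p * ·) hp
  refine ⟨⟨_, (hP.measurable_densityFormula hsig hgm).stronglyMeasurable, hae⟩, ?_, ?_⟩
  · rw [eLpNorm_congr_ae (hWae fun p => aleph m s lam θ (psi m psit) p.1 p.2),
      eLpNorm_congr_ae hg]
    have hW := hu.isTransportWeight_aleph hT hΩ.isOpen hΩO hO.isOpen hOne hw htr hGψ' hm hs hl
      hsig0.le hθ hT0.1 hT1.1 hTT hP.flow
    refine (hW.eLpNorm_two_le hP (by positivity) hTI hTT' hns hsig hGσ hgm).trans ?_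
    -- the constant in the bound of the initial weight is moved in front of both terms
    rw [ENNReal.ofReal_mul (p := C₁) (by positivity), mul_assoc (ENNReal.ofReal C₁)]
    set N₁ := eLpNorm (fun p : ℝ × Plane => aleph m s lam θ (psi m psit) p.1 p.2 • u p.1 p.2) 2
      (cylMeasure T Ω)
    set N₂ := ENNReal.ofReal (Real.exp (s * phiStar O m lam θ (psi m psit) 0)) *
      eLpNorm g₀ 2 (volume.restrict Ω)
    calc ENNReal.ofReal A * (N₁ + ENNReal.ofReal C₁ * N₂)
        ≤ ENNReal.ofReal A * (ENNReal.ofReal C₁ * N₁ + ENNReal.ofReal C₁ * N₂) := by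
          gcongr
          exact le_mul_of_one_le_left zero_le (ENNReal.one_le_ofReal.2 hC₁)
      _ = ENNReal.ofReal (A * C₁) * (N₁ + N₂) := by
          rw [ENNReal.ofReal_mul hA.le, mul_assoc, mul_add (ENNReal.ofReal C₁)]
      _ ≤ ENNReal.ofReal (A * C₁ + B) * (N₁ + N₂) := by
          gcongr
          linarith
      _ = _ := rfl
  · rw [eLpNorm_congr_ae (hWae fun p => linfWeight m s lam θ p.1), eLpNorm_congr_ae hg]
    have hW := hθ.isTransportWeight_linfWeight (X := X) hΩ.isOpen hm0 (zero_le_one.trans hs)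
      (zero_le_one.trans hl) hT0.1 hT1.1 hTT
    refine (hW.eLpNorm_top_le hP zero_le_one hTI hTT' hns hsig hGσ
      (hu.rep.continuous.mono fun t (ht : Continuous (u t)) =>
        ht.const_smul (linfWeight m s lam θ t))).trans ?_
    refine mul_le_mul_left (ENNReal.ofReal_le_ofReal ?_) _
    have : 0 ≤ A * C₁ := by positivity
    linarith
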